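/- **Setting.** Let $\mu$ be a Borel probability measure on a metric space $X$ with support $S_\mu$; $B(x,r)$ denotes the open ball. For $q,t\in\mathbb R$ put $$\overline{\mathscr H}^{q,t}_\mu(E)=\sup_{\delta>0}\inf\sum_i r_i^t\mu(B(x_i,r_i))^q,\qquad \mathscr H^{q,t}_\mu(E)=\sup_{F\subset E}\overline{\mathscr H}^{q,t}_\mu(F),$$ the infimum being over countable coverings of $E$ by balls with centres $x_i\in E$ and radii $r_i<\delta$, and $$\overline{\mathscr P}^{q,t}_\mu(E)=\inf_{\delta>0}\sup\sum_i r_i^t\mu(B(x_i,r_i))^q,\qquad \mathscr P^{q,t}_\mu(E)=\inf_{E\subset\bigcup_iE_i}\sum_i\overline{\mathscr P}^{q,t}_\mu(E_i),$$ the supremum being over countable families of pairwise disjoint balls with centres $x_i\in E$ and radii $r_i<\delta$ (terms in which $0$ is raised to a negative power are omitted). Olsen's functions are $b_\mu(q)=\inf\{s:\mathscr H^{q,s}_\mu(S_\mu)=0\}$ and $B_\mu(q)=\inf\{s:\mathscr P^{q,s}_\mu(S_\mu)=0\}$. Let $X_\mu(\alpha)=\{x\in S_\mu:\lim_{r\to0}\log\mu(B(x,r))/\log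 r=\alpha\}$, let $f^\ast(x)=\inf_y(xy+f(y))$, and let $\dim$, $\operatorname{Dim}$ be the Hausdorff and packing dimensions. An intersection of order $k$ at $(x_0,y_0)$ of the graphs of two analytic functions $f_1,f_2$ means that $f_1(x_0)=y_0$ and that $x_0$ is a zero of order $k$ of $f_1-f_2$. Let $c\ge2$, $\mathscr A=\{0,\dots,c-1\}$, and let $\partial\mathscr A^\ast=\mathscr A^{\mathbb N}$ carry the distance $d(x,y)=c^{-n}$ for $x\neq y$, where $n$ is the length of the largest common prefix of $x$ and $y$. Let $a,b\in(0,1)^c$ be probability vectors, indexed by $\mathscr A$, and let $(T_k)_{k\ge1}$ be integers with $T_1=1$, $T_k<T_{k+1}$, $T_{k+1}/T_k\to\infty$. Let $\mu=\mu_{a,b,T}$ be the measure on $\partial\mathscr A^\ast$ under which the letters are independent and the $j$-th letter $(j\ge 1)$ has law $a$ if $T_{2k-1}\le j<T_{2k}$ for some $k\geq 1$, and law $b$ if $T_{2k}\le j<T_{2k+1}$ for some $k\ge 1$. Let $g:\partial\mathscr A^\ast\to\partial\mathscr A^\ast$ be one of the following two generalized Gray codes (both are bijections): the one sending $\varepsilon_1\varepsilon_2\cdots$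 to the word with first letter $\varepsilon_1$ and $n$-th letter $\varepsilon_n-\varepsilon_{n-1}\bmod c$ for $n\ge2$; or the reflected one, which replaces each letter $\varepsilon_n$ by $c-1-\varepsilon_n$ if $\sum_{j=1}^{n-1}\varepsilon_jc^{\,n-1-j}$ is odd and keeps it otherwise. Let $\gamma(\varepsilon_1\varepsilon_2\cdots)=\sum_{n\ge1}\varepsilon_nc^{-n}\in[0,1]$, and let $\nu$ be the image of $\mu$ under $\gamma\circ g^{-1}$. **Statement.** 1. $\nu(E)=\mu(g(\gamma^{-1}(E)))$ for all Borel $E\subset[0,1]$, and $\nu$ is a probability measure on $[0,1]$ that is doubling: there is a constant $C$ with $\nu(B(x,2r))\le C\,\nu(B(x,r))$ for all $x\in[0,1]$, $r>0$. Moreover $\mu$ and $\nu$ share the same multifractal analysis: $b_\nu=b_\mu$ and $B_\nu=B_\mu$ on $\mathbb R$, and $\dim X_\nu(\alpha)=\dim X_\mu(\alpha)$, $\operatorname{Dim}X_\nu(\alpha)=\operatorname{Dim}X_\mu(\alpha)$ for all $\alpha\in\mathbb R$. 2. Let $c=4$ and $\theta_p(q)=\log_4(p_1^q+p_2^q+p_3^q+p_4^q)$.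 Assume that $a$ and $b$ are not permutations of each other and that $\theta_a,\theta_b$ have equal values and equal derivatives at $0$ and at $1$. Then one of the two vectors, called $h$, and the other one, called $l$, satisfy $\min_ih_i<\min_il_i$, $b_\nu=\theta_l$ and $B_\nu=\theta_h$. In particular $b_\nu$ and $B_\nu$ are real analytic on $\mathbb R$. Their graphs have intersections of order $2$ at $(0,1)$ and $(1,0)$, and $b_\nu(q)<B_\nu(q)$ for all $q\notin\{0,1\}$. For every $\alpha\in(-\log_4\max_il_i,\,-\log_4\min_il_i)$, $$\dim X_\nu(\alpha)=b_\nu^\ast(\alpha),\qquad \operatorname{Dim}X_\nu(\alpha)=B_\nu^\ast(\alpha).$$ 3. Vectors $a,b$ as in 2 exist, and so do sequences $(T_k)$ as above. Hence there is a doubling probability measure on $[0,1]$ with the properties in 2. -/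

import Mathlib

open Set Filter Topology MeasureTheory
open scoped ENNReal NNReal

namespace OlsenGray

/-! ### Multifractal Hausdorff and packing measures -/

/-- A centered `δ`-covering of `E`: a countable family of balls `ball p.1 p.2` with centres in `E`
and radii in `(0, δ)` whose union contains `E`. -/
def IsCenteredCovering {X : Type*} [PseudoMetricSpace X] (δ : ℝ) (E : Set X)
    (S : Set (X × ℝ)) : Prop :=
  S.Countable ∧ (∀ p ∈ S, p.1 ∈ E ∧ 0 < p.2 ∧ p.2 < δ) ∧ E ⊆ ⋃ p ∈ S, Metric.ball p.1 p.2

/-- A `δ`-packing of `E`: a countable family of pairwise disjoint balls with centres in `E`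
and radii in `(0, δ)`. -/
def IsPacking {X : Type*} [PseudoMetricSpace X] (δ : ℝ) (E : Set X)
    (S : Set (X × ℝ)) : Prop :=
  S.Countable ∧ (∀ p ∈ S, p.1 ∈ E ∧ 0 < p.2 ∧ p.2 < δ) ∧
    S.PairwiseDisjoint (fun p => Metric.ball p.1 p.2)

open scoped Classical in
/-- The term `r ^ t * μ (ball x r) ^ q`, where the terms that are infinite because `0` is raised
to a negative power are omitted from all sums. -/
noncomputable def weight {X : Type*} [PseudoMetricSpace X] [MeasurableSpace X]
    (μ : Measure X) (q t : ℝ) (p : X × ℝ) : ℝ≥0∞ :=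
  if q < 0 ∧ μ (Metric.ball p.1 p.2) = 0 then 0
  else ENNReal.ofReal p.2 ^ t * μ (Metric.ball p.1 p.2) ^ q

/-- The covering pre-measure attached to a weight `w` on balls. -/
noncomputable def coveringPre {X : Type*} [PseudoMetricSpace X] (w : X × ℝ → ℝ≥0∞)
    (E : Set X) : ℝ≥0∞ :=
  ⨆ (δ : ℝ) (_ : 0 < δ), ⨅ (S : Set (X × ℝ)) (_ : IsCenteredCovering δ E S), ∑' p : S, w p

/-- The centered covering measure attached to a weight `w` on balls. -/
noncomputable def coveringMeas {X : Type*} [PseudoMetricSpace X] (w : X × ℝ → ℝ≥0∞)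
    (E : Set X) : ℝ≥0∞ :=
  ⨆ (F : Set X) (_ : F ⊆ E), coveringPre w F

/-- The packing pre-measure attached to a weight `w` on balls. -/
noncomputable def packingPre {X : Type*} [PseudoMetricSpace X] (w : X × ℝ → ℝ≥0∞)
    (E : Set X) : ℝ≥0∞ :=
  ⨅ (δ : ℝ) (_ : 0 < δ), ⨆ (S : Set (X × ℝ)) (_ : IsPacking δ E S), ∑' p : S, w p

/-- The packing measure attached to a weight `w` on balls. -/
noncomputable def packingMeas {X : Type*} [PseudoMetricSpace X] (w : X × ℝ → ℝ≥0∞)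
    (E : Set X) : ℝ≥0∞ :=
  ⨅ (F : ℕ → Set X) (_ : E ⊆ ⋃ i, F i), ∑' i, packingPre w (F i)

/-- Olsen's function `b_{μ,E}`, the infimum of the `s` such that `H_μ^{q,s}(E) = 0`. -/
noncomputable def lowerOlsen {X : Type*} [PseudoMetricSpace X] [MeasurableSpace X]
    (μ : Measure X) (E : Set X) (q : ℝ) : EReal :=
  ⨅ (s : ℝ) (_ : coveringMeas (weight μ q s) E = 0), (s : EReal)

/-- Olsen's function `B_{μ,E}`, the infimum of the `s` such that `P_μ^{q,s}(E) = 0`. -/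
noncomputable def upperOlsen {X : Type*} [PseudoMetricSpace X] [MeasurableSpace X]
    (μ : Measure X) (E : Set X) (q : ℝ) : EReal :=
  ⨅ (s : ℝ) (_ : packingMeas (weight μ q s) E = 0), (s : EReal)

/-- `b_μ = b_{μ, supp μ}`. -/
noncomputable def olsenb {X : Type*} [PseudoMetricSpace X] [MeasurableSpace X]
    (μ : Measure X) (q : ℝ) : EReal :=
  lowerOlsen μ μ.support q

/-- `B_μ = B_{μ, supp μ}`. -/
noncomputable def olsenB {X : Type*} [PseudoMetricSpace X] [MeasurableSpace X]
    (μ : Measure X) (q : ℝ) : EReal :=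
  upperOlsen μ μ.support q

/-- The packing dimension of a set, through the packing measures with weights `r ^ s`. -/
noncomputable def packingDim {X : Type*} [PseudoMetricSpace X] (E : Set X) : ℝ≥0∞ :=
  ⨅ (s : ℝ≥0) (_ : packingMeas (fun p : X × ℝ => ENNReal.ofReal p.2 ^ (s : ℝ)) E = 0),
    (s : ℝ≥0∞)

/-! ### Level sets, Legendre transform, doubling measures -/

/-- The lower local dimension of `μ` at `x`. -/
noncomputable def lowerLocalDim {X : Type*} [PseudoMetricSpace X] [MeasurableSpace X]
    (μ : Measure X) (x : X) : EReal :=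
  liminf (fun r : ℝ => ((Real.log (μ.real (Metric.ball x r)) / Real.log r : ℝ) : EReal)) (𝓝[>] 0)

/-- The upper local dimension of `μ` at `x`. -/
noncomputable def upperLocalDim {X : Type*} [PseudoMetricSpace X] [MeasurableSpace X]
    (μ : Measure X) (x : X) : EReal :=
  limsup (fun r : ℝ => ((Real.log (μ.real (Metric.ball x r)) / Real.log r : ℝ) : EReal)) (𝓝[>] 0)

/-- The level set `X_μ(α)` of points of the support at which the local dimension is `α`. -/
def levelSet {X : Type*} [PseudoMetricSpace X] [MeasurableSpace X]
    (μ : Measure X) (α : ℝ) : Set X :=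
  {x ∈ μ.support | (α : EReal) ≤ lowerLocalDim μ x ∧ upperLocalDim μ x ≤ (α : EReal)}

/-- The Legendre transform `f*(x) = inf_y (x y + f y)`. -/
noncomputable def legendre (f : ℝ → EReal) (x : ℝ) : EReal :=
  ⨅ y : ℝ, ((x * y : ℝ) : EReal) + f y

/-- Doubling measures. -/
def IsDoubling {X : Type*} [PseudoMetricSpace X] [MeasurableSpace X] (μ : Measure X) : Prop :=
  ∃ C : ℝ≥0, ∀ (x : X) (r : ℝ), 0 < r →
    μ (Metric.ball x (2 * r)) ≤ C * μ (Metric.ball x r)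

/-- The graphs of `f₁` and `f₂` have an intersection of order `k` at `(x, y)`. -/
def IsIntersectionOfOrder (f₁ f₂ : ℝ → ℝ) (k : ℕ) (x y : ℝ) : Prop :=
  f₁ x = y ∧ (∀ i < k, iteratedDeriv i (f₁ - f₂) x = 0) ∧ iteratedDeriv k (f₁ - f₂) x ≠ 0

/-! ### The symbolic space -/

/-- Infinite words on the alphabet `{0, …, c - 1}`, indexed from `0`. -/
def Word (c : ℕ) : Type := ℕ → Fin c

instance (c : ℕ) : TopologicalSpace (Word c) := inferInstanceAs (TopologicalSpace (ℕ → Fin c))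
instance (c : ℕ) : MeasurableSpace (Word c) := inferInstanceAs (MeasurableSpace (ℕ → Fin c))
instance (c : ℕ) : BorelSpace (Word c) := inferInstanceAs (BorelSpace (ℕ → Fin c))

/-- The length `|x ∧ y|` of the largest common prefix of two different words. -/
noncomputable def prefixLength {c : ℕ} (x y : Word c) : ℕ :=
  PiNat.firstDiff (E := fun _ => Fin c) x y

open scoped Classical in
/-- `c ^ (-|x ∧ y|)` if `x ≠ y`, and `0` if `x = y`. -/
noncomputable def wordDist {c : ℕ} (x y : Word c) : ℝ :=
  if x = y then 0 else ((c : ℝ) ^ prefixLength x y)⁻¹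

theorem wordDist_self {c : ℕ} (x : Word c) : wordDist x x = 0 := if_pos rfl

theorem wordDist_of_ne {c : ℕ} {x y : Word c} (h : x ≠ y) :
    wordDist x y = ((c : ℝ) ^ prefixLength x y)⁻¹ := if_neg h

theorem word_one_lt {c : ℕ} {x y : Word c} (h : x ≠ y) : 1 < c := by
  by_contra hc
  have : Subsingleton (Fin c) := Fin.subsingleton_iff_le_one.2 (not_lt.1 hc)
  exact h (funext fun n => Subsingleton.elim _ _)

theorem wordDist_nonneg {c : ℕ} (x y : Word c) : 0 ≤ wordDist x y := by
  unfold wordDist; split_ifs <;> positivity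

theorem wordDist_triangle {c : ℕ} (x y z : Word c) :
    wordDist x z ≤ wordDist x y + wordDist y z := by
  by_cases hxz : x = z
  · rw [hxz, wordDist_self]
    exact add_nonneg (wordDist_nonneg _ _) (wordDist_nonneg _ _)
  by_cases hxy : x = y
  · subst hxy
    linarith [wordDist_nonneg x x]
  by_cases hyz : y = z
  · subst hyz
    linarith [wordDist_nonneg y y]
  have hc : (1 : ℝ) < c := by exact_mod_cast word_one_lt hxz
  refine le_trans ?_ (max_le_add_of_nonneg (wordDist_nonneg x y) (wordDist_nonneg y z))
  have hm : min (prefixLength x y) (prefixLength y z) ≤ prefixLength x z :=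
    PiNat.min_firstDiff_le (E := fun _ => Fin c) x y z hxz
  rw [wordDist_of_ne hxz, wordDist_of_ne hxy, wordDist_of_ne hyz, le_max_iff]
  rcases min_le_iff.1 hm with h | h
  · left
    exact inv_anti₀ (by positivity) (pow_le_pow_right₀ hc.le h)
  · right
    exact inv_anti₀ (by positivity) (pow_le_pow_right₀ hc.le h)

theorem wordDist_isOpen_iff {c : ℕ} (s : Set (Word c)) :
    IsOpen s ↔ ∀ x ∈ s, ∃ ε > 0, ∀ y, wordDist x y < ε → y ∈ s := by
  have key := PiNat.isOpen_iff_dist (E := fun _ => Fin c) s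
  refine key.trans (forall₂_congr fun x _ => ?_)
  rcases le_or_gt c 1 with hc | hc
  · have hs : ∀ y : Word c, y = x := fun y => by
      by_contra h
      exact absurd (word_one_lt h) (not_lt.2 hc)
    refine ⟨fun ⟨ε, hε, h⟩ => ⟨ε, hε, fun y _ => ?_⟩, fun ⟨ε, hε, h⟩ => ⟨ε, hε, fun y _ => ?_⟩⟩
    · exact h y (by rw [hs y]; exact lt_of_eq_of_lt (PiNat.dist_self _) hε)
    · exact h y (by rw [hs y]; exact lt_of_eq_of_lt (wordDist_self _) hε)
  have hc' : (1 : ℝ) < c := by exact_mod_cast hc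
  constructor
  · rintro ⟨ε, hε, h⟩
    obtain ⟨n, hn⟩ := exists_pow_lt_of_lt_one hε (by norm_num : (1 / 2 : ℝ) < 1)
    refine ⟨((c : ℝ) ^ n)⁻¹, by positivity, fun y hy => h y ?_⟩
    by_cases hxy : x = y
    · rw [← hxy]; exact lt_of_eq_of_lt (PiNat.dist_self _) hε
    rw [PiNat.dist_eq_of_ne hxy]
    refine lt_of_le_of_lt (pow_le_pow_of_le_one (by norm_num) (by norm_num) ?_) hn
    rw [wordDist_of_ne hxy] at hy
    exact ((pow_lt_pow_iff_right₀ hc').1 ((inv_lt_inv₀ (by positivity) (by positivity)).1 hy)).le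
  · rintro ⟨ε, hε, h⟩
    obtain ⟨n, hn⟩ := exists_pow_lt_of_lt_one hε (inv_lt_one_of_one_lt₀ hc')
    rw [inv_pow] at hn
    refine ⟨(1 / 2) ^ n, by positivity, fun y hy => h y ?_⟩
    by_cases hxy : x = y
    · subst hxy; exact lt_of_eq_of_lt (wordDist_self _) hε
    rw [PiNat.dist_eq_of_ne hxy] at hy
    rw [wordDist_of_ne hxy]
    refine lt_of_le_of_lt (inv_anti₀ (by positivity) (pow_le_pow_right₀ hc'.le ?_)) hn
    exact ((pow_lt_pow_iff_right_of_lt_one₀ (by norm_num) (by norm_num)).1 hy).le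

/-- The ultrametric `d(x, y) = c ^ (-|x ∧ y|)` on infinite words; its topology is the product
topology. -/
noncomputable instance (c : ℕ) : MetricSpace (Word c) :=
  MetricSpace.ofDistTopology wordDist wordDist_self
    (fun x y => by
      by_cases h : x = y
      · rw [h]
      · rw [wordDist_of_ne h, wordDist_of_ne (Ne.symm h)]
        unfold prefixLength
        exact congrArg (fun n => ((c : ℝ) ^ n)⁻¹) (PiNat.firstDiff_comm _ _))
    wordDist_triangle wordDist_isOpen_iff
    (fun x y h => by
      by_contra hxy
      have hc := word_one_lt hxy
      rw [wordDist_of_ne hxy, inv_eq_zero] at h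
      exact absurd h (by positivity))

/-- The cylinder of the words beginning with the first `n` letters of `x`. -/
def cyl {c : ℕ} (x : Word c) (n : ℕ) : Set (Word c) := {y | ∀ i < n, y i = x i}

/-! ### Inhomogeneous multinomial measures -/

/-- Probability vectors with all entries in `(0, 1)`. -/
def IsProbVec {c : ℕ} (a : Fin c → ℝ) : Prop := (∀ i, a i ∈ Set.Ioo (0 : ℝ) 1) ∧ ∑ i, a i = 1

/-- Sequences `T 1 = 1 < T 2 < ⋯` of integers with `T (k + 1) / T k → ∞`
(the value `T 0` is not used). -/
def IsBlockSeq (T : ℕ → ℕ) : Prop :=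
  T 1 = 1 ∧ (∀ k, 1 ≤ k → T k < T (k + 1)) ∧
    Tendsto (fun k => (T (k + 1) : ℝ) / (T k : ℝ)) atTop atTop

open scoped Classical in
/-- The vector governing the `j`-th letter (`j ≥ 1`): it is `a` when `T (2k-1) ≤ j < T (2k)` for
some `k ≥ 1`, and `b` when `T (2k) ≤ j < T (2k+1)` for some `k ≥ 1`. -/
noncomputable def letterVec {c : ℕ} (a b : Fin c → ℝ) (T : ℕ → ℕ) (j : ℕ) : Fin c → ℝ :=
  if ∃ k, 1 ≤ k ∧ T (2 * k - 1) ≤ j ∧ j < T (2 * k) then a else b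

/-- The law on letters with probabilities `p`. -/
noncomputable def letterLaw {c : ℕ} (p : Fin c → ℝ) : Measure (Fin c) :=
  ∑ i, ENNReal.ofReal (p i) • Measure.dirac i

/-- The inhomogeneous multinomial measure on infinite words: letters are independent, the one in
position `j = n + 1` having the law `letterVec a b T j`. -/
noncomputable def multinomial {c : ℕ} (a b : Fin c → ℝ) (T : ℕ → ℕ) : Measure (Word c) :=
  Measure.infinitePi (fun n : ℕ => letterLaw (letterVec a b T (n + 1)))

theorem letterLaw_singleton {c : ℕ} (p : Fin c → ℝ) (i : Fin c) :
    letterLaw p {i} = ENNReal.ofReal (p i) := by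
  classical
  simp [letterLaw, Measure.finsetSum_apply, Set.indicator_apply]

theorem isProbabilityMeasure_letterLaw {c : ℕ} {p : Fin c → ℝ} (hp : IsProbVec p) :
    IsProbabilityMeasure (letterLaw p) := by
  refine ⟨?_⟩
  simp only [letterLaw, Measure.finsetSum_apply, Measure.smul_apply, measure_univ, smul_eq_mul,
    mul_one]
  rw [← ENNReal.ofReal_sum_of_nonneg (fun i _ => (hp.1 i).1.le), hp.2, ENNReal.ofReal_one]

theorem isProbVec_letterVec {c : ℕ} {a b : Fin c → ℝ} (ha : IsProbVec a) (hb : IsProbVec b)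
    (T : ℕ → ℕ) (j : ℕ) : IsProbVec (letterVec a b T j) := by
  unfold letterVec; split_ifs <;> assumption

/-- The multinomial measure of a cylinder is the product of the probabilities of its letters. -/
theorem multinomial_cyl {c : ℕ} {a b : Fin c → ℝ} (ha : IsProbVec a) (hb : IsProbVec b)
    (T : ℕ → ℕ) (x : Word c) (n : ℕ) :
    multinomial a b T (cyl x n) =
      ∏ j ∈ Finset.range n, ENNReal.ofReal (letterVec a b T (j + 1) (x j)) := by
  have : ∀ n : ℕ, IsProbabilityMeasure (letterLaw (letterVec a b T (n + 1))) := fun n =>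
    isProbabilityMeasure_letterLaw (isProbVec_letterVec ha hb T _)
  have h : cyl x n = Set.pi (Finset.range n : Set ℕ) (fun i : ℕ => {x i}) := by
    ext y
    change (∀ i < n, y i = x i) ↔ ∀ i ∈ (Finset.range n : Set ℕ), y i ∈ ({x i} : Set (Fin c))
    simp
  rw [h, multinomial]
  refine (Measure.infinitePi_pi _ (fun i _ => MeasurableSet.singleton _)).trans ?_
  simp only [letterLaw_singleton]

/-! ### Generalized Gray codes -/

/-- The digitwise difference modulo `c`: the first letter is kept and the `n`-th letter becomes
`ε_n - ε_{n-1}` modulo `c`. -/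
def grayFun {c : ℕ} (x : Word c) : Word c
  | 0 => x 0
  | n + 1 => x (n + 1) - x n

/-- The inverse of `grayFun`. -/
def grayInv {c : ℕ} (y : Word c) : Word c
  | 0 => y 0
  | n + 1 => y (n + 1) + grayInv y n

/-- The Gray code `g` on infinite words. -/
def grayCode (c : ℕ) : Word c ≃ Word c where
  toFun := grayFun
  invFun := grayInv
  left_inv x := by
    have : NeZero c := ⟨(Fin.pos (x 0)).ne'⟩
    funext n
    induction n with
    | zero => rfl
    | succ n ih =>
      change x (n + 1) - x n + grayInv (grayFun x) n = x (n + 1)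
      rw [ih, sub_add_cancel]
  right_inv y := by
    have : NeZero c := ⟨(Fin.pos (y 0)).ne'⟩
    funext n
    cases n with
    | zero => rfl
    | succ n =>
      change y (n + 1) + grayInv y n - grayInv y n = y (n + 1)
      rw [add_sub_cancel_right]

/-- The rank `∑_{j < n} ε_{n - j} c ^ j` of the prefix `ε_1 ⋯ ε_n` in the natural enumeration. -/
def prefixRank {c : ℕ} (x : Word c) : ℕ → ℕ
  | 0 => 0
  | n + 1 => c * prefixRank x n + x n

/-- `c - 1 - j` when `m` is odd and `j` when `m` is even. -/
def flipDigit {c : ℕ} (m : ℕ) (j : Fin c) : Fin c := if Odd m then j.rev else j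

theorem flipDigit_flipDigit {c : ℕ} (m : ℕ) (j : Fin c) : flipDigit m (flipDigit m j) = j := by
  unfold flipDigit; split_ifs <;> simp

/-- The reflected code: a letter `j` following the prefix `w` becomes `c - 1 - j` when the rank of
`w` is odd, and is kept when it is even. -/
def reflectedFun {c : ℕ} (x : Word c) : Word c := fun n => flipDigit (prefixRank x n) (x n)

/-- The rank of the prefixes of the preimage of `y` under `reflectedFun`. -/
def reflectedRank {c : ℕ} (y : Word c) : ℕ → ℕ
  | 0 => 0
  | n + 1 => c * reflectedRank y n + flipDigit (reflectedRank y n) (y n)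

/-- The inverse of `reflectedFun`. -/
def reflectedInv {c : ℕ} (y : Word c) : Word c := fun n => flipDigit (reflectedRank y n) (y n)

theorem reflectedRank_reflectedFun {c : ℕ} (x : Word c) (n : ℕ) :
    reflectedRank (reflectedFun x) n = prefixRank x n := by
  induction n with
  | zero => rfl
  | succ n ih => simp only [reflectedRank, prefixRank, ih, reflectedFun, flipDigit_flipDigit]

theorem prefixRank_reflectedInv {c : ℕ} (y : Word c) (n : ℕ) :
    prefixRank (reflectedInv y) n = reflectedRank y n := by
  induction n with
  | zero => rfl
  | succ n ih => simp only [reflectedRank, prefixRank, ih, reflectedInv]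

/-- The reflected Gray code on infinite words. -/
def reflectedGrayCode (c : ℕ) : Word c ≃ Word c where
  toFun := reflectedFun
  invFun := reflectedInv
  left_inv x := by
    funext n
    simp only [reflectedInv, reflectedRank_reflectedFun]
    exact flipDigit_flipDigit _ _
  right_inv y := by
    funext n
    simp only [reflectedFun, prefixRank_reflectedInv]
    exact flipDigit_flipDigit _ _

/-- The generalized Gray codes: the difference code and the reflected code. -/
def grayCodes (c : ℕ) : Set (Word c ≃ Word c) := {grayCode c, reflectedGrayCode c}

/-! ### Image measures on the unit interval -/

/-- The map `γ(x) = ∑_{n ≥ 1} ε_n c ^ (-n)` from infinite words to `[0, 1]`. -/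
noncomputable def gammaMap {c : ℕ} (x : Word c) : unitInterval :=
  ⟨Real.ofDigits x, Real.ofDigits_nonneg _, Real.ofDigits_le_one _⟩

/-- The image of `μ` under `γ ∘ g⁻¹`. -/
noncomputable def grayImage {c : ℕ} (g : Word c ≃ Word c) (μ : Measure (Word c)) :
    Measure unitInterval :=
  μ.map (fun x => gammaMap (g.symm x))

/-! ### Tangent pairs of probability vectors -/

/-- `θ_a(q) = log_c (a_1 ^ q + ⋯ + a_c ^ q)`. -/
noncomputable def theta {c : ℕ} (a : Fin c → ℝ) (q : ℝ) : ℝ := Real.logb c (∑ i, a i ^ q)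

/-- Two probability vectors that are not permutations of each other and whose functions `θ` have
the same values and the same derivatives at `0` and `1`. -/
def IsTangentPair {c : ℕ} (a b : Fin c → ℝ) : Prop :=
  IsProbVec a ∧ IsProbVec b ∧ (¬ ∃ σ : Equiv.Perm (Fin c), a ∘ σ = b) ∧
    theta a 0 = theta b 0 ∧ theta a 1 = theta b 1 ∧
    deriv (theta a) 0 = deriv (theta b) 0 ∧ deriv (theta a) 1 = deriv (theta b) 1

end OlsenGray

/-! Transfer to the interval. The coding `γ ∘ g⁻¹` of the interval by words is onto and 1-Lipschitz,
and two points less than `c ^ (-n)` apart have cylinders of generation `n` that are equal or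
neighbours in the natural order. Neighbouring prefixes may differ in many letters because of
carries, but the Gray code turns them into prefixes differing in at most one place, so their masses
under a product measure agree up to a bounded factor. Hence the ball of radius `r` around the image
of `x` and the ball of words `B(x, r)` have comparable masses (`IsDoublingCoding.map_ball_le`).
Doubling and the equality of level sets follow. Coverings transfer because an interval pulls back
into at most three cylinders of comparable size (`IsCoding.coveringMeas_preimage_null`). Packings
transfer because cylinders of one generation with ranks of one parity have separated images; summing
over generations costs an arbitrarily small increase of the exponent, invisible in the infima
(`IsCoding.packingMeas_preimage_null`).

Olsen's functions on words. Suppose `θ_l ≤ θ_h`. Replacing each law `p` by the law proportional to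
`p ^ q` gives an auxiliary measure under which a cylinder `C` of generation `n` has mass `μ(C) ^ q *
c ^ (-S_n)`, where `S_n` sums `n` terms equal to `θ_l(q)` or `θ_h(q)` (`logMass_mix_tilt`). Always
`n θ_l ≤ S_n ≤ n θ_h`, and since `T (k + 1) / T k → ∞` both extremes are approached at infinitely
many generations. A covering may choose its generation, and so may a packing, which gives `b = θ_l`
and `B = θ_h`.

Level sets. The upper bounds come from the vanishing Olsen measures. For the lower bounds, `l` and
`h` are tilted with two different exponents, the minimizers of `α q + θ_l(q)` and `α q + θ_h(q)`:
both tilted laws then produce the same local dimension `α`, and their entropies are the two Legendre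
transforms. By the strong law the resulting product measure is carried by the level set, and its
mass on cylinders gives both dimensions (`le_dimH_levelSet_mix`, `le_packingDim_levelSet_mix`).

Order of the two functions. In terms of the logarithms of the entries, tangency says that the sums
of `x`, `exp x` and `x * exp x` agree. Convexity of `exp` forces the two sorted vectors to interlace
(`EqualMoments.interlaced`). A repeated use of Rolle's theorem then shows that the sums of `exp (q
x)` differ for `q ≠ 0, 1`, and that the second derivatives differ at `0` and `1`
(`Interlaced.sum_ne`). The smaller minimal entry decides the sign for very negative `q`, and the
sign persists across the double zeros. -/

namespace OlsenGray

/-! ### Null sets of covering and packing measures -/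

section General

variable {X : Type*} [PseudoMetricSpace X] {w w' : X × ℝ → ℝ≥0∞} {E F : Set X}

theorem ENNReal_exists_mul_le {K ε : ℝ≥0∞} (hK : K ≠ ⊤) (hε : ε ≠ 0) :
    ∃ ε' : ℝ≥0∞, ε' ≠ 0 ∧ K * ε' ≤ ε := by
  refine ⟨ε / (K + 1), ENNReal.div_ne_zero.2 ⟨hε, by finiteness⟩, ?_⟩
  calc K * (ε / (K + 1)) ≤ (K + 1) * (ε / (K + 1)) := by gcongr; exact le_self_add
    _ ≤ ε := ENNReal.mul_div_le

theorem tsum_image_le_tsum {α β : Type*} (f : β → ℝ≥0∞) (g : α → β) (s : Set α) :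
    ∑' y : g '' s, f y ≤ ∑' x : s, f (g x) :=
  ENNReal.tsum_le_tsum_comp_of_surjective (f := fun x : s => (⟨g x, x, x.2, rfl⟩ : g '' s))
    (fun ⟨_, x, hx, h⟩ => ⟨⟨x, hx⟩, Subtype.ext h⟩) fun y : g '' s => f y

theorem coveringPre_eq_zero_iff :
    coveringPre w E = 0 ↔ ∀ δ : ℝ, 0 < δ → ∀ ε : ℝ≥0∞, ε ≠ 0 →
      ∃ S, IsCenteredCovering δ E S ∧ ∑' p : S, w p ≤ ε := by
  simp only [coveringPre, ENNReal.iSup_eq_zero]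
  refine forall₂_congr fun δ _ => ⟨fun h ε hε => ?_, fun h => ?_⟩
  · have : (⨅ (S : Set (X × ℝ)) (_ : IsCenteredCovering δ E S), ∑' p : S, w p) < ε := by
      rw [h]; exact pos_iff_ne_zero.2 hε
    simp only [iInf_lt_iff, exists_prop] at this
    obtain ⟨S, hS, hlt⟩ := this
    exact ⟨S, hS, hlt.le⟩
  · refine nonpos_iff_eq_zero.1 (le_of_forall_pos_le_add fun ε hε => ?_)
    obtain ⟨S, hS, hle⟩ := h ε hε.ne'
    exact (iInf₂_le S hS).trans (hle.trans (by simp))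

theorem coveringMeas_eq_zero_iff :
    coveringMeas w E = 0 ↔ ∀ F ⊆ E, coveringPre w F = 0 := by
  simp only [coveringMeas, ENNReal.iSup_eq_zero]

theorem coveringMeas_null_mono (h : F ⊆ E) (hE : coveringMeas w E = 0) :
    coveringMeas w F = 0 :=
  coveringMeas_eq_zero_iff.2 fun G hG => coveringMeas_eq_zero_iff.1 hE G (hG.trans h)

/-- A weight dominated on small balls by a weight with vanishing covering measure has vanishing
covering measure. -/
theorem coveringMeas_null_of_le {δ₀ : ℝ} (hδ₀ : 0 < δ₀) {K : ℝ≥0∞} (hK : K ≠ ⊤)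
    (hw : ∀ x ∈ E, ∀ r, 0 < r → r < δ₀ → w (x, r) ≤ K * w' (x, r))
    (h : coveringMeas w' E = 0) : coveringMeas w E = 0 := by
  rw [coveringMeas_eq_zero_iff] at h ⊢
  intro F hF
  have h := h F hF
  rw [coveringPre_eq_zero_iff] at h ⊢
  intro δ hδ ε hε
  obtain ⟨ε', hε', hle⟩ := ENNReal_exists_mul_le hK hε
  obtain ⟨S, ⟨hc, hS, hcov⟩, hsum⟩ := h (min δ δ₀) (lt_min hδ hδ₀) ε' hε'
  refine ⟨S, ⟨hc, fun p hp => ?_, hcov⟩, ?_⟩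
  · exact ⟨(hS p hp).1, (hS p hp).2.1, (hS p hp).2.2.trans_le (min_le_left _ _)⟩
  · calc ∑' p : S, w p ≤ ∑' p : S, K * w' p := ENNReal.tsum_le_tsum fun p =>
          hw _ (hF (hS p p.2).1) _ (hS p p.2).2.1 ((hS p p.2).2.2.trans_le (min_le_right _ _))
      _ = K * ∑' p : S, w' p := ENNReal.tsum_mul_left
      _ ≤ K * ε' := by gcongr
      _ ≤ ε := hle

/-- Centres must lie in the covered set, so a cover of `E i` need not serve for a subset of it. The
supremum over subsets in `coveringMeas` supplies covers of each `F ∩ E i`, and their union is a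
centred cover of `F`. -/
theorem coveringMeas_iUnion_null {E : ℕ → Set X} (h : ∀ i, coveringMeas w (E i) = 0) :
    coveringMeas w (⋃ i, E i) = 0 := by
  rw [coveringMeas_eq_zero_iff]
  intro F hF
  rw [coveringPre_eq_zero_iff]
  intro δ hδ ε hε
  obtain ⟨ε', hε', hsum⟩ := ENNReal.exists_pos_sum_of_countable' hε ℕ
  have := fun i => coveringPre_eq_zero_iff.1
    (coveringMeas_eq_zero_iff.1 (h i) (F ∩ E i) inter_subset_right) δ hδ (ε' i) (hε' i).ne'
  choose S hS hSle using this
  refine ⟨⋃ i, S i, ⟨countable_iUnion fun i => (hS i).1, fun p hp => ?_, fun x hx => ?_⟩, ?_⟩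
  · obtain ⟨i, hi⟩ := mem_iUnion.1 hp
    exact ⟨((hS i).2.1 p hi).1.1, ((hS i).2.1 p hi).2⟩
  · obtain ⟨i, hi⟩ := mem_iUnion.1 (hF hx)
    obtain ⟨p, hp, hxp⟩ := mem_iUnion₂.1 ((hS i).2.2 ⟨hx, hi⟩)
    exact mem_iUnion₂.2 ⟨p, mem_iUnion.2 ⟨i, hp⟩, hxp⟩
  · calc ∑' p : ⋃ i, S i, w p ≤ ∑' i, ∑' p : S i, w p := ENNReal.tsum_iUnion_le_tsum w S
      _ ≤ ∑' i, ε' i := ENNReal.tsum_le_tsum hSle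
      _ ≤ ε := hsum.le

/-- Mass distribution principle for the covering measures. -/
theorem measure_null_of_coveringMeas_null [MeasurableSpace X] (m : Measure X) {δ₀ : ℝ}
    (hδ₀ : 0 < δ₀) {K : ℝ≥0∞} (hK : K ≠ ⊤)
    (hw : ∀ x ∈ E, ∀ r, 0 < r → r < δ₀ → m (Metric.ball x r) ≤ K * w (x, r))
    (h : coveringMeas w E = 0) : m E = 0 := by
  have h := coveringMeas_eq_zero_iff.1 h E subset_rfl
  refine nonpos_iff_eq_zero.1 (le_of_forall_pos_le_add fun ε hε => ?_)
  obtain ⟨ε', hε', hle⟩ := ENNReal_exists_mul_le hK hε.ne'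
  obtain ⟨S, ⟨hc, hS, hcov⟩, hsum⟩ := coveringPre_eq_zero_iff.1 h δ₀ hδ₀ ε' hε'
  calc m E ≤ m (⋃ p ∈ S, Metric.ball p.1 p.2) := measure_mono hcov
    _ ≤ ∑' p : S, m (Metric.ball p.1.1 p.1.2) := measure_biUnion_le m hc _
    _ ≤ ∑' p : S, K * w p := ENNReal.tsum_le_tsum fun p =>
        hw _ (hS p p.2).1 _ (hS p p.2).2.1 (hS p p.2).2.2
    _ = K * ∑' p : S, w p := ENNReal.tsum_mul_left
    _ ≤ K * ε' := by gcongr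
    _ ≤ 0 + ε := by simpa using hle

theorem IsPacking.mono {δ δ' : ℝ} {S : Set (X × ℝ)} (h : IsPacking δ E S) (hδ : δ ≤ δ')
    (hE : E ⊆ F) : IsPacking δ' F S :=
  ⟨h.1, fun p hp => ⟨hE (h.2.1 p hp).1, (h.2.1 p hp).2.1, (h.2.1 p hp).2.2.trans_le hδ⟩, h.2.2⟩

theorem packingPre_le {δ : ℝ} (hδ : 0 < δ) {D : ℝ≥0∞}
    (h : ∀ S, IsPacking δ E S → ∑' p : S, w p ≤ D) : packingPre w E ≤ D :=
  (iInf₂_le δ hδ).trans (iSup₂_le h)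

theorem exists_of_packingPre_lt {D : ℝ≥0∞} (h : packingPre w E < D) :
    ∃ δ, 0 < δ ∧ ∀ S, IsPacking δ E S → ∑' p : S, w p ≤ D := by
  simp only [packingPre, iInf_lt_iff, exists_prop] at h
  obtain ⟨δ, hδ, hlt⟩ := h
  exact ⟨δ, hδ, fun S hS => (le_iSup₂ (f := fun S (_ : IsPacking δ E S) => ∑' p : S, w p) S hS).trans
    hlt.le⟩

theorem packingPre_empty : packingPre w ∅ = 0 :=
  nonpos_iff_eq_zero.1 <| packingPre_le one_pos fun S hS => by
    have : S = ∅ := eq_empty_of_forall_notMem fun p hp => (hS.2.1 p hp).1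
    subst this; simp

theorem packingMeas_le_packingPre : packingMeas w E ≤ packingPre w E := by
  refine (iInf₂_le (fun n : ℕ => if n = 0 then E else ∅)
    fun x hx => mem_iUnion.2 ⟨0, by simpa using hx⟩).trans ?_
  rw [tsum_eq_single 0 fun n hn => by simp only [if_neg hn, packingPre_empty]]
  simp

theorem packingMeas_mono (h : E ⊆ F) : packingMeas w E ≤ packingMeas w F :=
  iInf_mono fun _ => iInf_mono' fun hF => ⟨h.trans hF, le_rfl⟩

theorem exists_of_packingMeas_null (h : packingMeas w E = 0) {ε : ℝ≥0∞} (hε : ε ≠ 0) :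
    ∃ F : ℕ → Set X, E ⊆ ⋃ i, F i ∧ ∑' i, packingPre w (F i) < ε := by
  have : packingMeas w E < ε := by rw [h]; exact pos_iff_ne_zero.2 hε
  simp only [packingMeas, iInf_lt_iff, exists_prop] at this
  obtain ⟨F, hF, hlt⟩ := this
  exact ⟨F, hF, hlt⟩

theorem packingMeas_iUnion_null {E : ℕ → Set X} (h : ∀ i, packingMeas w (E i) = 0) :
    packingMeas w (⋃ i, E i) = 0 := by
  refine nonpos_iff_eq_zero.1 (le_of_forall_pos_le_add fun ε hε => ?_)
  obtain ⟨ε', hε', hsum⟩ := ENNReal.exists_pos_sum_of_countable' hε.ne' ℕ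
  choose F hF hlt using fun i => exists_of_packingMeas_null (h i) (hε' i).ne'
  have hcov : ⋃ i, E i ⊆ ⋃ n : ℕ, F n.unpair.1 n.unpair.2 := by
    refine iUnion_subset fun i x hx => ?_
    obtain ⟨j, hj⟩ := mem_iUnion.1 (hF i hx)
    exact mem_iUnion.2 ⟨Nat.pair i j, by simpa using hj⟩
  calc packingMeas w (⋃ i, E i) ≤ ∑' n : ℕ, packingPre w (F n.unpair.1 n.unpair.2) :=
        iInf₂_le (fun n : ℕ => F n.unpair.1 n.unpair.2) hcov
    _ = ∑' p : ℕ × ℕ, packingPre w (F p.1 p.2) :=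
        Nat.pairEquiv.symm.tsum_eq fun p : ℕ × ℕ => packingPre w (F p.1 p.2)
    _ = ∑' i, ∑' j, packingPre w (F i j) :=
        ENNReal.tsum_prod (f := fun i j => packingPre w (F i j))
    _ ≤ ∑' i, ε' i := ENNReal.tsum_le_tsum fun i => (hlt i).le
    _ ≤ 0 + ε := by simpa using hsum.le

/-- A weight dominated on small balls by a weight with vanishing packing measure has vanishing
packing measure. -/
theorem packingMeas_null_of_le {δ₀ : ℝ} (hδ₀ : 0 < δ₀) {K : ℝ≥0∞} (hK : K ≠ ⊤)
    (hw : ∀ x ∈ E, ∀ r, 0 < r → r < δ₀ → w (x, r) ≤ K * w' (x, r))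
    (h : packingMeas w' E = 0) : packingMeas w E = 0 := by
  -- The constant is made nonzero so that multiplication by it commutes with the infima in
  -- `packingPre`.
  replace hw : ∀ x ∈ E, ∀ r, 0 < r → r < δ₀ → w (x, r) ≤ (K + 1) * w' (x, r) :=
    fun x hx r hr hrδ => (hw x hx r hr hrδ).trans (by gcongr; exact le_self_add)
  replace hK : K + 1 ≠ ⊤ := by finiteness
  have hK0 : K + 1 ≠ 0 := by simp
  generalize K + 1 = K at hw hK hK0
  refine nonpos_iff_eq_zero.1 (le_of_forall_pos_le_add fun ε hε => ?_)
  obtain ⟨ε', hε', hle⟩ := ENNReal_exists_mul_le hK hε.ne'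
  obtain ⟨F, hF, hlt⟩ := exists_of_packingMeas_null h hε'
  have hcov : E ⊆ ⋃ i, F i ∩ E := by rw [← iUnion_inter]; exact subset_inter hF subset_rfl
  have hpre : ∀ i, packingPre w (F i ∩ E) ≤ K * packingPre w' (F i) := fun i => by
    simp only [packingPre]
    rw [ENNReal.mul_iInf_of_ne hK0 hK]
    refine le_iInf fun δ => ?_
    rw [ENNReal.mul_iInf_of_ne hK0 hK]
    refine le_iInf fun hδ => (iInf₂_le (min δ δ₀) (lt_min hδ hδ₀)).trans ?_
    refine iSup₂_le fun S hS => ?_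
    calc ∑' p : S, w p ≤ ∑' p : S, K * w' p := ENNReal.tsum_le_tsum fun p =>
          hw _ (hS.2.1 p p.2).1.2 _ (hS.2.1 p p.2).2.1
            ((hS.2.1 p p.2).2.2.trans_le (min_le_right _ _))
      _ = K * ∑' p : S, w' p := ENNReal.tsum_mul_left
      _ ≤ _ := by
        gcongr
        exact le_iSup₂ (f := fun S (_ : IsPacking δ (F i) S) => ∑' p : S, w' p) S
          (hS.mono (min_le_left _ _) inter_subset_left)
  calc packingMeas w E ≤ ∑' i, packingPre w (F i ∩ E) :=
        iInf₂_le (fun i => F i ∩ E) hcov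
    _ ≤ ∑' i, K * packingPre w' (F i) := ENNReal.tsum_le_tsum hpre
    _ = K * ∑' i, packingPre w' (F i) := ENNReal.tsum_mul_left
    _ ≤ K * ε' := by gcongr
    _ ≤ 0 + ε := by simpa using hle

/-- A weight dominated on small balls by an arbitrarily small multiple of a finite measure has
vanishing packing pre-measure. -/
theorem packingPre_null_of_le_measure [MeasurableSpace X] [OpensMeasurableSpace X]
    (m : Measure X) [IsFiniteMeasure m]
    (hw : ∀ ε : ℝ≥0∞, ε ≠ 0 → ∃ δ₀ : ℝ, 0 < δ₀ ∧
      ∀ x ∈ E, ∀ r, 0 < r → r < δ₀ → w (x, r) ≤ ε * m (Metric.ball x r)) :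
    packingPre w E = 0 := by
  refine nonpos_iff_eq_zero.1 (le_of_forall_pos_le_add fun ε hε => ?_)
  obtain ⟨ε', hε', hle⟩ := ENNReal_exists_mul_le (measure_ne_top m univ) hε.ne'
  obtain ⟨δ₀, hδ₀, hw⟩ := hw ε' hε'
  refine packingPre_le hδ₀ fun S hS => ?_
  have := hS.1.to_subtype
  calc ∑' p : S, w p ≤ ∑' p : S, ε' * m (Metric.ball p.1.1 p.1.2) :=
        ENNReal.tsum_le_tsum fun p => hw _ (hS.2.1 p p.2).1 _ (hS.2.1 p p.2).2.1 (hS.2.1 p p.2).2.2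
    _ = ε' * ∑' p : S, m (Metric.ball p.1.1 p.1.2) := ENNReal.tsum_mul_left
    _ = ε' * m (⋃ p ∈ S, Metric.ball p.1 p.2) := by
        rw [measure_biUnion hS.1 hS.2.2 fun p _ => Metric.isOpen_ball.measurableSet]
    _ ≤ ε' * m univ := by gcongr; exact subset_univ _
    _ ≤ 0 + ε := by rw [mul_comm]; simpa using hle

end General

/-! ### Dimension bounds for level sets -/

section LevelSets

variable {X : Type*} [PseudoMetricSpace X] [MeasurableSpace X] {μ : Measure X}

theorem mem_levelSet_iff {α : ℝ} {x : X} :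
    x ∈ levelSet μ α ↔ x ∈ μ.support ∧
      Tendsto (fun r : ℝ => Real.log (μ.real (Metric.ball x r)) / Real.log r) (𝓝[>] 0) (𝓝 α) := by
  refine and_congr_right fun _ => ⟨fun h => ?_, fun h => ?_⟩
  · exact EReal.tendsto_coe.1 (tendsto_of_le_liminf_of_limsup_le h.1 h.2)
  · have h' := EReal.tendsto_coe.2 h
    exact ⟨h'.liminf_eq.ge, h'.limsup_eq.le⟩

theorem measure_ball_pos_of_mem_support {x : X} (hx : x ∈ μ.support) {r : ℝ} (hr : 0 < r) :
    0 < μ (Metric.ball x r) :=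
  (Measure.mem_support_iff_forall x).1 hx _ (Metric.ball_mem_nhds x hr)

theorem weight_eq_ofReal [IsFiniteMeasure μ] {q t : ℝ} {x : X} {r : ℝ} (hr : 0 < r)
    (hx : 0 < μ (Metric.ball x r)) :
    weight μ q t (x, r) = ENNReal.ofReal (r ^ t * μ.real (Metric.ball x r) ^ q) := by
  have hx' : 0 < μ.real (Metric.ball x r) := ENNReal.toReal_pos hx.ne' (measure_ne_top _ _)
  rw [weight, if_neg fun h => hx.ne' h.2, ENNReal.ofReal_mul (by positivity),
    ← ENNReal.ofReal_rpow_of_pos hr, ← ENNReal.ofReal_rpow_of_pos hx', ofReal_measureReal]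

/-- Writing the mass as `r ^ β` with `|β - α| ≤ ε`, the weight is `r ^ (t + β * q)`, and since `r <
1` a larger exponent gives a smaller power. -/
theorem rpow_le_weight [IsFiniteMeasure μ] {q t s α ε : ℝ} {x : X} {r : ℝ} (hr : 0 < r)
    (hr1 : r < 1) (hx : 0 < μ (Metric.ball x r))
    (hα : |Real.log (μ.real (Metric.ball x r)) / Real.log r - α| ≤ ε)
    (hs : t + α * q + ε * |q| ≤ s) :
    ENNReal.ofReal r ^ s ≤ weight μ q t (x, r) := by
  have hx' : 0 < μ.real (Metric.ball x r) := ENNReal.toReal_pos hx.ne' (measure_ne_top _ _)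
  rw [weight_eq_ofReal hr hx, ENNReal.ofReal_rpow_of_pos hr]
  refine ENNReal.ofReal_le_ofReal ?_
  set β := Real.log (μ.real (Metric.ball x r)) / Real.log r with hβ
  have hlog : Real.log r < 0 := Real.log_neg hr hr1
  have h1 : μ.real (Metric.ball x r) = r ^ β := by
    rw [Real.rpow_def_of_pos hr, hβ, mul_div_cancel₀ _ hlog.ne, Real.exp_log hx']
  rw [h1, ← Real.rpow_mul hr.le, ← Real.rpow_add hr]
  refine Real.rpow_le_rpow_of_exponent_ge hr hr1.le (le_trans ?_ hs)
  have : (β - α) * q ≤ ε * |q| := by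
    calc (β - α) * q ≤ |(β - α) * q| := le_abs_self _
      _ = |β - α| * |q| := abs_mul _ _
      _ ≤ ε * |q| := by gcongr
  linarith

/-- The convergence of the local dimension is not uniform in the point. The pieces collect the
points at which the quotient is `ε`-close to `α` for every radius below `1 / (k + 1)`. -/
theorem exists_iUnion_levelSet [IsFiniteMeasure μ] {q t s α : ℝ} (hs : t + α * q < s) :
    ∃ E : ℕ → Set X, levelSet μ α = ⋃ k, E k ∧ ∀ k, ∃ δ₀ : ℝ, 0 < δ₀ ∧
      ∀ x ∈ E k, ∀ r, 0 < r → r < δ₀ → ENNReal.ofReal r ^ s ≤ 1 * weight μ q t (x, r) := by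
  obtain ⟨ε, hε, hεs⟩ : ∃ ε > 0, t + α * q + ε * |q| ≤ s := by
    refine ⟨(s - (t + α * q)) / (|q| + 1), div_pos (by linarith) (by positivity), ?_⟩
    have : (s - (t + α * q)) / (|q| + 1) * |q| ≤ s - (t + α * q) := by
      rw [div_mul_eq_mul_div, div_le_iff₀ (by positivity)]
      nlinarith [abs_nonneg q]
    linarith
  refine ⟨fun k => {x ∈ levelSet μ α | ∀ r, 0 < r → r < 1 / ((k : ℝ) + 1) →
    |Real.log (μ.real (Metric.ball x r)) / Real.log r - α| ≤ ε}, ?_, fun k =>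
    ⟨1 / ((k : ℝ) + 1), by positivity, fun x hx r hr hrδ => ?_⟩⟩
  · refine subset_antisymm (fun x hx => ?_) (iUnion_subset fun k x hx => hx.1)
    have h := (mem_levelSet_iff.1 hx).2
    have h2 := (Metric.tendsto_nhds.1 h) ε hε
    obtain ⟨u, hu, hsub⟩ := (mem_nhdsGT_iff_exists_Ioo_subset).1 h2
    obtain ⟨k, hk⟩ := exists_nat_one_div_lt (show (0 : ℝ) < u from hu)
    refine mem_iUnion.2 ⟨k, hx, fun r hr hrk => ?_⟩
    have := hsub ⟨hr, hrk.trans hk⟩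
    rw [mem_ofPred_eq, Real.dist_eq] at this
    exact this.le
  · rw [one_mul]
    refine rpow_le_weight hr (hrδ.trans_le ?_) (measure_ball_pos_of_mem_support hx.1.1 hr)
      (hx.2 r hr hrδ) hεs
    rw [div_le_one (by positivity)]
    linarith [(Nat.cast_nonneg k : (0 : ℝ) ≤ k)]

/-- On the level set the mass behaves like `r ^ α`, so the weight with exponents `q, t` behaves like
`r ^ (t + α * q)`. This yields the upper bound `t + α * q` for the dimension. -/
theorem coveringMeas_levelSet_null [IsFiniteMeasure μ] {q t s α : ℝ} (hs : t + α * q < s)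
    (h : coveringMeas (weight μ q t) (levelSet μ α) = 0) :
    coveringMeas (fun p : X × ℝ => ENNReal.ofReal p.2 ^ s) (levelSet μ α) = 0 := by
  obtain ⟨E, hE, hw⟩ := exists_iUnion_levelSet (μ := μ) hs
  rw [hE]
  refine coveringMeas_iUnion_null fun k => ?_
  obtain ⟨δ₀, hδ₀, hk⟩ := hw k
  refine coveringMeas_null_of_le hδ₀ ENNReal.one_ne_top hk (coveringMeas_null_mono ?_ h)
  rw [hE]; exact subset_iUnion _ _

theorem packingMeas_levelSet_null [IsFiniteMeasure μ] {q t s α : ℝ} (hs : t + α * q < s)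
    (h : packingMeas (weight μ q t) (levelSet μ α) = 0) :
    packingMeas (fun p : X × ℝ => ENNReal.ofReal p.2 ^ s) (levelSet μ α) = 0 := by
  obtain ⟨E, hE, hw⟩ := exists_iUnion_levelSet (μ := μ) hs
  rw [hE]
  refine packingMeas_iUnion_null fun k => ?_
  obtain ⟨δ₀, hδ₀, hk⟩ := hw k
  refine packingMeas_null_of_le hδ₀ ENNReal.one_ne_top hk
    (nonpos_iff_eq_zero.1 ((packingMeas_mono ?_).trans h.le))
  rw [hE]; exact subset_iUnion _ _

end LevelSets

/-! ### Hausdorff dimension through centred coverings -/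

section HausdorffDimension

variable {X : Type*} [MetricSpace X] {E : Set X}

/-- Each covering set that meets `F` is replaced by a ball centred at one of its points in `F`, of
radius slightly above its diameter. The excess keeps the radius positive when the diameter is zero,
and its cost is summable. -/
theorem coveringMeas_null_of_hausdorffMeasure_null [MeasurableSpace X] [BorelSpace X] {s : ℝ}
    (hs : 0 < s) (h : μH[s] E = 0) :
    coveringMeas (fun p : X × ℝ => ENNReal.ofReal p.2 ^ s) E = 0 := by
  rw [coveringMeas_eq_zero_iff]
  intro F hF
  have h : μH[s] F = 0 := measure_mono_null hF h
  rw [coveringPre_eq_zero_iff]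
  intro δ hδ ε hε
  rw [Measure.hausdorffMeasure_apply] at h
  simp only [ENNReal.iSup_eq_zero] at h
  obtain ⟨ε₁, hε₁, hε₁le⟩ := ENNReal_exists_mul_le (K := 2) (by simp) hε
  have h := h (ENNReal.ofReal (δ / 2)) (by simpa using hδ)
  obtain ⟨t, ht⟩ := iInf_lt_iff.1 (h.trans_lt (pos_iff_ne_zero.2 hε₁))
  obtain ⟨htF, ht⟩ := iInf_lt_iff.1 ht
  obtain ⟨htd, hsum⟩ := iInf_lt_iff.1 ht
  obtain ⟨ε', hε', hsum'⟩ := ENNReal.exists_pos_sum_of_countable' hε₁ ℕ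
  have key : ∀ n, (t n ∩ F).Nonempty → ∃ r : ℝ, 0 < r ∧ r < δ ∧
      (∀ x ∈ t n ∩ F, ∀ y ∈ t n ∩ F, dist y x < r) ∧
      ENNReal.ofReal r ^ s ≤ Metric.ediam (t n) ^ s + ε' n := by
    intro n _
    have hd : Metric.ediam (t n) ≠ ⊤ := ((htd n).trans_lt ENNReal.ofReal_lt_top).ne
    have hd' : (Metric.ediam (t n)).toReal < δ := by
      refine (ENNReal.toReal_le_of_le_ofReal (by positivity) (htd n)).trans_lt (by linarith)
    have hcont : Tendsto (fun r : ℝ => ENNReal.ofReal r ^ s) (𝓝[>] (Metric.ediam (t n)).toReal)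
        (𝓝 (Metric.ediam (t n) ^ s)) := by
      have : Tendsto (fun r : ℝ => ENNReal.ofReal r ^ s) (𝓝 (Metric.ediam (t n)).toReal)
          (𝓝 (ENNReal.ofReal (Metric.ediam (t n)).toReal ^ s)) :=
        ((ENNReal.continuous_rpow_const (y := s)).comp ENNReal.continuous_ofReal).tendsto _
      rw [ENNReal.ofReal_toReal hd] at this
      exact this.mono_left nhdsWithin_le_nhds
    have hpow : Metric.ediam (t n) ^ s ≠ ⊤ := ENNReal.rpow_ne_top_of_nonneg hs.le hd
    have h1 : ∀ᶠ r in 𝓝[>] (Metric.ediam (t n)).toReal,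
        ENNReal.ofReal r ^ s < Metric.ediam (t n) ^ s + ε' n :=
      hcont.eventually_lt_const (ENNReal.lt_add_right hpow (hε' n).ne')
    have h2 : ∀ᶠ r in 𝓝[>] (Metric.ediam (t n)).toReal,
        r ∈ Ioo (Metric.ediam (t n)).toReal δ := Ioo_mem_nhdsGT hd'
    obtain ⟨r, hr1, hr2⟩ := (h1.and h2).exists
    refine ⟨r, ENNReal.toReal_nonneg.trans_lt hr2.1, hr2.2, fun x hx y hy => ?_, hr1.le⟩
    have := Metric.edist_le_ediam_of_mem hy.1 hx.1
    rw [edist_dist] at this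
    exact ((ENNReal.ofReal_le_iff_le_toReal hd).1 this).trans_lt hr2.1
  choose! r hr hrδ hdist hrs using key
  -- Choosing centres as a total function of `n` needs a default point.
  rcases isEmpty_or_nonempty X with hX | hX
  · exact ⟨∅, ⟨countable_empty, by simp, fun y => isEmptyElim y⟩, by simp⟩
  choose! x hx using fun (n : ℕ) (h : (t n ∩ F).Nonempty) => h
  refine ⟨(fun n => (x n, r n)) '' {n | (t n ∩ F).Nonempty}, ⟨(to_countable _).image _, ?_, ?_⟩, ?_⟩
  · rintro _ ⟨n, hn, rfl⟩
    exact ⟨(hx n hn).2, hr n hn, hrδ n hn⟩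
  · intro y hy
    obtain ⟨n, hn⟩ := mem_iUnion.1 (htF hy)
    have hne : (t n ∩ F).Nonempty := ⟨y, hn, hy⟩
    exact mem_iUnion₂.2 ⟨_, ⟨n, hne, rfl⟩, hdist n hne _ (hx n hne) _ ⟨hn, hy⟩⟩
  · have hle : ∑' p : ((fun n => (x n, r n)) '' {n | (t n ∩ F).Nonempty}),
        ENNReal.ofReal p.1.2 ^ s ≤
        ∑' n : {n | (t n ∩ F).Nonempty}, ENNReal.ofReal (r n) ^ s :=
      tsum_image_le_tsum (fun p : X × ℝ => ENNReal.ofReal p.2 ^ s)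
        (fun n => (x n, r n)) {n | (t n ∩ F).Nonempty}
    refine hle.trans ?_
    calc ∑' n : {n | (t n ∩ F).Nonempty}, ENNReal.ofReal (r n) ^ s
        ≤ ∑' n : {n | (t n ∩ F).Nonempty},
          ((⨆ _ : (t n).Nonempty, Metric.ediam (t n) ^ s) + ε' n) := by
          refine ENNReal.tsum_le_tsum fun n => (hrs n n.2).trans ?_
          gcongr
          exact le_iSup (fun _ : (t n).Nonempty => Metric.ediam (t n) ^ s)
            (n.2.mono inter_subset_left)
      _ ≤ ∑' n : ℕ, ((⨆ _ : (t n).Nonempty, Metric.ediam (t n) ^ s) + ε' n) :=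
          ENNReal.tsum_comp_le_tsum_of_injective Subtype.val_injective _
      _ = ∑' n : ℕ, (⨆ _ : (t n).Nonempty, Metric.ediam (t n) ^ s) + ∑' n, ε' n :=
          ENNReal.tsum_add
      _ ≤ ε₁ + ε₁ := add_le_add hsum.le hsum'.le
      _ = 2 * ε₁ := (two_mul _).symm
      _ ≤ ε := hε₁le

theorem hausdorffMeasure_null_of_coveringMeas_null [MeasurableSpace X] [BorelSpace X] {s : ℝ}
    (hs : 0 ≤ s) (h : coveringMeas (fun p : X × ℝ => ENNReal.ofReal p.2 ^ s) E = 0) :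
    μH[s] E = 0 := by
  have h := coveringPre_eq_zero_iff.1 (coveringMeas_eq_zero_iff.1 h E subset_rfl)
  refine nonpos_iff_eq_zero.1 (le_of_forall_pos_le_add fun ε hε => ?_)
  obtain ⟨ε', hε', hle⟩ := ENNReal_exists_mul_le (K := 2 ^ s)
    (ENNReal.rpow_ne_top_of_nonneg hs (by simp)) hε.ne'
  choose S hS hsum using fun n : ℕ => h (1 / (2 * ((n : ℝ) + 1))) (by positivity) ε' hε'
  have := fun n => (hS n).1.to_subtype
  have hball : ∀ n, ∀ p : S n, Metric.ediam (Metric.ball p.1.1 p.1.2) ≤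
      2 * ENNReal.ofReal p.1.2 := fun n p => by
    rw [← Metric.eball_ofReal]; exact Metric.ediam_eball_le
  refine (Measure.hausdorffMeasure_le_liminf_tsum (l := (atTop : Filter ℕ)) s E
    (fun n : ℕ => ENNReal.ofReal (1 / ((n : ℝ) + 1))) ?_
    (fun n (p : S n) => Metric.ball p.1.1 p.1.2) ?_ ?_).trans ?_
  · have := ENNReal.tendsto_ofReal (tendsto_one_div_add_atTop_nhds_zero_nat (𝕜 := ℝ))
    simpa using this
  · refine Eventually.of_forall fun n p => (hball n p).trans ?_
    have := ((hS n).2.1 p p.2).2.2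
    rw [show (2 : ℝ≥0∞) = ENNReal.ofReal 2 by simp, ← ENNReal.ofReal_mul (by norm_num)]
    refine ENNReal.ofReal_le_ofReal ?_
    have h2 : 1 / (2 * ((n : ℝ) + 1)) = 1 / ((n : ℝ) + 1) / 2 := by field_simp
    rw [h2] at this
    linarith
  · refine Eventually.of_forall fun n x hx => ?_
    obtain ⟨p, hp, hxp⟩ := mem_iUnion₂.1 ((hS n).2.2 hx)
    exact mem_iUnion.2 ⟨⟨p, hp⟩, hxp⟩
  · refine le_trans (liminf_le_liminf (v := fun _ => ε) (Eventually.of_forall fun n => ?_)) ?_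
    · calc ∑' p : S n, Metric.ediam (Metric.ball p.1.1 p.1.2) ^ s
          ≤ ∑' p : S n, 2 ^ s * ENNReal.ofReal p.1.2 ^ s := ENNReal.tsum_le_tsum fun p => by
            rw [← ENNReal.mul_rpow_of_nonneg _ _ hs]
            exact ENNReal.rpow_le_rpow (hball n p) hs
        _ = 2 ^ s * ∑' p : S n, ENNReal.ofReal p.1.2 ^ s := ENNReal.tsum_mul_left
        _ ≤ 2 ^ s * ε' := by gcongr; exact hsum n
        _ ≤ ε := hle
    · simp

theorem dimH_le_of_coveringMeas_null {s : ℝ≥0}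
    (h : coveringMeas (fun p : X × ℝ => ENNReal.ofReal p.2 ^ (s : ℝ)) E = 0) : dimH E ≤ s := by
  let _ := borel X
  have : BorelSpace X := ⟨rfl⟩
  refine dimH_le_of_hausdorffMeasure_ne_top ?_
  exact (hausdorffMeasure_null_of_coveringMeas_null s.2 h).trans_ne ENNReal.zero_ne_top

theorem coveringMeas_null_of_dimH_lt {s : ℝ≥0} (h : dimH E < s) :
    coveringMeas (fun p : X × ℝ => ENNReal.ofReal p.2 ^ (s : ℝ)) E = 0 := by
  let _ := borel X
  have : BorelSpace X := ⟨rfl⟩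
  have hs : (0 : ℝ) < s := by
    have := (zero_le : 0 ≤ dimH E).trans_lt h
    exact_mod_cast this
  exact coveringMeas_null_of_hausdorffMeasure_null hs (hausdorffMeasure_of_dimH_lt h)

end HausdorffDimension

end OlsenGray

namespace OlsenGray

/-! ### Balls of words are cylinders -/

section Balls

variable {c : ℕ}

theorem cyl_zero (x : Word c) : cyl x 0 = univ := eq_univ_of_forall fun _ _ h => absurd h (by simp)

theorem mem_cyl_self (x : Word c) (n : ℕ) : x ∈ cyl x n := fun _ _ => rfl

theorem cyl_anti (x : Word c) {m n : ℕ} (h : m ≤ n) : cyl x n ⊆ cyl x m :=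
  fun _ hy i hi => hy i (hi.trans_le h)

/-- The generation of the cylinders which are the balls of radius `r`. -/
noncomputable def level (c : ℕ) (r : ℝ) : ℕ := sInf {n : ℕ | ((c : ℝ) ^ n)⁻¹ < r}

theorem inv_pow_level_lt (hc : 2 ≤ c) {r : ℝ} (hr : 0 < r) : ((c : ℝ) ^ level c r)⁻¹ < r := by
  have hc' : (1 : ℝ) < c := by exact_mod_cast hc
  have hne : {n : ℕ | ((c : ℝ) ^ n)⁻¹ < r}.Nonempty := by
    obtain ⟨n, hn⟩ := exists_pow_lt_of_lt_one hr (inv_lt_one_of_one_lt₀ hc')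
    exact ⟨n, by simpa using hn⟩
  exact Nat.sInf_mem hne

theorem level_le {r : ℝ} {n : ℕ} (h : ((c : ℝ) ^ n)⁻¹ < r) : level c r ≤ n := Nat.sInf_le h

theorem le_of_lt_level {r : ℝ} {n : ℕ} (h : n < level c r) : r ≤ ((c : ℝ) ^ n)⁻¹ :=
  not_lt.1 fun h' => (level_le h').not_gt h

/-- Nonzero distances are of the form `c ^ (-n)`, so being closer than `r` means sharing a prefix at
least as long as the least `n` with `c ^ (-n) < r`. -/
theorem ball_eq_cyl (hc : 2 ≤ c) (x : Word c) {r : ℝ} (hr : 0 < r) :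
    Metric.ball x r = cyl x (level c r) := by
  have hc' : (1 : ℝ) < c := by exact_mod_cast hc
  ext y
  rw [Metric.mem_ball]
  change wordDist y x < r ↔ _
  by_cases h : y = x
  · subst h
    simp only [wordDist_self, hr, mem_cyl_self]
  have hmem : y ∈ cyl x (level c r) ↔ level c r ≤ prefixLength y x :=
    PiNat.mem_cylinder_iff_le_firstDiff (E := fun _ => Fin c) (x := y) (y := x) h _
  rw [wordDist_of_ne h, hmem]
  refine ⟨fun hlt => level_le hlt, fun hle => ?_⟩
  refine lt_of_le_of_lt ?_ (inv_pow_level_lt hc hr)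
  exact inv_anti₀ (by positivity) (pow_le_pow_right₀ hc'.le hle)

theorem level_anti (hc : 2 ≤ c) {r s : ℝ} (hr : 0 < r) (h : r ≤ s) : level c s ≤ level c r :=
  level_le ((inv_pow_level_lt hc hr).trans_le h)

theorem level_le_level_mul_add_one (hc : 2 ≤ c) {r : ℝ} (hr : 0 < r) :
    level c r ≤ level c (c * r) + 1 := by
  have hc0 : (0 : ℝ) < c := by exact_mod_cast (by lia : 0 < c)
  refine level_le ?_
  have h := inv_pow_level_lt hc (r := c * r) (by positivity)
  rw [pow_succ, mul_inv, ← div_eq_mul_inv, div_lt_iff₀ hc0]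
  linarith

theorem level_inv_pow (hc : 2 ≤ c) (n : ℕ) : level c ((c : ℝ) ^ n)⁻¹ = n + 1 := by
  have hc' : (1 : ℝ) < c := by exact_mod_cast hc
  refine le_antisymm (level_le ?_) (Nat.succ_le_of_lt (not_le.1 fun h => ?_))
  · exact (inv_lt_inv₀ (by positivity) (by positivity)).2 (pow_lt_pow_right₀ hc' (Nat.lt_succ_self n))
  · have h1 := inv_pow_level_lt hc (r := ((c : ℝ) ^ n)⁻¹) (by positivity)
    rw [inv_lt_inv₀ (by positivity) (by positivity)] at h1
    exact absurd (pow_le_pow_right₀ hc'.le h) h1.not_ge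

theorem one_le_level (hc : 2 ≤ c) {r : ℝ} (hr : 0 < r) (h : r ≤ 1) : 1 ≤ level c r := by
  by_contra! h0
  have := inv_pow_level_lt hc hr
  rw [Nat.lt_one_iff.1 h0] at this
  simp at this
  linarith

theorem le_inv_pow_level_sub_one {r : ℝ} (h : 1 ≤ level c r) :
    r ≤ ((c : ℝ) ^ (level c r - 1))⁻¹ := le_of_lt_level (by lia)

theorem cyl_subset_ball_mul (hc : 2 ≤ c) (x : Word c) {r : ℝ} (hr : 0 < r) :
    cyl x (level c r - 1) ⊆ Metric.ball x (c * r) := by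
  have hc0 : (0 : ℝ) < c := by exact_mod_cast (by lia : 0 < c)
  have hc' : (1 : ℝ) < c := by exact_mod_cast hc
  rw [ball_eq_cyl hc x (by positivity)]
  refine cyl_anti x (level_le ?_)
  have h := inv_pow_level_lt hc hr
  -- At generation zero the truncated subtraction leaves the whole space, which the larger ball also
  -- fills.
  rcases Nat.eq_zero_or_pos (level c r) with h0 | h0
  · rw [h0] at h ⊢
    simp at h ⊢
    nlinarith
  · obtain ⟨k, hk⟩ := Nat.exists_eq_succ_of_ne_zero h0.ne'
    rw [hk] at h ⊢
    rw [Nat.succ_eq_add_one, pow_succ, mul_inv, ← div_eq_mul_inv, div_lt_iff₀ hc0] at h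
    simpa [mul_comm] using h

theorem isOpen_cyl (hc : 2 ≤ c) (x : Word c) (n : ℕ) : IsOpen (cyl x n) := by
  have hc0 : (0 : ℝ) < c := by exact_mod_cast (by lia : 0 < c)
  rcases n with _ | n
  · rw [cyl_zero]; exact isOpen_univ
  · rw [← level_inv_pow hc, ← ball_eq_cyl hc x (by positivity)]
    exact Metric.isOpen_ball

theorem measurableSet_cyl (hc : 2 ≤ c) (x : Word c) (n : ℕ) : MeasurableSet (cyl x n) :=
  (isOpen_cyl hc x n).measurableSet

end Balls

/-! ### Transfer of null sets through a coding -/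

section Coding

variable {c : ℕ} {Y : Type*} [MetricSpace Y]

/-- A `1`-Lipschitz coding of a metric space by infinite words, with a linear order of the
cylinders of each generation, such that cylinders whose images are close to each other are equal
or adjacent. -/
structure IsCoding (π : Word c → Y) (R : ℕ → Word c → ℕ) : Prop where
  two_le : 2 ≤ c
  surjective : Function.Surjective π
  dist_le : ∀ x y, dist (π x) (π y) ≤ dist x y
  rank_eq_iff : ∀ n x y, R n x = R n y ↔ y ∈ cyl x n
  rank_le : ∀ n x y, dist (π x) (π y) < ((c : ℝ) ^ n)⁻¹ → R n y ≤ R n x + 1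

variable {π : Word c → Y} {R : ℕ → Word c → ℕ}

theorem IsCoding.continuous (h : IsCoding π R) : Continuous π :=
  (LipschitzWith.of_dist_le_mul (K := 1) (by simpa using h.dist_le)).continuous

theorem IsCoding.rank_le_of_dist_lt (h : IsCoding π R) {x y : Word c} {r : ℝ}
    (hd : dist (π x) (π y) < r) : R (level c r - 1) y ≤ R (level c r - 1) x + 1 := by
  rcases Nat.eq_zero_or_pos (level c r) with h0 | h0
  · rw [h0]
    exact ((h.rank_eq_iff 0 y x).2 (by simp [cyl_zero])).le.trans (Nat.le_succ _)
  · exact h.rank_le _ _ _ (hd.trans_le (le_inv_pow_level_sub_one h0))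

theorem IsCoding.mem_ball (h : IsCoding π R) {x y : Word c} {r : ℝ} (hy : y ∈ Metric.ball x r) :
    π y ∈ Metric.ball (π x) r :=
  (h.dist_le y x).trans_lt hy

variable {w : Word c × ℝ → ℝ≥0∞} {w' : Y × ℝ → ℝ≥0∞} {E : Set Y} {K : ℝ≥0∞}

/-- A centred cover by balls of words projects, with the same radii, to a centred cover downstairs,
because the coding is 1-Lipschitz and onto. -/
theorem IsCoding.coveringMeas_null (h : IsCoding π R) (hK : K ≠ ⊤)
    (hw : ∀ (x : Word c) (r : ℝ), 0 < r → w' (π x, r) ≤ K * w (x, r)) (hE : coveringMeas w (π ⁻¹' E) = 0) :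
    coveringMeas w' E = 0 := by
  rw [coveringMeas_eq_zero_iff] at hE ⊢
  intro F hF
  have hE := coveringPre_eq_zero_iff.1 (hE _ (preimage_mono hF))
  rw [coveringPre_eq_zero_iff]
  intro δ hδ ε hε
  obtain ⟨ε', hε', hle⟩ := ENNReal_exists_mul_le hK hε
  obtain ⟨S, ⟨hc, hS, hcov⟩, hsum⟩ := hE δ hδ ε' hε'
  refine ⟨(fun p : Word c × ℝ => (π p.1, p.2)) '' S, ⟨hc.image _, ?_, fun y hy => ?_⟩, ?_⟩
  · rintro _ ⟨p, hp, rfl⟩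
    exact hS p hp
  · obtain ⟨x, rfl⟩ := h.surjective y
    obtain ⟨p, hp, hxp⟩ := mem_iUnion₂.1 (hcov hy)
    exact mem_iUnion₂.2 ⟨_, ⟨p, hp, rfl⟩, h.mem_ball hxp⟩
  · calc ∑' p : (fun p : Word c × ℝ => (π p.1, p.2)) '' S, w' p
        ≤ ∑' p : S, w' (π p.1.1, p.1.2) := tsum_image_le_tsum _ _ _
      _ ≤ ∑' p : S, K * w p := ENNReal.tsum_le_tsum fun p => hw _ _ (hS p p.2).2.1
      _ = K * ∑' p : S, w p := ENNReal.tsum_mul_left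
      _ ≤ K * ε' := by gcongr
      _ ≤ ε := hle

/-- The preimage of `ball (π x) r` lies in the cylinders of generation `level c r - 1` whose rank is
within one of that of `x`: at most three of them. Each one that contains a suitable point of `F`
lies in a ball of radius `c * r` centred there, whence the factor `3`. -/
theorem IsCoding.coveringMeas_preimage_null (h : IsCoding π R) (hK : K ≠ ⊤)
    (hw : ∀ (x y : Word c) (r ρ : ℝ), 0 < ρ → ρ ≤ r → r ≤ 2 * c * ρ → dist (π x) (π y) < r →
      w (y, r) ≤ K * w' (π x, ρ)) (hE : coveringMeas w' E = 0) :
    coveringMeas w (π ⁻¹' E) = 0 := by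
  have hc0 : (0 : ℝ) < c := by exact_mod_cast (by have := h.two_le; lia : 0 < c)
  have hc1 : (1 : ℝ) ≤ c := by exact_mod_cast (by have := h.two_le; lia : 1 ≤ c)
  rw [coveringMeas_eq_zero_iff] at hE ⊢
  intro F hF
  have hE := coveringPre_eq_zero_iff.1 (hE (π '' F) (image_subset_iff.2 hF))
  rw [coveringPre_eq_zero_iff]
  intro δ hδ ε hε
  obtain ⟨ε', hε', hle⟩ := ENNReal_exists_mul_le (K := 3 * K) (by finiteness) hε
  -- The radii will be multiplied by `c`.
  obtain ⟨S, ⟨hc, hS, hcov⟩, hsum⟩ := hE (δ / c) (by positivity) ε' hε'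
  choose x hxF hx using fun p : S => (hS p p.2).1
  -- The index in `Fin 3` encodes a rank difference `-1`, `0` or `1`, shifted by one to stay in `ℕ`.
  -- Only the cylinders containing a point of `F` in the preimage of the ball are kept, and that
  -- point serves as centre.
  let P : S × Fin 3 → Word c → Prop := fun a y => y ∈ F ∧ dist (π (x a.1)) (π y) < a.1.1.2 ∧
    R (level c a.1.1.2 - 1) y + 1 = R (level c a.1.1.2 - 1) (x a.1) + a.2
  let T : Set (S × Fin 3) := {a | ∃ y, P a y}
  choose y hy using fun a : T => a.2
  have : Countable S := hc.to_subtype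
  refine ⟨range fun a : T => (y a, c * a.1.1.1.2), ⟨countable_range _, ?_, fun z hz => ?_⟩, ?_⟩
  · rintro _ ⟨a, rfl⟩
    have h1 := (hS a.1.1 a.1.1.2).2
    refine ⟨(hy a).1, mul_pos hc0 h1.1, ?_⟩
    have := h1.2
    rw [lt_div_iff₀ hc0] at this
    linarith
  · obtain ⟨p, hp, hzp⟩ := mem_iUnion₂.1 (hcov (mem_image_of_mem π hz))
    have hr : 0 < p.2 := (hS p hp).2.1
    have hd : dist (π z) (π (x ⟨p, hp⟩)) < p.2 := by rw [hx]; exact hzp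
    have h1 := h.rank_le_of_dist_lt hd
    have h2 := h.rank_le_of_dist_lt (by rwa [dist_comm] : dist (π (x ⟨p, hp⟩)) (π z) < p.2)
    obtain ⟨j, hj⟩ : ∃ j : Fin 3, R (level c p.2 - 1) z + 1 =
        R (level c p.2 - 1) (x ⟨p, hp⟩) + j := by
      refine ⟨⟨R (level c p.2 - 1) z + 1 - R (level c p.2 - 1) (x ⟨p, hp⟩), by lia⟩, ?_⟩
      simp only
      lia
    have hT : (⟨⟨p, hp⟩, j⟩ : S × Fin 3) ∈ T := ⟨z, hz, by rwa [dist_comm], hj⟩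
    refine mem_iUnion₂.2 ⟨_, ⟨⟨_, hT⟩, rfl⟩, ?_⟩
    refine cyl_subset_ball_mul h.two_le _ hr ?_
    rw [← h.rank_eq_iff]
    have := (hy ⟨_, hT⟩).2.2
    simp only at this
    lia
  · calc ∑' p : range fun a : T => (y a, c * a.1.1.1.2), w p
        ≤ ∑' a : T, w (y a, c * a.1.1.1.2) := by
          rw [← image_univ]
          refine (tsum_image_le_tsum w _ _).trans ?_
          rw [tsum_univ fun a : T => w (y a, c * a.1.1.1.2)]
      _ ≤ ∑' a : T, K * w' a.1.1 := ENNReal.tsum_le_tsum fun a => by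
          have h1 := (hS a.1.1 a.1.1.2).2.1
          have h2 := (hy a).2.1
          have := hw (x a.1.1) (y a) (c * a.1.1.1.2) a.1.1.1.2 h1 (by nlinarith) (by nlinarith)
            (h2.trans_le (by nlinarith))
          rwa [hx] at this
      _ ≤ ∑' a : S × Fin 3, K * w' a.1 :=
          ENNReal.tsum_comp_le_tsum_of_injective Subtype.val_injective
            (fun a : S × Fin 3 => K * w' a.1)
      _ = ∑' p : S, ∑' _ : Fin 3, K * w' p :=
          ENNReal.tsum_prod (f := fun (p : S) (_ : Fin 3) => K * w' p)
      _ = ∑' p : S, 3 * K * w' p := by simp [tsum_fintype, mul_assoc]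
      _ = 3 * K * ∑' p : S, w' p := ENNReal.tsum_mul_left
      _ ≤ 3 * K * ε' := by gcongr
      _ ≤ ε := hle

/-- Centres lift to words. Balls of words of the same radii are mapped into the given disjoint
balls, so they are disjoint too. -/
theorem IsCoding.packingMeas_null (h : IsCoding π R) (hK : K ≠ ⊤)
    (hw : ∀ (x : Word c) (r : ℝ), 0 < r → w' (π x, r) ≤ K * w (x, r)) (hE : packingMeas w (π ⁻¹' E) = 0) :
    packingMeas w' E = 0 := by
  have hpre : ∀ F, packingPre w' (π '' F) ≤ (K + 1) * packingPre w F := fun F => by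
    simp only [packingPre]
    rw [ENNReal.mul_iInf_of_ne (by simp) (by finiteness)]
    refine le_iInf fun δ => ?_
    rw [ENNReal.mul_iInf_of_ne (by simp) (by finiteness)]
    refine le_iInf fun hδ => (iInf₂_le δ hδ).trans ?_
    refine iSup₂_le fun S hS => ?_
    choose x hxF hx using fun p : S => (hS.2.1 p p.2).1
    let f : S → Word c × ℝ := fun p => (x p, p.1.2)
    have hf : Function.Injective f := fun p q hpq => by
      have h1 : x p = x q := congrArg Prod.fst (show f p = f q from hpq)
      have h2 : p.1.2 = q.1.2 := congrArg (Prod.snd : Word c × ℝ → ℝ) (show f p = f q from hpq)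
      exact Subtype.ext (Prod.ext (by rw [← hx p, ← hx q, h1]) h2)
    have hP : IsPacking δ F (range f) := by
      have := hS.1.to_subtype
      refine ⟨countable_range _, ?_, ?_⟩
      · rintro _ ⟨p, rfl⟩
        exact ⟨hxF p, (hS.2.1 p p.2).2⟩
      · rintro _ ⟨p, rfl⟩ _ ⟨q, rfl⟩ hpq
        have hne : (p : Y × ℝ) ≠ q := fun h => hpq (by rw [Subtype.ext h])
        have hd := hS.2.2 p.2 q.2 hne
        refine Set.disjoint_left.2 fun z hz hz' => ?_
        have h1 := h.mem_ball hz
        have h2 := h.mem_ball hz'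
        rw [hx] at h1 h2
        exact Set.disjoint_left.1 hd h1 h2
    calc ∑' p : S, w' p ≤ ∑' p : S, (K + 1) * w (f p) := ENNReal.tsum_le_tsum fun p => by
          have := hw (x p) p.1.2 (hS.2.1 p p.2).2.1
          rw [hx] at this
          exact this.trans (by gcongr; exact le_self_add)
      _ = (K + 1) * ∑' p : S, w (f p) := ENNReal.tsum_mul_left
      _ = (K + 1) * ∑' p : range f, w p := by rw [tsum_range w hf]
      _ ≤ _ := by
        gcongr
        exact le_iSup₂ (f := fun S (_ : IsPacking δ F S) => ∑' p : S, w p) _ hP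
  refine nonpos_iff_eq_zero.1 (le_of_forall_pos_le_add fun ε hε => ?_)
  obtain ⟨ε', hε', hle⟩ := ENNReal_exists_mul_le (K := K + 1) (by finiteness) hε.ne'
  obtain ⟨F, hF, hlt⟩ := exists_of_packingMeas_null hE hε'
  have hcov : E ⊆ ⋃ i, π '' F i := fun y hy => by
    obtain ⟨x, rfl⟩ := h.surjective y
    obtain ⟨i, hi⟩ := mem_iUnion.1 (hF hy)
    exact mem_iUnion.2 ⟨i, x, hi, rfl⟩
  calc packingMeas w' E ≤ ∑' i, packingPre w' (π '' F i) := iInf₂_le (fun i => π '' F i) hcov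
    _ ≤ ∑' i, (K + 1) * packingPre w (F i) := ENNReal.tsum_le_tsum fun i => hpre _
    _ = (K + 1) * ∑' i, packingPre w (F i) := ENNReal.tsum_mul_left
    _ ≤ (K + 1) * ε' := by gcongr
    _ ≤ 0 + ε := by simpa using hle

/-- A packing by cylinders of one generation and of ranks of one parity is mapped to a packing. -/
theorem IsCoding.tsum_packing_le (h : IsCoding π R) {F : Set Y} {δ : ℝ} {D : ℝ≥0∞}
    (hw : ∀ (x : Word c) (r ρ : ℝ), 0 < ρ → ρ ≤ r → r ≤ 2 * c * ρ → w (x, r) ≤ K * w' (π x, ρ))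
    (hD : ∀ S, IsPacking δ F S → ∑' p : S, w' p ≤ D) {S : Set (Word c × ℝ)}
    (hS : IsPacking δ (π ⁻¹' F) S) {k b : ℕ}
    (hk : ∀ p ∈ S, level c p.2 = k + 1) (hb : ∀ p ∈ S, R (k + 1) p.1 % 2 = b) :
    ∑' p : S, w p ≤ K * D := by
  have hc0 : (0 : ℝ) < c := by exact_mod_cast (by have := h.two_le; lia : 0 < c)
  set ρ : ℝ := ((c : ℝ) ^ (k + 1))⁻¹ / 2 with hρ
  have hρ0 : 0 < ρ := by positivity
  -- Two images closer than `c ^ (-(k + 1))` have equal or consecutive ranks, hence equal ones by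
  -- parity. Both centres then lie in the same cylinder, against disjointness. So balls of half that
  -- radius around the images are disjoint.
  have hfar : ∀ p ∈ S, ∀ p' ∈ S, p ≠ p' → ρ + ρ ≤ dist (π p.1) (π p'.1) := by
    intro p hp p' hp' hne
    by_contra! hlt
    have hρ2 : ρ + ρ = ((c : ℝ) ^ (k + 1))⁻¹ := by rw [hρ]; ring
    rw [hρ2] at hlt
    have h1 := h.rank_le _ _ _ hlt
    rw [dist_comm] at hlt
    have h2 := h.rank_le _ _ _ hlt
    have h3 := hb p hp
    have h4 := hb p' hp'
    have h5 := (h.rank_eq_iff (k + 1) p.1 p'.1).1 (by lia)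
    have hd := hS.2.2 hp hp' hne
    have h6 : p'.1 ∈ Metric.ball p.1 p.2 := by
      rw [ball_eq_cyl h.two_le _ (hS.2.1 p hp).2.1, hk p hp]
      exact h5
    exact Set.disjoint_left.1 hd h6 (Metric.mem_ball_self (hS.2.1 p' hp').2.1)
  let f : S → Y × ℝ := fun p => (π p.1.1, ρ)
  have hr : ∀ p ∈ S, ((c : ℝ) ^ (k + 1))⁻¹ < p.2 := fun p hp => by
    rw [← hk p hp]; exact inv_pow_level_lt h.two_le (hS.2.1 p hp).2.1
  have hf : Function.Injective f := fun p q hpq => by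
    by_contra hne
    have h1 : π p.1.1 = π q.1.1 := congrArg Prod.fst hpq
    have := hfar p p.2 q q.2 fun h => hne (Subtype.ext h)
    rw [h1, dist_self] at this
    linarith
  have hP : IsPacking δ F (range f) := by
    have := hS.1.to_subtype
    refine ⟨countable_range _, ?_, ?_⟩
    · rintro _ ⟨p, rfl⟩
      refine ⟨(hS.2.1 p p.2).1, hρ0, ?_⟩
      have h1 := (hS.2.1 p p.2).2.2
      have h2 := hr p p.2
      change ρ < δ
      linarith
    · rintro _ ⟨p, rfl⟩ _ ⟨q, rfl⟩ hpq
      exact Metric.ball_disjoint_ball (hfar p p.2 q q.2 fun h => hpq (by rw [Subtype.ext h]))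
  calc ∑' p : S, w p ≤ ∑' p : S, K * w' (f p) := ENNReal.tsum_le_tsum fun p => by
        have h1 := hr p p.2
        refine hw _ _ _ hρ0 (by linarith) ?_
        have h2 : p.1.2 ≤ ((c : ℝ) ^ k)⁻¹ := le_of_lt_level (by rw [hk p p.2]; lia)
        refine h2.trans (le_of_eq ?_)
        rw [hρ, pow_succ]
        field_simp
    _ = K * ∑' p : S, w' (f p) := ENNReal.tsum_mul_left
    _ = K * ∑' p : range f, w' p := by rw [tsum_range w' hf]
    _ ≤ K * D := by gcongr; exact hD _ hP

/-- A packing by words is sorted by generation and by parity of the rank, and each class is mapped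
to a packing downstairs. There are infinitely many classes, so the extra factor `r ^ (2 * η)` is
needed: one half of it makes the sum over generations geometric, the other half makes the total
small. -/
theorem IsCoding.packingMeas_preimage_null (h : IsCoding π R) (hK : K ≠ ⊤)
    (hw : ∀ (x : Word c) (r ρ : ℝ), 0 < ρ → ρ ≤ r → r ≤ 2 * c * ρ → w (x, r) ≤ K * w' (π x, ρ))
    {v : Word c × ℝ → ℝ≥0∞} {η : ℝ} (hη : 0 < η)
    (hv : ∀ (x : Word c) (r : ℝ), 0 < r → v (x, r) ≤ ENNReal.ofReal r ^ (2 * η) * w (x, r))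
    (hE : packingMeas w' E = 0) : packingMeas v (π ⁻¹' E) = 0 := by
  have hc1 : (1 : ℝ) < c := by exact_mod_cast h.two_le
  -- A finite bound on the pre-measures suffices; smallness will come from the factor `r ^ η`.
  obtain ⟨F, hF, hlt⟩ := exists_of_packingMeas_null hE one_ne_zero
  suffices hpre : ∀ i, packingPre v (π ⁻¹' F i) = 0 by
    have : π ⁻¹' E ⊆ ⋃ i, π ⁻¹' F i := by rw [← preimage_iUnion]; exact preimage_mono hF
    refine nonpos_iff_eq_zero.1 ((packingMeas_mono this).trans (le_of_eq ?_))
    exact packingMeas_iUnion_null fun i =>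
      nonpos_iff_eq_zero.1 (packingMeas_le_packingPre.trans (hpre i).le)
  intro i
  obtain ⟨δ₀, hδ₀, hD⟩ := exists_of_packingPre_lt ((ENNReal.le_tsum i).trans_lt hlt)
  set G : ℕ → ℝ≥0∞ := fun k => ENNReal.ofReal ((c : ℝ)⁻¹ ^ η) ^ k with hG
  have hGsum : ∑' k, G k ≠ ⊤ := by
    rw [hG, ENNReal.tsum_geometric]
    refine ENNReal.inv_ne_top.2 (tsub_pos_iff_lt.2 ?_).ne'
    rw [ENNReal.ofReal_lt_one]
    exact Real.rpow_lt_one (by positivity) (inv_lt_one_of_one_lt₀ hc1) hη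
  refine nonpos_iff_eq_zero.1 (le_of_forall_pos_le_add fun ε hε => ?_)
  obtain ⟨ε', hε', hle⟩ := ENNReal_exists_mul_le (K := 2 * (∑' k, G k) * K) (by finiteness) hε.ne'
  -- Radii at most `1` have generation at least one, so the generation can be written `k + 1`.
  obtain ⟨δ, hδε, hδ⟩ : ∃ δ, ENNReal.ofReal δ ^ η < ε' ∧ δ ∈ Ioo 0 (min δ₀ 1) := by
    have h1 : Tendsto (fun r : ℝ => ENNReal.ofReal r ^ η) (𝓝[>] 0) (𝓝 0) := by
      have : Tendsto (fun r : ℝ => ENNReal.ofReal r ^ η) (𝓝 0) (𝓝 (ENNReal.ofReal 0 ^ η)) :=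
        ((ENNReal.continuous_rpow_const (y := η)).comp ENNReal.continuous_ofReal).tendsto _
      rw [ENNReal.ofReal_zero, ENNReal.zero_rpow_of_pos hη] at this
      exact this.mono_left nhdsWithin_le_nhds
    exact ((h1.eventually_lt_const (pos_iff_ne_zero.2 hε')).and
      (Ioo_mem_nhdsGT (lt_min hδ₀ one_pos))).exists
  refine packingPre_le hδ.1 fun S hS => ?_
  let S' : ℕ × Fin 2 → Set (Word c × ℝ) := fun a =>
    {p ∈ S | level c p.2 = a.1 + 1 ∧ R (a.1 + 1) p.1 % 2 = a.2}
  have hcov : S ⊆ ⋃ a, S' a := fun p hp => by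
    have h1 := one_le_level h.two_le (hS.2.1 p hp).2.1
      ((hS.2.1 p hp).2.2.le.trans (hδ.2.le.trans (min_le_right _ _)))
    refine mem_iUnion.2 ⟨(level c p.2 - 1, ⟨R (level c p.2) p.1 % 2, Nat.mod_lt _ two_pos⟩),
      hp, by simp only; lia, ?_⟩
    simp only
    rw [Nat.sub_add_cancel h1]
  have hterm : ∀ a, ∑' p : S' a, v p ≤ ε' * G a.1 * K := fun a => by
    have hP : IsPacking δ₀ (π ⁻¹' F i) (S' a) :=
      ⟨hS.1.mono fun p hp => hp.1, fun p hp => ⟨(hS.2.1 p hp.1).1, (hS.2.1 p hp.1).2.1,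
        (hS.2.1 p hp.1).2.2.trans (hδ.2.trans_le (min_le_left _ _))⟩,
        hS.2.2.subset fun p hp => hp.1⟩
    calc ∑' p : S' a, v p ≤ ∑' p : S' a, ε' * G a.1 * w p := ENNReal.tsum_le_tsum fun p => by
          have hr := (hS.2.1 p p.2.1).2
          refine (hv _ _ hr.1).trans ?_
          gcongr
          rw [two_mul, ENNReal.rpow_add_of_nonneg _ _ hη.le hη.le]
          refine mul_le_mul' ?_ ?_
          · refine (ENNReal.rpow_le_rpow (ENNReal.ofReal_le_ofReal hr.2.le) hη.le).trans hδε.le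
          · have h2 : p.1.2 ≤ ((c : ℝ) ^ a.1)⁻¹ := le_of_lt_level (by rw [p.2.2.1]; lia)
            refine (ENNReal.rpow_le_rpow (ENNReal.ofReal_le_ofReal h2) hη.le).trans (le_of_eq ?_)
            change _ = ENNReal.ofReal ((c : ℝ)⁻¹ ^ η) ^ a.1
            rw [ENNReal.ofReal_rpow_of_pos (by positivity),
              ← ENNReal.ofReal_pow (by positivity), ← inv_pow, ← Real.rpow_natCast,
              ← Real.rpow_natCast, ← Real.rpow_mul (by positivity),
              ← Real.rpow_mul (by positivity), mul_comm]
      _ = ε' * G a.1 * ∑' p : S' a, w p := ENNReal.tsum_mul_left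
      _ ≤ ε' * G a.1 * (K * 1) := by
          gcongr
          exact h.tsum_packing_le hw hD hP (fun p hp => hp.2.1) (fun p hp => hp.2.2)
      _ = ε' * G a.1 * K := by rw [mul_one]
  calc ∑' p : S, v p ≤ ∑' p : ⋃ a, S' a, v p := ENNReal.tsum_mono_subtype v hcov
    _ ≤ ∑' a, ∑' p : S' a, v p := ENNReal.tsum_iUnion_le_tsum v S'
    _ ≤ ∑' a : ℕ × Fin 2, ε' * G a.1 * K := ENNReal.tsum_le_tsum hterm
    _ = ∑' k, ∑' _ : Fin 2, ε' * G k * K :=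
        ENNReal.tsum_prod (f := fun k (_ : Fin 2) => ε' * G k * K)
    _ = ∑' k, 2 * ε' * K * G k := by
        congr 1; ext k; simp [tsum_fintype]; ring
    _ = 2 * (∑' k, G k) * K * ε' := by rw [ENNReal.tsum_mul_left]; ring
    _ ≤ 0 + ε := by simpa using hle

end Coding

end OlsenGray

/-! ### Doubling codings and the invariance of the multifractal analysis -/

namespace OlsenGray

theorem rpow_le_mul_rpow {a b C : ℝ} (ha : 0 < a) (hb : 0 < b) (hC : 0 < C) (hab : a ≤ C * b)
    (hba : b ≤ C * a) (q : ℝ) : a ^ q ≤ C ^ |q| * b ^ q := by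
  rcases le_total 0 q with hq | hq
  · rw [abs_of_nonneg hq, ← Real.mul_rpow hC.le hb.le]
    exact Real.rpow_le_rpow ha.le hab hq
  · rw [abs_of_nonpos hq, Real.rpow_neg hC.le, ← Real.inv_rpow hC.le,
      ← Real.mul_rpow (by positivity) hb.le]
    refine Real.rpow_le_rpow_of_nonpos (by positivity) ?_ hq
    rw [inv_mul_le_iff₀ hC]
    exact hba

/-- Both the masses and the radii must be comparable in both directions, because `q` and `t` may
have either sign. -/
theorem weight_le_mul_weight {X Y : Type*} [PseudoMetricSpace X] [MeasurableSpace X]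
    [PseudoMetricSpace Y] [MeasurableSpace Y] {μ : Measure X} {ν : Measure Y} [IsFiniteMeasure μ]
    [IsFiniteMeasure ν] {x : X} {y : Y} {r ρ C D : ℝ} (hr : 0 < r) (hρ : 0 < ρ) (hC : 0 < C)
    (hD : 0 < D) (hx : 0 < μ (Metric.ball x r)) (hy : 0 < ν (Metric.ball y ρ))
    (h1 : μ (Metric.ball x r) ≤ ENNReal.ofReal C * ν (Metric.ball y ρ))
    (h2 : ν (Metric.ball y ρ) ≤ ENNReal.ofReal C * μ (Metric.ball x r))
    (h3 : r ≤ D * ρ) (h4 : ρ ≤ D * r) (q t : ℝ) :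
    weight μ q t (x, r) ≤ ENNReal.ofReal (D ^ |t| * C ^ |q|) * weight ν q t (y, ρ) := by
  have hx' : 0 < μ.real (Metric.ball x r) := ENNReal.toReal_pos hx.ne' (measure_ne_top _ _)
  have hy' : 0 < ν.real (Metric.ball y ρ) := ENNReal.toReal_pos hy.ne' (measure_ne_top _ _)
  have h1' : μ.real (Metric.ball x r) ≤ C * ν.real (Metric.ball y ρ) := by
    have := ENNReal.toReal_mono (by finiteness) h1
    rwa [ENNReal.toReal_mul, ENNReal.toReal_ofReal hC.le] at this
  have h2' : ν.real (Metric.ball y ρ) ≤ C * μ.real (Metric.ball x r) := by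
    have := ENNReal.toReal_mono (by finiteness) h2
    rwa [ENNReal.toReal_mul, ENNReal.toReal_ofReal hC.le] at this
  rw [weight_eq_ofReal hr hx, weight_eq_ofReal hρ hy, ← ENNReal.ofReal_mul (by positivity)]
  refine ENNReal.ofReal_le_ofReal ?_
  calc r ^ t * μ.real (Metric.ball x r) ^ q
      ≤ (D ^ |t| * ρ ^ t) * (C ^ |q| * ν.real (Metric.ball y ρ) ^ q) := by
        have := rpow_le_mul_rpow hr hρ hD h3 h4 t
        have := rpow_le_mul_rpow hx' hy' hC h1' h2' q
        gcongr
    _ = _ := by ring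

section Coding

variable {c : ℕ} {Y : Type*} [MetricSpace Y] {π : Word c → Y} {R : ℕ → Word c → ℕ}
  {μ : Measure (Word c)}

/-- A coding together with a measure charging all cylinders, for which the masses of a cylinder,
of its subcylinders of the next generation, and of the adjacent cylinders are comparable. -/
structure IsDoublingCoding (π : Word c → Y) (R : ℕ → Word c → ℕ) (μ : Measure (Word c)) : Prop
    extends IsCoding π R where
  pos : ∀ x n, 0 < μ (cyl x n)
  child : ∃ K : ℝ, 0 < K ∧ ∀ x n, μ (cyl x n) ≤ ENNReal.ofReal K * μ (cyl x (n + 1))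
  adjacent : ∃ K : ℝ, 0 < K ∧ ∀ n x y, R n y ≤ R n x + 1 → R n x ≤ R n y + 1 →
    μ (cyl y n) ≤ ENNReal.ofReal K * μ (cyl x n)

theorem IsDoublingCoding.ball_pos (h : IsDoublingCoding π R μ) (x : Word c) {r : ℝ} (hr : 0 < r) :
    0 < μ (Metric.ball x r) := by
  rw [ball_eq_cyl h.two_le x hr]; exact h.pos _ _

theorem ofReal_rpow_le_mul (s : ℝ≥0) {r ρ : ℝ} (hr : r ≤ 2 * c * ρ) :
    ENNReal.ofReal r ^ (s : ℝ) ≤ (ENNReal.ofReal (2 * c)) ^ (s : ℝ) * ENNReal.ofReal ρ ^ (s : ℝ) := by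
  rw [← ENNReal.mul_rpow_of_nonneg _ _ s.coe_nonneg, ← ENNReal.ofReal_mul (by positivity)]
  exact ENNReal.rpow_le_rpow (ENNReal.ofReal_le_ofReal hr) s.coe_nonneg

theorem IsCoding.dimH_preimage (h : IsCoding π R) (E : Set Y) : dimH (π ⁻¹' E) = dimH E := by
  refine le_antisymm (le_of_forall_gt_imp_ge_of_dense fun t ht => ?_) ?_
  · obtain ⟨s, hs, hst⟩ := ENNReal.lt_iff_exists_nnreal_btwn.1 ht
    refine le_trans ?_ hst.le
    exact dimH_le_of_coveringMeas_null (h.coveringMeas_preimage_null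
      (K := (ENNReal.ofReal (2 * c)) ^ (s : ℝ))
      (ENNReal.rpow_ne_top_of_nonneg s.coe_nonneg ENNReal.ofReal_ne_top)
      (fun x y r ρ _ _ hr _ => ofReal_rpow_le_mul s hr) (coveringMeas_null_of_dimH_lt hs))
  · have := (LipschitzWith.of_dist_le_mul (K := 1) (by simpa using h.dist_le)).dimH_image_le (π ⁻¹' E)
    rwa [image_preimage_eq _ h.surjective] at this

theorem IsCoding.packingDim_preimage (h : IsCoding π R) (E : Set Y) :
    packingDim (π ⁻¹' E) = packingDim E := by
  refine le_antisymm (le_iInf₂ fun s hs => ?_) (le_iInf₂ fun s hs => ?_)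
  · refine le_of_forall_gt_imp_ge_of_dense fun t' ht' => ?_
    obtain ⟨t, hst, ht⟩ := ENNReal.lt_iff_exists_nnreal_btwn.1 ht'
    have hst : (s : ℝ) < t := by exact_mod_cast hst
    refine le_trans (iInf₂_le t ?_) ht.le
    refine h.packingMeas_preimage_null (K := (ENNReal.ofReal (2 * c)) ^ (s : ℝ))
      (ENNReal.rpow_ne_top_of_nonneg s.coe_nonneg ENNReal.ofReal_ne_top)
      -- The gap `t - s` plays the role of the extra exponent `2 * η` in the transfer of packings.
      (w := fun p => ENNReal.ofReal p.2 ^ (s : ℝ)) (η := ((t : ℝ) - s) / 2)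
      (fun x r ρ _ _ hr => ofReal_rpow_le_mul s hr) (by linarith)
      (fun x r hr => le_of_eq ?_) hs
    rw [← ENNReal.rpow_add _ _ (by simpa using hr) ENNReal.ofReal_ne_top]
    congr 1
    ring
  · exact iInf₂_le s (h.packingMeas_null (K := 1) ENNReal.one_ne_top
      (w := fun p => ENNReal.ofReal p.2 ^ (s : ℝ)) (fun x r _ => by simp) hs)

theorem IsDoublingCoding.support_eq_univ (h : IsDoublingCoding π R μ) : μ.support = univ :=
  eq_univ_of_forall fun x => (Metric.nhds_basis_ball.mem_measureSupport).2 fun _ hr => h.ball_pos x hr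

variable [MeasurableSpace Y] [BorelSpace Y]

theorem IsCoding.measurable (h : IsCoding π R) : Measurable π := h.continuous.measurable

theorem IsCoding.le_map_ball (h : IsCoding π R) (x : Word c) (r : ℝ) :
    μ (Metric.ball x r) ≤ μ.map π (Metric.ball (π x) r) := by
  rw [Measure.map_apply h.measurable measurableSet_ball]
  exact measure_mono fun y hy => h.mem_ball hy

theorem IsDoublingCoding.map_ball_pos (h : IsDoublingCoding π R μ) (y : Y) {r : ℝ} (hr : 0 < r) :
    0 < μ.map π (Metric.ball y r) := by
  obtain ⟨x, rfl⟩ := h.surjective y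
  exact (h.ball_pos x hr).trans_le (h.le_map_ball x r)

/-- The preimage of the ball meets at most three cylinders of generation `level c r - 1`, of masses
comparable by adjacency; one passage to a subcylinder reaches the ball of words of radius `r`. -/
theorem IsDoublingCoding.map_ball_le (h : IsDoublingCoding π R μ) :
    ∃ K : ℝ, 1 ≤ K ∧ ∀ x r, 0 < r →
      μ.map π (Metric.ball (π x) r) ≤ ENNReal.ofReal K * μ (Metric.ball x r) := by
  obtain ⟨K₁, hK₁, hchild⟩ := h.child
  obtain ⟨K₂, hK₂, hadj⟩ := h.adjacent
  have key : ∀ x r, 0 < r → μ.map π (Metric.ball (π x) r) ≤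
      3 * ENNReal.ofReal K₂ * μ (cyl x (level c r - 1)) := by
    intro x r hr
    rw [Measure.map_apply h.measurable measurableSet_ball]
    set k := level c r - 1
    set A := π ⁻¹' Metric.ball (π x) r with hA
    have h1 : ∀ y ∈ A, R k y ≤ R k x + 1 ∧ R k x ≤ R k y + 1 := fun y hy => by
      have hy' : dist (π y) (π x) < r := hy
      exact ⟨h.rank_le_of_dist_lt (by rwa [dist_comm]), h.rank_le_of_dist_lt hy'⟩
    have hcov : A ⊆ ⋃ j : Fin 3, {y ∈ A | R k y + 1 = R k x + j} := fun y hy => by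
      have := h1 y hy
      refine mem_iUnion.2 ⟨⟨R k y + 1 - R k x, by lia⟩, hy, ?_⟩
      simp only
      lia
    calc μ A ≤ μ (⋃ j : Fin 3, {y ∈ A | R k y + 1 = R k x + j}) := measure_mono hcov
      _ ≤ ∑' j : Fin 3, μ {y ∈ A | R k y + 1 = R k x + j} := measure_iUnion_le _
      _ ≤ ∑' _ : Fin 3, ENNReal.ofReal K₂ * μ (cyl x k) := by
          refine ENNReal.tsum_le_tsum fun j => ?_
          rcases eq_empty_or_nonempty {y ∈ A | R k y + 1 = R k x + j} with he | ⟨z, hz⟩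
          · rw [he]; simp
          · refine (measure_mono fun y hy => ?_).trans (hadj k x z (h1 z hz.1).1 (h1 z hz.1).2)
            rw [← h.rank_eq_iff]
            have h2 := hz.2
            have h3 := hy.2
            lia
      _ = 3 * ENNReal.ofReal K₂ * μ (cyl x k) := by simp [tsum_fintype, mul_assoc]
  refine ⟨max 1 (3 * K₂ * max 1 K₁), le_max_left _ _, fun x r hr => (key x r hr).trans ?_⟩
  rw [ball_eq_cyl h.two_le x hr]
  have h2 : μ (cyl x (level c r - 1)) ≤ ENNReal.ofReal (max 1 K₁) * μ (cyl x (level c r)) := by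
    rcases Nat.eq_zero_or_pos (level c r) with h0 | h0
    · rw [h0]
      exact le_mul_of_one_le_left' (by simp)
    · have := hchild x (level c r - 1)
      rw [Nat.sub_add_cancel h0] at this
      exact this.trans (by gcongr; exact le_max_right _ _)
  calc 3 * ENNReal.ofReal K₂ * μ (cyl x (level c r - 1))
      ≤ 3 * ENNReal.ofReal K₂ * (ENNReal.ofReal (max 1 K₁) * μ (cyl x (level c r))) := by gcongr
    _ = ENNReal.ofReal (3 * K₂ * max 1 K₁) * μ (cyl x (level c r)) := by
        rw [ENNReal.ofReal_mul (by positivity), ENNReal.ofReal_mul (by positivity),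
          ENNReal.ofReal_ofNat]
        ring
    _ ≤ _ := by gcongr; exact le_max_right _ _

/-- Since `2 ≤ c`, doubling the radius lowers the generation by at most one, so balls of words
satisfy the doubling bound. The comparison of balls transports it. -/
theorem IsDoublingCoding.exists_doubling (h : IsDoublingCoding π R μ) :
    ∃ C : ℝ, 1 ≤ C ∧ ∀ y r, 0 < r →
      μ.map π (Metric.ball y (2 * r)) ≤ ENNReal.ofReal C * μ.map π (Metric.ball y r) := by
  obtain ⟨K, hK, hle⟩ := h.map_ball_le
  obtain ⟨K₁, hK₁, hchild⟩ := h.child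
  have hc : (2 : ℝ) ≤ c := by exact_mod_cast h.two_le
  refine ⟨K * max 1 K₁, by nlinarith [le_max_left 1 K₁], fun y r hr => ?_⟩
  obtain ⟨x, rfl⟩ := h.surjective y
  have h1 : μ (Metric.ball x (2 * r)) ≤ ENNReal.ofReal (max 1 K₁) * μ (Metric.ball x r) := by
    rw [ball_eq_cyl h.two_le x hr, ball_eq_cyl h.two_le x (by positivity)]
    have h2 := level_anti h.two_le hr (by linarith : r ≤ 2 * r)
    have h3 := level_le_level_mul_add_one h.two_le hr
    have h4 := level_anti h.two_le (by positivity) (by nlinarith : 2 * r ≤ c * r)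
    rcases h2.eq_or_lt with h5 | h5
    · rw [h5]; exact le_mul_of_one_le_left' (by simp)
    · have h6 : level c r = level c (2 * r) + 1 := by lia
      rw [h6]
      exact (hchild _ _).trans (by gcongr; exact le_max_right _ _)
  calc μ.map π (Metric.ball (π x) (2 * r)) ≤ ENNReal.ofReal K * μ (Metric.ball x (2 * r)) :=
        hle _ _ (by positivity)
    _ ≤ ENNReal.ofReal K * (ENNReal.ofReal (max 1 K₁) * μ (Metric.ball x r)) := by gcongr
    _ = ENNReal.ofReal (K * max 1 K₁) * μ (Metric.ball x r) := by
        rw [ENNReal.ofReal_mul (by linarith), mul_assoc]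
    _ ≤ _ := by gcongr; exact h.le_map_ball x r

theorem IsDoublingCoding.isDoubling (h : IsDoublingCoding π R μ) : IsDoubling (μ.map π) := by
  obtain ⟨C, -, hC⟩ := h.exists_doubling
  exact ⟨C.toNNReal, hC⟩

theorem IsDoublingCoding.support_map_eq_univ (h : IsDoublingCoding π R μ) :
    (μ.map π).support = univ :=
  eq_univ_of_forall fun x =>
    (Metric.nhds_basis_ball.mem_measureSupport).2 fun _ hr => h.map_ball_pos x hr

theorem IsDoublingCoding.exists_doubling_pow (h : IsDoublingCoding π R μ) {D : ℝ} :
    ∃ C : ℝ, 1 ≤ C ∧ ∀ y r ρ, 0 < ρ → r ≤ D * ρ →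
      μ.map π (Metric.ball y r) ≤ ENNReal.ofReal C * μ.map π (Metric.ball y ρ) := by
  obtain ⟨C, hC1, hC⟩ := h.exists_doubling
  obtain ⟨j, hj⟩ := pow_unbounded_of_one_lt D (one_lt_two (α := ℝ))
  refine ⟨C ^ j, one_le_pow₀ hC1, fun y r ρ hρ hr => ?_⟩
  have key : ∀ j : ℕ, μ.map π (Metric.ball y (2 ^ j * ρ)) ≤
      ENNReal.ofReal (C ^ j) * μ.map π (Metric.ball y ρ) := fun j => by
    induction j with
    | zero => simp
    | succ j ih =>
      calc μ.map π (Metric.ball y (2 ^ (j + 1) * ρ))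
          = μ.map π (Metric.ball y (2 * (2 ^ j * ρ))) := by rw [pow_succ]; ring_nf
        _ ≤ ENNReal.ofReal C * μ.map π (Metric.ball y (2 ^ j * ρ)) := hC _ _ (by positivity)
        _ ≤ ENNReal.ofReal C * (ENNReal.ofReal (C ^ j) * μ.map π (Metric.ball y ρ)) := by gcongr
        _ = _ := by rw [pow_succ', ENNReal.ofReal_mul (by linarith), mul_assoc]
  refine (measure_mono (Metric.ball_subset_ball ?_)).trans (key j)
  nlinarith

variable [IsFiniteMeasure μ]

theorem IsDoublingCoding.weight_map_le (h : IsDoublingCoding π R μ) (q t : ℝ) :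
    ∃ K : ℝ≥0∞, K ≠ ⊤ ∧ ∀ (x : Word c) (r : ℝ), 0 < r →
      weight (μ.map π) q t (π x, r) ≤ K * weight μ q t (x, r) := by
  obtain ⟨K, hK, hle⟩ := h.map_ball_le
  refine ⟨_, ENNReal.ofReal_ne_top, fun x r hr => weight_le_mul_weight hr hr (by linarith : 0 < K)
    one_pos (h.map_ball_pos _ hr) (h.ball_pos x hr) (hle x r hr) ?_ (one_mul r).ge (one_mul r).ge q t⟩
  exact (h.le_map_ball x r).trans (le_mul_of_one_le_left' (by simpa using hK))

theorem IsDoublingCoding.weight_le_map (h : IsDoublingCoding π R μ) (q t : ℝ) :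
    ∃ K : ℝ≥0∞, K ≠ ⊤ ∧ ∀ (x y : Word c) (r ρ : ℝ), 0 < ρ → ρ ≤ r → r ≤ 2 * c * ρ →
      dist (π x) (π y) < r → weight μ q t (y, r) ≤ K * weight (μ.map π) q t (π x, ρ) := by
  have hc : (2 : ℝ) ≤ c := by exact_mod_cast h.two_le
  obtain ⟨K, hK, hle⟩ := h.map_ball_le
  -- Moving the centre from `π y` to `π x` enlarges the radius to `2 * r ≤ 4 * c * ρ`.
  obtain ⟨C, hC1, hC⟩ := h.exists_doubling_pow (D := 4 * c)
  have hCK : 0 < C * K := by nlinarith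
  refine ⟨_, ENNReal.ofReal_ne_top, fun x y r ρ hρ hρr hr hd => weight_le_mul_weight
    (by linarith : 0 < r) hρ hCK (by positivity : (0 : ℝ) < 2 * c) (h.ball_pos y (by linarith))
    (h.map_ball_pos _ hρ) ?_ ?_ hr (by nlinarith) q t⟩
  · calc μ (Metric.ball y r) ≤ μ.map π (Metric.ball (π y) r) := h.le_map_ball y r
      _ ≤ μ.map π (Metric.ball (π x) (2 * r)) :=
          measure_mono (Metric.ball_subset_ball' (by rw [dist_comm]; linarith))
      _ ≤ ENNReal.ofReal C * μ.map π (Metric.ball (π x) ρ) := hC _ _ _ hρ (by linarith)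
      _ ≤ _ := by gcongr; nlinarith
  · calc μ.map π (Metric.ball (π x) ρ) ≤ μ.map π (Metric.ball (π y) (2 * r)) :=
          measure_mono (Metric.ball_subset_ball' (by linarith))
      _ ≤ ENNReal.ofReal C * μ.map π (Metric.ball (π y) r) :=
          hC _ _ _ (by linarith) (by nlinarith)
      _ ≤ ENNReal.ofReal C * (ENNReal.ofReal K * μ (Metric.ball y r)) := by
          gcongr; exact hle _ _ (by linarith)
      _ = _ := by rw [ENNReal.ofReal_mul (by linarith), mul_assoc]

theorem IsDoublingCoding.olsenb_map (h : IsDoublingCoding π R μ) (q : ℝ) :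
    olsenb (μ.map π) q = olsenb μ q := by
  simp only [olsenb, lowerOlsen, h.support_eq_univ, h.support_map_eq_univ]
  refine iInf_congr fun s => iInf_congr_Prop ⟨fun hs => ?_, fun hs => ?_⟩ fun _ => rfl
  · obtain ⟨K, hK, hw⟩ := h.weight_le_map q s
    simpa using h.coveringMeas_preimage_null hK hw hs
  · obtain ⟨K, hK, hw⟩ := h.weight_map_le q s
    exact h.coveringMeas_null hK hw (by simpa using hs)

/-- Unlike for `olsenb`, the exponents with null measure are not shown to be the same: one direction
loses an arbitrarily small `t - s`, so only the infima are compared. -/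
theorem IsDoublingCoding.olsenB_map (h : IsDoublingCoding π R μ) (q : ℝ) :
    olsenB (μ.map π) q = olsenB μ q := by
  simp only [olsenB, upperOlsen, h.support_eq_univ, h.support_map_eq_univ]
  refine le_antisymm (le_iInf₂ fun s hs => ?_) (le_iInf₂ fun s hs => ?_)
  · obtain ⟨K, hK, hw⟩ := h.weight_map_le q s
    exact iInf₂_le s (h.packingMeas_null hK hw (by simpa using hs))
  · refine EReal.le_of_forall_lt_iff_le.1 fun t hst => ?_
    have hst : s < t := by exact_mod_cast hst
    obtain ⟨K, hK, hw⟩ := h.weight_le_map q s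
    refine iInf₂_le t ?_
    have := h.packingMeas_preimage_null hK (fun x r ρ h1 h2 h3 => hw x x r ρ h1 h2 h3
      (by rw [dist_self]; linarith)) (v := weight μ q t) (η := (t - s) / 2) (by linarith)
      (fun x r hr => le_of_eq ?_) hs
    · simpa using this
    · rw [weight_eq_ofReal hr (h.ball_pos x hr), weight_eq_ofReal hr (h.ball_pos x hr),
        ENNReal.ofReal_rpow_of_pos hr, ← ENNReal.ofReal_mul (by positivity), ← mul_assoc,
        ← Real.rpow_add hr]
      congr 4
      ring

/-- The logarithms of the two masses differ by at most `log K`, which is negligible after division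
by `log r`. -/
theorem IsDoublingCoding.levelSet_eq (h : IsDoublingCoding π R μ) (α : ℝ) :
    levelSet μ α = π ⁻¹' levelSet (μ.map π) α := by
  obtain ⟨K, hK, hle⟩ := h.map_ball_le
  ext x
  rw [mem_preimage, mem_levelSet_iff, mem_levelSet_iff, h.support_eq_univ, h.support_map_eq_univ]
  simp only [mem_univ, true_and]
  refine tendsto_iff_of_dist ?_
  have h1 : Tendsto (fun r : ℝ => Real.log K * |Real.log r|⁻¹) (𝓝[>] 0) (𝓝 0) := by
    have := (tendsto_abs_atBot_atTop.comp Real.tendsto_log_nhdsGT_zero).inv_tendsto_atTop.const_mul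
      (Real.log K)
    simpa using this
  refine squeeze_zero' (Eventually.of_forall fun _ => dist_nonneg) ?_ h1
  filter_upwards [self_mem_nhdsWithin] with r hr
  have hr : 0 < r := hr
  have hx : 0 < μ.real (Metric.ball x r) :=
    ENNReal.toReal_pos (h.ball_pos x hr).ne' (measure_ne_top _ _)
  have hle1 : μ.real (Metric.ball x r) ≤ (μ.map π).real (Metric.ball (π x) r) :=
    ENNReal.toReal_mono (measure_ne_top _ _) (h.le_map_ball x r)
  have hle2 : (μ.map π).real (Metric.ball (π x) r) ≤ K * μ.real (Metric.ball x r) := by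
    have := ENNReal.toReal_mono (by finiteness) (hle x r hr)
    rwa [ENNReal.toReal_mul, ENNReal.toReal_ofReal (by linarith)] at this
  have hl1 := Real.log_le_log hx hle1
  have hl2 := Real.log_le_log (hx.trans_le hle1) hle2
  rw [Real.log_mul (by linarith) hx.ne'] at hl2
  rw [dist_comm, Real.dist_eq, ← sub_div, abs_div, div_eq_mul_inv]
  gcongr
  rw [abs_of_nonneg (by linarith)]
  linarith

end Coding

end OlsenGray

namespace OlsenGray

variable {c : ℕ}

/-! ### Product measures on words -/

section WordMeasure

/-- The law of a sequence of independent letters, the `n`-th one having the law `v n`. -/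
noncomputable def wordMeasure (v : ℕ → Fin c → ℝ) : Measure (Word c) :=
  Measure.infinitePi (fun n : ℕ => letterLaw (v n))

variable {v : ℕ → Fin c → ℝ}

theorem isProbabilityMeasure_wordMeasure (hv : ∀ n, IsProbVec (v n)) :
    IsProbabilityMeasure (wordMeasure v) := by
  have : ∀ n : ℕ, IsProbabilityMeasure (letterLaw (v n)) := fun n =>
    isProbabilityMeasure_letterLaw (hv n)
  exact inferInstanceAs (IsProbabilityMeasure (Measure.infinitePi fun n : ℕ => letterLaw (v n)))

theorem wordMeasure_cyl (hv : ∀ n, IsProbVec (v n)) (x : Word c) (n : ℕ) :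
    wordMeasure v (cyl x n) = ENNReal.ofReal (∏ j ∈ Finset.range n, v j (x j)) := by
  have : ∀ n : ℕ, IsProbabilityMeasure (letterLaw (v n)) := fun n =>
    isProbabilityMeasure_letterLaw (hv n)
  have h : cyl x n = Set.pi (Finset.range n : Set ℕ) (fun i : ℕ => {x i}) := by
    ext y
    change (∀ i < n, y i = x i) ↔ ∀ i ∈ (Finset.range n : Set ℕ), y i ∈ ({x i} : Set (Fin c))
    simp
  have hprod := ENNReal.ofReal_prod_of_nonneg (s := Finset.range n) (f := fun j => v j (x j))
    fun j _ => ((hv j).1 _).1.le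
  rw [hprod, h, wordMeasure]
  refine (Measure.infinitePi_pi _ (fun i _ => MeasurableSet.singleton _)).trans ?_
  simp only [letterLaw_singleton]

theorem wordMeasure_cyl_pos (hv : ∀ n, IsProbVec (v n)) (x : Word c) (n : ℕ) :
    0 < wordMeasure v (cyl x n) := by
  rw [wordMeasure_cyl hv, ENNReal.ofReal_pos]
  exact Finset.prod_pos fun j _ => ((hv j).1 _).1

theorem wordMeasure_cyl_le_succ (hv : ∀ n, IsProbVec (v n)) {m : ℝ} (hm : 0 < m)
    (hvm : ∀ n i, m ≤ v n i) (x : Word c) (n : ℕ) :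
    wordMeasure v (cyl x n) ≤ ENNReal.ofReal m⁻¹ * wordMeasure v (cyl x (n + 1)) := by
  rw [wordMeasure_cyl hv, wordMeasure_cyl hv, ← ENNReal.ofReal_mul (by positivity)]
  refine ENNReal.ofReal_le_ofReal ?_
  have hp : 0 < ∏ j ∈ Finset.range n, v j (x j) := Finset.prod_pos fun j _ => ((hv j).1 _).1
  rw [Finset.prod_range_succ, le_inv_mul_iff₀ hm, mul_comm]
  gcongr
  exact hvm _ _

/-- Only one factor of the product changes, and it stays between `m` and `1`. This is what makes the
one-letter property of Gray codes yield comparable masses. -/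
theorem wordMeasure_cyl_le_of_eq_off (hv : ∀ n, IsProbVec (v n)) {m : ℝ} (hm : 0 < m)
    (hvm : ∀ n i, m ≤ v n i) {x y : Word c} {n k : ℕ} (h : ∀ i < n, i ≠ k → y i = x i) :
    wordMeasure v (cyl y n) ≤ ENNReal.ofReal m⁻¹ * wordMeasure v (cyl x n) := by
  rw [wordMeasure_cyl hv, wordMeasure_cyl hv, ← ENNReal.ofReal_mul (by positivity)]
  refine ENNReal.ofReal_le_ofReal ?_
  have hpos : ∀ (z : Word c) (s : Finset ℕ), 0 < ∏ j ∈ s, v j (z j) := fun z s =>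
    Finset.prod_pos fun j _ => ((hv j).1 _).1
  have hm1 : 1 ≤ m⁻¹ := (one_le_inv₀ hm).2 ((hvm 0 (x 0)).trans ((hv 0).1 _).2.le)
  have heq : ∏ j ∈ (Finset.range n).erase k, v j (y j) =
      ∏ j ∈ (Finset.range n).erase k, v j (x j) := Finset.prod_congr rfl fun j hj => by
    rw [Finset.mem_erase, Finset.mem_range] at hj
    rw [h j hj.2 hj.1]
  by_cases hk : k ∈ Finset.range n
  · rw [← Finset.mul_prod_erase _ _ hk, ← Finset.mul_prod_erase _ _ hk, heq, ← mul_assoc]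
    have h1 := hpos x ((Finset.range n).erase k)
    gcongr
    refine ((hv k).1 _).2.le.trans ?_
    rw [le_inv_mul_iff₀ hm, mul_one]
    exact hvm _ _
  · rw [Finset.erase_eq_of_notMem hk] at heq
    rw [heq]
    exact le_mul_of_one_le_left (hpos x _).le hm1

theorem exists_pos_le_of_isProbVec {a : Fin c → ℝ} (ha : IsProbVec a) :
    ∃ m : ℝ, 0 < m ∧ ∀ i, m ≤ a i := by
  rcases isEmpty_or_nonempty (Fin c) with h | h
  · exact ⟨1, one_pos, fun i => isEmptyElim i⟩
  · obtain ⟨i, hi⟩ := Finite.exists_min a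
    exact ⟨a i, (ha.1 i).1, hi⟩

end WordMeasure

/-! ### Ranks of prefixes and expansions in base `c` -/

section Ranks

theorem prefixRank_eq_iff (x y : Word c) (n : ℕ) :
    prefixRank x n = prefixRank y n ↔ ∀ i < n, y i = x i := by
  induction n with
  | zero => simp [prefixRank]
  | succ n ih =>
    rw [Nat.forall_lt_succ_right, ← ih]
    simp only [prefixRank]
    have hc : 0 < c := Fin.pos (x n)
    constructor
    · intro h
      have h1 : prefixRank x n = prefixRank y n := by
        have := congrArg (· / c) h
        simpa [Nat.mul_add_div hc, Nat.div_eq_of_lt (x n).2, Nat.div_eq_of_lt (y n).2] using this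
      refine ⟨h1, Fin.ext ?_⟩
      rw [h1] at h
      lia
    · rintro ⟨h1, h2⟩
      rw [h1, h2]

/-- The dichotomy of adding one: either the last digit increases, or it passes from `c - 1` to `0`
and a carry reaches the shorter prefix. -/
theorem prefixRank_succ_cases {x y : Word c} {n : ℕ}
    (h : prefixRank y (n + 1) = prefixRank x (n + 1) + 1) :
    (y n : ℕ) = x n + 1 ∧ prefixRank y n = prefixRank x n ∨
      (y n : ℕ) = 0 ∧ (x n : ℕ) + 1 = c ∧ prefixRank y n = prefixRank x n + 1 := by
  simp only [prefixRank] at h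
  have h1 := (x n).2
  have h2 := (y n).2
  have hle : prefixRank x n ≤ prefixRank y n := by
    by_contra! hlt
    have := Nat.mul_le_mul_left c (Nat.succ_le_of_lt hlt)
    rw [Nat.succ_eq_add_one, mul_add] at this
    lia
  rcases hle.eq_or_lt with heq | hlt
  · rw [heq] at h
    exact Or.inl ⟨by lia, heq.symm⟩
  · have hle2 : prefixRank y n ≤ prefixRank x n + 1 := by
      by_contra! hlt'
      have := Nat.mul_le_mul_left c (Nat.succ_le_of_lt hlt')
      rw [Nat.succ_eq_add_one, mul_add, mul_add] at this
      lia
    have heq : prefixRank y n = prefixRank x n + 1 := by lia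
    rw [heq, mul_add] at h
    exact Or.inr ⟨by lia, by lia, heq⟩

theorem prefixRank_succ_eq_add_one [NeZero c] {x y : Word c} {n : ℕ}
    (h : prefixRank y (n + 1) = prefixRank x (n + 1) + 1) : y n = x n + 1 := by
  rcases prefixRank_succ_cases h with ⟨h1, -⟩ | ⟨h1, h2, -⟩
  · refine Fin.ext ?_
    rw [Fin.val_add, Fin.val_one', Nat.add_mod_mod, ← h1, Nat.mod_eq_of_lt (y n).2]
  · refine Fin.ext ?_
    rw [Fin.val_add, Fin.val_one', Nat.add_mod_mod, h2, Nat.mod_self, h1]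

theorem sum_ofDigitsTerm_eq (x : Word c) (n : ℕ) :
    (∑ i ∈ Finset.range n, Real.ofDigitsTerm x i) * (c : ℝ) ^ n = prefixRank x n := by
  have hc : (c : ℝ) ≠ 0 := by exact_mod_cast (Fin.pos (x 0)).ne'
  induction n with
  | zero => simp [prefixRank]
  | succ n ih =>
    rw [Finset.sum_range_succ, add_mul, pow_succ, ← mul_assoc, ih, prefixRank]
    simp only [Real.ofDigitsTerm]
    push_cast
    field_simp
    ring

theorem prefixRank_le_ofDigits_mul (x : Word c) (n : ℕ) :
    (prefixRank x n : ℝ) ≤ Real.ofDigits x * (c : ℝ) ^ n ∧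
      Real.ofDigits x * (c : ℝ) ^ n ≤ prefixRank x n + 1 := by
  have hc : 0 < (c : ℝ) := by exact_mod_cast Fin.pos (x 0)
  have h := Real.ofDigits_eq_sum_add_ofDigits x n
  have h0 := Real.ofDigits_nonneg (b := c) fun i => x (i + n)
  have h1 := Real.ofDigits_le_one (b := c) fun i => x (i + n)
  have h2 : Real.ofDigits x * (c : ℝ) ^ n =
      prefixRank x n + Real.ofDigits (b := c) fun i => x (i + n) := by
    rw [h, add_mul, sum_ofDigitsTerm_eq]
    field_simp
  rw [h2]
  constructor <;> linarith

/-- The point multiplied by `c ^ n` lies between the rank and the rank plus one, and here the two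
multiples differ by less than one. -/
theorem prefixRank_le_of_dist_lt {x y : Word c} {n : ℕ}
    (h : dist (gammaMap x) (gammaMap y) < ((c : ℝ) ^ n)⁻¹) :
    prefixRank y n ≤ prefixRank x n + 1 := by
  have hc : 0 < (c : ℝ) := by exact_mod_cast Fin.pos (x 0)
  have h1 : |Real.ofDigits x - Real.ofDigits y| < ((c : ℝ) ^ n)⁻¹ := h
  have h2 := neg_lt_of_abs_lt h1
  have h3 := (prefixRank_le_ofDigits_mul x n).2
  have h4 := (prefixRank_le_ofDigits_mul y n).1
  have h5 : Real.ofDigits y * (c : ℝ) ^ n < Real.ofDigits x * (c : ℝ) ^ n + 1 := by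
    have h6 : Real.ofDigits y < Real.ofDigits x + ((c : ℝ) ^ n)⁻¹ := by linarith
    calc Real.ofDigits y * (c : ℝ) ^ n < (Real.ofDigits x + ((c : ℝ) ^ n)⁻¹) * (c : ℝ) ^ n := by
          gcongr
      _ = _ := by field_simp
  have : (prefixRank y n : ℝ) < (prefixRank x n + 2 : ℕ) := by push_cast; linarith
  have := Nat.cast_lt.1 this
  lia

theorem gammaMap_surjective (hc : 2 ≤ c) : Function.Surjective (gammaMap (c := c)) := fun y => by
  obtain ⟨x, -, hx⟩ := Real.ofDigits_SurjOn (b := c) hc y.2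
  exact ⟨x, Subtype.ext hx⟩

end Ranks

/-! ### The Gray property of the two codes -/

section Codes

/-- Bijections `g` of the space of words such that `g` and its inverse preserve common prefixes
and such that `g` maps words with prefixes of consecutive ranks to words with prefixes differing
in at most one place. -/
structure IsGrayLike (g : Word c ≃ Word c) : Prop where
  prefix_apply : ∀ {n x y}, (∀ i < n, y i = x i) → ∀ i < n, g y i = g x i
  prefix_symm : ∀ {n x y}, (∀ i < n, y i = x i) → ∀ i < n, g.symm y i = g.symm x i
  adjacent : ∀ {n x y}, prefixRank y n = prefixRank x n + 1 →
    ∃ k, ∀ i < n, i ≠ k → g y i = g x i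

/-- Without carry the shorter prefixes coincide and only the last letter may change. With a carry
`hstep` makes the last coded letters agree, and the exceptional place comes from the shorter
prefixes. -/
theorem exists_eq_off_of_step {f : Word c → Word c}
    (hf : ∀ {n x y}, (∀ i < n, y i = x i) → ∀ i < n, f y i = f x i)
    (hstep : ∀ {n x y}, prefixRank y n = prefixRank x n + 1 →
      prefixRank y (n + 1) = prefixRank x (n + 1) + 1 → f y n = f x n) {n : ℕ} {x y : Word c}
    (h : prefixRank y n = prefixRank x n + 1) : ∃ k, ∀ i < n, i ≠ k → f y i = f x i := by
  induction n with
  | zero => simp [prefixRank] at h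
  | succ n ih =>
    rcases prefixRank_succ_cases h with ⟨-, h1⟩ | ⟨-, -, h1⟩
    · refine ⟨n, fun i hi hne => hf ((prefixRank_eq_iff x y n).1 h1.symm) i (by lia)⟩
    · obtain ⟨k, hk⟩ := ih h1
      refine ⟨k, fun i hi hne => ?_⟩
      rcases (Nat.lt_succ_iff.1 hi).eq_or_lt with rfl | hlt
      · exact hstep h1 h
      · exact hk i hlt hne

theorem isGrayLike_grayCode : IsGrayLike (grayCode c) := by
  have hpre : ∀ {n : ℕ} {x y : Word c}, (∀ i < n, y i = x i) → ∀ i < n, grayFun y i = grayFun x i := by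
    intro n x y h i hi
    cases i with
    | zero => exact h 0 hi
    | succ i => simp only [grayFun, h (i + 1) hi, h i (by lia)]
  refine ⟨hpre, fun {n x y} h i hi => ?_, fun {n x y} h => exists_eq_off_of_step hpre ?_ h⟩
  · change grayInv y i = grayInv x i
    induction i with
    | zero => exact h 0 hi
    | succ i ih => simp only [grayInv, h (i + 1) hi, ih (by lia)]
  · intro n x y h1 h2
    have : NeZero c := ⟨(Fin.pos (x 0)).ne'⟩
    rcases n with _ | n
    · simp [prefixRank] at h1
    · change y (n + 1) - y n = x (n + 1) - x n
      -- After a carry both consecutive letters increase by one modulo `c`, so their difference is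
      -- unchanged.
      rw [prefixRank_succ_eq_add_one h1, prefixRank_succ_eq_add_one h2, add_sub_add_right_eq_sub]

theorem isGrayLike_reflectedGrayCode : IsGrayLike (reflectedGrayCode c) := by
  have hpre : ∀ {n : ℕ} {x y : Word c}, (∀ i < n, y i = x i) →
      ∀ i < n, reflectedFun y i = reflectedFun x i := by
    intro n x y h i hi
    have h1 : prefixRank y i = prefixRank x i :=
      ((prefixRank_eq_iff x y i).2 fun j hj => h j (by lia)).symm
    simp only [reflectedFun, h1, h i hi]
  refine ⟨hpre, fun {n x y} h => ?_, fun {n x y} h => exists_eq_off_of_step hpre ?_ h⟩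
  · have h1 : ∀ i ≤ n, reflectedRank y i = reflectedRank x i := fun i hi => by
      induction i with
      | zero => rfl
      | succ i ih => simp only [reflectedRank, h i hi, ih (by lia)]
    intro i hi
    change flipDigit (reflectedRank y i) (y i) = flipDigit (reflectedRank x i) (x i)
    rw [h1 i hi.le, h i hi]
  · intro n x y h1 h2
    change flipDigit (prefixRank y n) (y n) = flipDigit (prefixRank x n) (x n)
    rcases prefixRank_succ_cases h2 with ⟨-, h3⟩ | ⟨h3, h4, -⟩
    · lia
    -- The letters are `c - 1` and `0`, and the ranks of the shorter prefixes have opposite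
    -- parities. Exactly one letter is flipped, and the results agree.
    · refine Fin.ext ?_
      rw [h1, flipDigit, flipDigit]
      by_cases ho : Odd (prefixRank x n)
      · rw [if_pos ho, if_neg (by rw [Nat.odd_add_one]; simpa using ho), Fin.val_rev]
        lia
      · rw [if_neg ho, if_pos (by rw [Nat.odd_add_one]; exact ho), Fin.val_rev]
        lia

theorem isGrayLike_of_mem_grayCodes {g : Word c ≃ Word c} (hg : g ∈ grayCodes c) :
    IsGrayLike g := by
  rcases hg with rfl | hg
  · exact isGrayLike_grayCode
  · rw [mem_singleton_iff.1 hg]; exact isGrayLike_reflectedGrayCode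

/-- A Gray-like bijection and a measure with independent letters of laws bounded from below give
a doubling coding of the unit interval. -/
theorem IsGrayLike.isDoublingCoding (hc : 2 ≤ c) {g : Word c ≃ Word c} (hg : IsGrayLike g)
    {v : ℕ → Fin c → ℝ} (hv : ∀ n, IsProbVec (v n)) {m : ℝ} (hm : 0 < m)
    (hvm : ∀ n i, m ≤ v n i) :
    IsDoublingCoding (fun x => gammaMap (g.symm x)) (fun n x => prefixRank (g.symm x) n)
      (wordMeasure v) where
  two_le := hc
  surjective := (gammaMap_surjective hc).comp g.symm.surjective
  dist_le x y := by
    by_cases h : x = y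
    · simp [h]
    · change _ ≤ wordDist x y
      rw [wordDist_of_ne h]
      refine Real.abs_ofDigits_sub_ofDigits_le fun i hi => ?_
      exact (hg.prefix_symm (n := prefixLength x y)
        (fun i hi => (PiNat.apply_eq_of_lt_firstDiff (E := fun _ => Fin c) hi)) i hi)
  rank_eq_iff n x y := by
    rw [prefixRank_eq_iff]
    refine ⟨fun h i hi => ?_, fun h => hg.prefix_symm h⟩
    simpa using hg.prefix_apply h i hi
  rank_le n x y h := prefixRank_le_of_dist_lt h
  pos := wordMeasure_cyl_pos hv
  child := ⟨m⁻¹, inv_pos.2 hm, wordMeasure_cyl_le_succ hv hm hvm⟩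
  adjacent := by
    refine ⟨m⁻¹, inv_pos.2 hm, fun n x y h1 h2 => ?_⟩
    suffices h : ∃ k, ∀ i < n, i ≠ k → y i = x i by
      obtain ⟨k, hk⟩ := h
      exact wordMeasure_cyl_le_of_eq_off hv hm hvm hk
    rcases lt_trichotomy (prefixRank (g.symm x) n) (prefixRank (g.symm y) n) with h | h | h
    · obtain ⟨k, hk⟩ := hg.adjacent (le_antisymm h1 h)
      exact ⟨k, by simpa using hk⟩
    · refine ⟨0, fun i hi _ => ?_⟩
      simpa using hg.prefix_apply ((prefixRank_eq_iff _ _ n).1 h) i hi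
    · obtain ⟨k, hk⟩ := hg.adjacent (le_antisymm h2 h)
      exact ⟨k, fun i hi hne => by simpa using (hk i hi hne).symm⟩

theorem isDoublingCoding_multinomial (hc : 2 ≤ c) {g : Word c ≃ Word c} (hg : g ∈ grayCodes c)
    {a b : Fin c → ℝ} (ha : IsProbVec a) (hb : IsProbVec b) (T : ℕ → ℕ) :
    IsDoublingCoding (fun x => gammaMap (g.symm x)) (fun n x => prefixRank (g.symm x) n)
      (multinomial a b T) := by
  obtain ⟨m₁, hm₁, h1⟩ := exists_pos_le_of_isProbVec ha
  obtain ⟨m₂, hm₂, h2⟩ := exists_pos_le_of_isProbVec hb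
  refine (isGrayLike_of_mem_grayCodes hg).isDoublingCoding hc
    (v := fun n => letterVec a b T (n + 1)) (fun n => isProbVec_letterVec ha hb T _)
    (lt_min hm₁ hm₂) fun n i => ?_
  unfold letterVec
  split_ifs
  · exact (min_le_left _ _).trans (h1 i)
  · exact (min_le_right _ _).trans (h2 i)

theorem isProbabilityMeasure_multinomial {a b : Fin c → ℝ} (ha : IsProbVec a) (hb : IsProbVec b)
    (T : ℕ → ℕ) : IsProbabilityMeasure (multinomial a b T) :=
  isProbabilityMeasure_wordMeasure (v := fun n => letterVec a b T (n + 1))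
    fun _ => isProbVec_letterVec ha hb T _

theorem IsCoding.grayImage_apply {g : Word c ≃ Word c} {R : ℕ → Word c → ℕ}
    (h : IsCoding (fun x => gammaMap (g.symm x)) R) (μ : Measure (Word c)) {E : Set unitInterval}
    (hE : MeasurableSet E) : grayImage g μ E = μ (g '' (gammaMap ⁻¹' E)) := by
  rw [grayImage, Measure.map_apply h.measurable hE, g.image_eq_preimage_symm]
  rfl

end Codes

end OlsenGray

namespace OlsenGray

variable {c : ℕ}

/-! ### Strong law for independent letters -/

section LargeNumbers

open ProbabilityTheory

theorem integral_letterLaw {p : Fin c → ℝ} (hp : IsProbVec p) (f : Fin c → ℝ) :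
    ∫ i, f i ∂letterLaw p = ∑ i, p i * f i := by
  rw [letterLaw, integral_finsetSum_measure fun i _ =>
    (Integrable.of_finite (μ := Measure.dirac i)).smul_measure ENNReal.ofReal_ne_top]
  simp [integral_smul_measure, ENNReal.toReal_ofReal (hp.1 _).1.le]

/-- Centred bounded variables are sub-Gaussian, so Hoeffding's bound decays geometrically in `n` and
Borel–Cantelli applies. The laws need not be identical. -/
theorem ae_eventually_sum_lt {v : ℕ → Fin c → ℝ} (hv : ∀ n, IsProbVec (v n))
    {f : ℕ → Fin c → ℝ} {B : ℝ} (hf : ∀ n i, |f n i| ≤ B) {η : ℝ} (hη : 0 < η) :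
    ∀ᵐ x ∂wordMeasure v, ∀ᶠ n : ℕ in atTop,
      ∑ j ∈ Finset.range n, (f j (x j) - ∑ i, v j i * f j i) < η * n := by
  have hlaw : ∀ n : ℕ, IsProbabilityMeasure (letterLaw (v n)) := fun n =>
    isProbabilityMeasure_letterLaw (hv n)
  let μ : Measure (ℕ → Fin c) := Measure.infinitePi fun n : ℕ => letterLaw (v n)
  change ∀ᵐ x : ℕ → Fin c ∂μ, ∀ᶠ n : ℕ in atTop,
      ∑ j ∈ Finset.range n, (f j (x j) - ∑ i, v j i * f j i) < η * n
  set X : ℕ → (ℕ → Fin c) → ℝ := fun j x => f j (x j) - ∑ i, v j i * f j i with hX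
  have hind : iIndepFun X μ := iIndepFun_infinitePi (P := fun n : ℕ => letterLaw (v n))
    (X := fun j i => f j i - ∑ i, v j i * f j i) fun j => measurable_of_finite _
  have hmeas : ∀ j, Measurable fun x : ℕ → Fin c => f j (x j) := fun j =>
    (measurable_of_finite (f j)).comp (measurable_pi_apply j)
  set b : ℝ := |B| + 1 with hb
  have hb0 : 0 < b := by positivity
  set C : ℝ≥0 := (‖b - -b‖₊ / 2) ^ 2 with hC
  have hC0 : 0 < C := by
    have : 0 < ‖b - -b‖₊ := nnnorm_pos.2 (by linarith : 0 < b - -b).ne'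
    positivity
  have hsub : ∀ j, HasSubgaussianMGF (X j) C μ := fun j => by
    have h1 := hasSubgaussianMGF_of_mem_Icc (μ := μ) (a := -b) (b := b) (hmeas j).aemeasurable
      (Eventually.of_forall fun x => abs_le.1 ((hf j (x j)).trans
        ((le_abs_self B).trans (by linarith))))
    have h2 : ∫ x, f j (x j) ∂μ = ∑ i, v j i * f j i := by
      have h3 := integral_map (μ := μ) (φ := fun x : ℕ → Fin c => x j)
        (measurable_pi_apply j).aemeasurable (f := f j)
        (measurable_of_finite (f j)).aestronglyMeasurable
      rw [← h3, Measure.infinitePi_map_eval, integral_letterLaw (hv j)]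
    rw [h2] at h1
    exact h1
  have hbound : ∀ n : ℕ, μ {x | η * n ≤ ∑ j ∈ Finset.range n, X j x} ≤
      ENNReal.ofReal (Real.exp (-(η ^ 2 / (2 * C))) ^ n) := fun n => by
    have h1 := HasSubgaussianMGF.measure_sum_range_ge_le_of_iIndepFun hind (n := n) (c := C)
      (fun j _ => hsub j) (ε := η * n) (by positivity)
    rw [← ofReal_measureReal]
    refine ENNReal.ofReal_le_ofReal (h1.trans (le_of_eq ?_))
    rw [← Real.exp_nat_mul]
    congr 1
    rcases eq_or_ne n 0 with rfl | hn
    · simp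
    · have hn' : (n : ℝ) ≠ 0 := by exact_mod_cast hn
      field_simp
  have hsum : ∑' n : ℕ, μ {x | η * n ≤ ∑ j ∈ Finset.range n, X j x} ≠ ⊤ := by
    refine ne_top_of_le_ne_top ?_ (ENNReal.tsum_le_tsum hbound)
    simp only [ENNReal.ofReal_pow (Real.exp_pos _).le]
    rw [ENNReal.tsum_geometric]
    refine ENNReal.inv_ne_top.2 (tsub_pos_iff_lt.2 ?_).ne'
    rw [ENNReal.ofReal_lt_one, Real.exp_lt_one_iff]
    have : 0 < η ^ 2 / (2 * (C : ℝ)) := by positivity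
    linarith
  filter_upwards [ae_eventually_notMem hsum] with x hx
  filter_upwards [hx] with n hn
  exact not_le.1 hn

/-- Strong law of large numbers for bounded functions of independent letters. -/
theorem ae_tendsto_sum_div {v : ℕ → Fin c → ℝ} (hv : ∀ n, IsProbVec (v n))
    {f : ℕ → Fin c → ℝ} {B : ℝ} (hf : ∀ n i, |f n i| ≤ B) :
    ∀ᵐ x ∂wordMeasure v, ∀ η : ℝ, 0 < η → ∀ᶠ n : ℕ in atTop,
      |∑ j ∈ Finset.range n, f j (x j) - ∑ j ∈ Finset.range n, ∑ i, v j i * f j i| ≤ η * n := by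
  have h1 : ∀ᵐ x ∂wordMeasure v, ∀ k : ℕ, ∀ᶠ n : ℕ in atTop,
      ∑ j ∈ Finset.range n, (f j (x j) - ∑ i, v j i * f j i) < 1 / ((k : ℝ) + 1) * n :=
    ae_all_iff.2 fun k => ae_eventually_sum_lt hv hf (by positivity)
  have h2 : ∀ᵐ x ∂wordMeasure v, ∀ k : ℕ, ∀ᶠ n : ℕ in atTop,
      ∑ j ∈ Finset.range n, (-f j (x j) - ∑ i, v j i * -f j i) < 1 / ((k : ℝ) + 1) * n :=
    ae_all_iff.2 fun k => ae_eventually_sum_lt (f := fun j i => -f j i) (B := B) hv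
      (fun n i => by rw [abs_neg]; exact hf n i) (by positivity)
  filter_upwards [h1, h2] with x hx1 hx2 η hη
  obtain ⟨k, hk⟩ := exists_nat_one_div_lt hη
  filter_upwards [hx1 k, hx2 k] with n hn1 hn2
  have hle : 1 / ((k : ℝ) + 1) * n ≤ η * n := by gcongr
  rw [abs_le, ← Finset.sum_sub_distrib]
  have h3 : ∑ j ∈ Finset.range n, (-f j (x j) - ∑ i, v j i * -f j i) =
      -∑ j ∈ Finset.range n, (f j (x j) - ∑ i, v j i * f j i) := by
    rw [← Finset.sum_neg_distrib]
    refine Finset.sum_congr rfl fun j _ => ?_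
    simp only [mul_neg, Finset.sum_neg_distrib]
    ring
  rw [h3] at hn2
  constructor <;> linarith

end LargeNumbers

/-! ### Blocks of upper density one -/

section Frequencies

open scoped Classical in
/-- The places in `P` have upper density one. -/
def DominatesOften (P : ℕ → Prop) : Prop :=
  ∀ ε : ℝ, 0 < ε → ∃ᶠ n : ℕ in atTop, (((Finset.range n).filter fun j => ¬ P j).card : ℝ) ≤ ε * n

open scoped Classical in
/-- The sum of the first `n` terms of the sequence equal to `u` at the places in `P` and to `v` at
the other places. -/
noncomputable def mixSum (P : ℕ → Prop) (u v : ℝ) (n : ℕ) : ℝ :=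
  ∑ j ∈ Finset.range n, if P j then u else v

open scoped Classical in
theorem mixSum_eq (P : ℕ → Prop) (u v : ℝ) (n : ℕ) :
    mixSum P u v n = n * u + (v - u) * ((Finset.range n).filter fun j => ¬ P j).card := by
  have h : ∀ j, (if P j then u else v) = u + (v - u) * (if ¬ P j then 1 else 0) := fun j => by
    by_cases hj : P j <;> simp [hj]
  simp only [mixSum, h, Finset.sum_add_distrib, ← Finset.mul_sum]
  rw [Finset.sum_boole]
  simp

theorem mixSum_swap (P : ℕ → Prop) (u v : ℝ) (n : ℕ) :
    mixSum (fun j => ¬ P j) u v n = mixSum P v u n := by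
  refine Finset.sum_congr rfl fun j _ => ?_
  by_cases hj : P j <;> simp [hj]

open scoped Classical in
theorem mixSum_bounds (P : ℕ → Prop) {u v : ℝ} (huv : u ≤ v) (n : ℕ) :
    n * u ≤ mixSum P u v n ∧ mixSum P u v n ≤ n * v := by
  constructor
  · have := Finset.card_nsmul_le_sum (Finset.range n) (fun j => if P j then u else v) u
      fun j _ => by split_ifs <;> simp [huv]
    simpa [mixSum] using this
  · have := Finset.sum_le_card_nsmul (Finset.range n) (fun j => if P j then u else v) v
      fun j _ => by split_ifs <;> simp [huv]
    simpa [mixSum] using this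

theorem DominatesOften.frequently_mixSum {P : ℕ → Prop} (hP : DominatesOften P) (u v : ℝ)
    {ε : ℝ} (hε : 0 < ε) : ∃ᶠ n : ℕ in atTop, |mixSum P u v n - n * u| ≤ ε * n := by
  refine (hP (ε / (|v - u| + 1)) (by positivity)).mono fun n hn => ?_
  rw [mixSum_eq, add_sub_cancel_left, abs_mul, Nat.abs_cast]
  calc |v - u| * _ ≤ |v - u| * (ε / (|v - u| + 1) * n) := by gcongr
    _ = |v - u| / (|v - u| + 1) * (ε * n) := by ring
    _ ≤ 1 * (ε * n) := by
        gcongr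
        rw [div_le_one (by positivity)]
        linarith
    _ = ε * n := one_mul _

theorem DominatesOften.frequently_mixSum' {P : ℕ → Prop} (hP : DominatesOften fun j => ¬ P j)
    (u v : ℝ) {ε : ℝ} (hε : 0 < ε) : ∃ᶠ n : ℕ in atTop, |mixSum P u v n - n * v| ≤ ε * n := by
  simpa only [mixSum_swap] using hP.frequently_mixSum v u hε

/-- If all places from `s k` on and below `t k` belong to `P` and `t k / s k` tends to infinity,
then `P` has upper density one. -/
theorem dominatesOften_of_blocks {P : ℕ → Prop} {s t : ℕ → ℕ}
    (hst : ∀ k, ∀ j, s k ≤ j → j < t k → P j) (ht : Tendsto t atTop atTop)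
    (h : ∀ ε : ℝ, 0 < ε → ∀ᶠ k in atTop, (s k : ℝ) ≤ ε * t k) : DominatesOften P := by
  classical
  intro ε hε
  refine ht.frequently ((h ε hε).mono fun k hk => ?_).frequently
  refine le_trans ?_ hk
  have : ((Finset.range (t k)).filter fun j => ¬ P j) ⊆ Finset.range (s k) := fun j hj => by
    rw [Finset.mem_filter, Finset.mem_range] at hj
    rw [Finset.mem_range]
    by_contra! hlt
    exact hj.2 (hst k j hlt hj.1)
  have := Finset.card_le_card this
  rw [Finset.card_range] at this
  exact_mod_cast this

/-- The places of the letters of law `a`. -/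
def firstBlocks (T : ℕ → ℕ) (n : ℕ) : Prop :=
  ∃ k, 1 ≤ k ∧ T (2 * k - 1) ≤ n + 1 ∧ n + 1 < T (2 * k)

theorem IsBlockSeq.le_of_le {T : ℕ → ℕ} (hT : IsBlockSeq T) {i j : ℕ} (hi : 1 ≤ i) (hij : i ≤ j) :
    T i ≤ T j :=
  Nat.le_induction le_rfl (fun k hk ih => ih.trans (hT.2.1 k (hi.trans hk)).le) j hij

theorem IsBlockSeq.le_self {T : ℕ → ℕ} (hT : IsBlockSeq T) {k : ℕ} (hk : 1 ≤ k) : k ≤ T k :=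
  Nat.le_induction (P := fun k _ => k ≤ T k) hT.1.ge
    (fun k hk ih => Nat.succ_le_of_lt (ih.trans_lt (hT.2.1 k hk))) k hk

theorem IsBlockSeq.eventually_le {T : ℕ → ℕ} (hT : IsBlockSeq T) {ε : ℝ} (hε : 0 < ε) :
    ∀ᶠ k in atTop, ((T k - 1 : ℕ) : ℝ) ≤ ε * ((T (k + 1) - 1 : ℕ) : ℝ) := by
  -- The factor `2` absorbs the shift by one between positions counted from `1` and indices counted
  -- from `0`.
  filter_upwards [hT.2.2.eventually_ge_atTop (2 / ε), eventually_ge_atTop 1] with k hk hk1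
  have h1 : (1 : ℝ) ≤ T k := by exact_mod_cast hk1.trans (hT.le_self hk1)
  have h2 : (2 : ℝ) ≤ T (k + 1) := by
    have := hT.le_self (k := k + 1) (by lia)
    exact_mod_cast (by lia : 2 ≤ T (k + 1))
  rw [div_le_div_iff₀ hε (by linarith)] at hk
  rw [Nat.cast_sub (by exact_mod_cast h1), Nat.cast_sub (by exact_mod_cast (by linarith : (1 : ℝ) ≤ T (k + 1)))]
  push_cast
  nlinarith

theorem IsBlockSeq.tendsto_sub_one {T : ℕ → ℕ} (hT : IsBlockSeq T) :
    Tendsto (fun k => T k - 1) atTop atTop := by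
  refine tendsto_atTop_mono' atTop ?_ (tendsto_sub_atTop_nat 1)
  filter_upwards [eventually_ge_atTop 1] with k hk
  exact Nat.sub_le_sub_right (hT.le_self hk) 1

theorem IsBlockSeq.dominatesOften_firstBlocks {T : ℕ → ℕ} (hT : IsBlockSeq T) :
    DominatesOften (firstBlocks T) := by
  have hk : Tendsto (fun k => 2 * k + 1) atTop atTop :=
    tendsto_atTop_mono (fun k => by simp only [id]; lia) tendsto_id
  refine dominatesOften_of_blocks (s := fun k => T (2 * k + 1) - 1)
    (t := fun k => T (2 * k + 1 + 1) - 1) (fun k j h1 h2 => ⟨k + 1, by lia, ?_, ?_⟩) ?_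
    fun ε hε => hk.eventually (hT.eventually_le hε)
  · rw [show 2 * (k + 1) - 1 = 2 * k + 1 by lia]; lia
  · rw [show 2 * (k + 1) = 2 * k + 1 + 1 by lia]; lia
  · exact hT.tendsto_sub_one.comp ((tendsto_add_atTop_nat 1).comp hk)

theorem IsBlockSeq.dominatesOften_not_firstBlocks {T : ℕ → ℕ} (hT : IsBlockSeq T) :
    DominatesOften fun n => ¬ firstBlocks T n := by
  have hk : Tendsto (fun k => 2 * k + 2) atTop atTop :=
    tendsto_atTop_mono (fun k => by simp only [id]; lia) tendsto_id
  refine dominatesOften_of_blocks (s := fun k => T (2 * k + 2) - 1)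
    (t := fun k => T (2 * k + 2 + 1) - 1) (fun k j h1 h2 => ?_) ?_
    fun ε hε => hk.eventually (hT.eventually_le hε)
  · rintro ⟨i, hi, h3, h4⟩
    rcases le_or_gt i (k + 1) with h | h
    · have := hT.le_of_le (i := 2 * i) (j := 2 * k + 2) (by lia) (by lia)
      lia
    · have := hT.le_of_le (i := 2 * k + 2 + 1) (j := 2 * i - 1) (by lia) (by lia)
      lia
  · exact hT.tendsto_sub_one.comp ((tendsto_add_atTop_nat 1).comp hk)

end Frequencies

/-! ### Coverings and packings by cylinders of one generation -/

section Generations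

variable {w : Word c × ℝ → ℝ≥0∞} {E : Set (Word c)}

/-- The radius `c ^ (1 - n)`, for which the balls are the cylinders of generation `n`. -/
noncomputable def rad (c n : ℕ) : ℝ := c * ((c : ℝ) ^ n)⁻¹

theorem rad_pos (hc : 2 ≤ c) (n : ℕ) : 0 < rad c n := by
  have : (0 : ℝ) < c := by exact_mod_cast (by lia : 0 < c)
  unfold rad; positivity

theorem ball_rad (hc : 2 ≤ c) (x : Word c) (n : ℕ) : Metric.ball x (rad c n) = cyl x n := by
  have hc1 : (1 : ℝ) < c := by exact_mod_cast hc
  rw [ball_eq_cyl hc x (rad_pos hc n)]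
  congr 1
  refine le_antisymm (level_le ?_) (not_lt.1 fun h => ?_)
  · rw [rad]
    exact lt_mul_of_one_lt_left (by positivity) hc1
  · have h1 := inv_pow_level_lt hc (rad_pos hc n)
    refine absurd h1 (not_lt.2 ?_)
    obtain ⟨k, hk⟩ := Nat.exists_eq_add_of_lt h
    have h2 : n = level c (rad c n) + (k + 1) := by lia
    have h3 : (c : ℝ) ^ (level c (rad c n)) * c ≤ (c : ℝ) ^ n := by
      rw [← pow_succ]
      exact pow_le_pow_right₀ hc1.le (by lia)
    rw [show rad c n = c * ((c : ℝ) ^ n)⁻¹ from rfl, ← div_eq_mul_inv,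
      div_le_iff₀ (by positivity), ← div_eq_inv_mul, le_div_iff₀ (by positivity), mul_comm]
    exact h3

theorem log_rad (hc : 2 ≤ c) (n : ℕ) : Real.log (rad c n) = (1 - n) * Real.log c := by
  have hc0 : (c : ℝ) ≠ 0 := by exact_mod_cast (by lia : c ≠ 0)
  rw [rad, Real.log_mul hc0 (by positivity), Real.log_inv, Real.log_pow]
  ring

theorem tendsto_rad (hc : 2 ≤ c) : Tendsto (rad c) atTop (𝓝 0) := by
  have hc1 : (1 : ℝ) < c := by exact_mod_cast hc
  have h := (tendsto_pow_atTop_nhds_zero_of_lt_one (by positivity)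
    (inv_lt_one_of_one_lt₀ hc1)).const_mul (c : ℝ)
  simp only [mul_zero, inv_pow] at h
  exact h

theorem exists_cyl_representatives (A : Set (Word c)) (n : ℕ) :
    ∃ T ⊆ A, T.Countable ∧ T.PairwiseDisjoint (fun x => cyl x n) ∧ A ⊆ ⋃ x ∈ T, cyl x n := by
  let f : Word c → Fin n → Fin c := fun x i => x i
  obtain ⟨T, hTA, hbij⟩ := exists_subset_bijOn A f
  refine ⟨T, hTA, ?_, fun x hx y hy hxy => ?_, fun z hz => ?_⟩
  · exact (Set.Finite.of_injOn (mapsTo_univ f T) hbij.injOn finite_univ).countable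
  · refine Set.disjoint_left.2 fun z hzx hzy => hxy (hbij.injOn hx hy (funext fun i => ?_))
    exact (hzx i i.2).symm.trans (hzy i i.2)
  · obtain ⟨x, hx, hxz⟩ := hbij.surjOn (mem_image_of_mem f hz)
    exact mem_iUnion₂.2 ⟨x, hx, fun i hi => (congrFun hxz ⟨i, hi⟩).symm⟩

/-- A cover may use a single generation of its choice, so infinitely many good generations suffice.
The disjointness of its cylinders bounds the sum by a small multiple of the total mass. -/
theorem coveringMeas_null_of_frequently (hc : 2 ≤ c) (m : Measure (Word c)) [IsFiniteMeasure m]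
    (h : ∀ ε : ℝ, 0 < ε → ∃ᶠ n in atTop, ∀ x ∈ E,
      w (x, rad c n) ≤ ENNReal.ofReal ε * m (cyl x n)) : coveringMeas w E = 0 := by
  rw [coveringMeas_eq_zero_iff]
  intro F hF
  rw [coveringPre_eq_zero_iff]
  intro δ hδ ε hε
  obtain ⟨ε', hε', hle⟩ := ENNReal_exists_mul_le (measure_ne_top m univ) hε
  obtain ⟨η, hη, hη0, hηε⟩ := ENNReal.lt_iff_exists_real_btwn.1 (pos_iff_ne_zero.2 hε')
  have hη' : 0 < η := by simpa using hη0
  obtain ⟨n, hn, hnδ⟩ := ((h η hη').and_eventually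
    ((tendsto_rad hc).eventually_lt_const hδ)).exists
  obtain ⟨T, hTF, hTc, hTd, hTcov⟩ := exists_cyl_representatives F n
  have := hTc.to_subtype
  refine ⟨(fun x => (x, rad c n)) '' T, ⟨hTc.image _, ?_, fun z hz => ?_⟩, ?_⟩
  · rintro _ ⟨x, hx, rfl⟩
    exact ⟨hTF hx, rad_pos hc n, hnδ⟩
  · obtain ⟨x, hx, hzx⟩ := mem_iUnion₂.1 (hTcov hz)
    refine mem_iUnion₂.2 ⟨_, ⟨x, hx, rfl⟩, ?_⟩
    rwa [ball_rad hc]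
  · calc ∑' p : (fun x => (x, rad c n)) '' T, w p ≤ ∑' x : T, w (x, rad c n) :=
          tsum_image_le_tsum w _ _
      _ ≤ ∑' x : T, ENNReal.ofReal η * m (cyl x n) :=
          ENNReal.tsum_le_tsum fun x => hn x (hF (hTF x.2))
      _ = ENNReal.ofReal η * m (⋃ x ∈ T, cyl x n) := by
          rw [ENNReal.tsum_mul_left,
            measure_biUnion hTc hTd fun x _ => measurableSet_cyl hc x n]
      _ ≤ ε' * m univ := by gcongr; exact subset_univ _
      _ ≤ ε := by rwa [mul_comm]

/-- The dual principle: cylinders of one good generation form a packing. On each piece of finite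
pre-measure this bounds `D * m` by `1` for every `D`. -/
theorem measure_null_of_packingMeas_null (hc : 2 ≤ c) (m : Measure (Word c)) [IsFiniteMeasure m]
    (h : ∀ D : ℝ, 0 < D → ∃ᶠ n in atTop, ∀ x ∈ E,
      ENNReal.ofReal D * m (cyl x n) ≤ w (x, rad c n)) (hE : packingMeas w E = 0) : m E = 0 := by
  obtain ⟨F, hF, hlt⟩ := exists_of_packingMeas_null hE one_ne_zero
  have hcov : E ⊆ ⋃ i, F i ∩ E := by rw [← iUnion_inter]; exact subset_inter hF subset_rfl
  refine measure_mono_null hcov (measure_iUnion_null fun i => ?_)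
  obtain ⟨δ, hδ, hpack⟩ := exists_of_packingPre_lt ((ENNReal.le_tsum i).trans_lt hlt)
  have key : ∀ D : ℝ, 0 < D → ENNReal.ofReal D * m (F i ∩ E) ≤ 1 := fun D hD => by
    obtain ⟨n, hn, hnδ⟩ := ((h D hD).and_eventually
      ((tendsto_rad hc).eventually_lt_const hδ)).exists
    obtain ⟨T, hTF, hTc, hTd, hTcov⟩ := exists_cyl_representatives (F i ∩ E) n
    have := hTc.to_subtype
    have hinj : InjOn (fun x : Word c => (x, rad c n)) T := fun x _ y _ hxy =>
      congrArg Prod.fst hxy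
    have hP : IsPacking δ (F i) ((fun x => (x, rad c n)) '' T) := by
      refine ⟨hTc.image _, ?_, ?_⟩
      · rintro _ ⟨x, hx, rfl⟩
        exact ⟨(hTF hx).1, rad_pos hc n, hnδ⟩
      · rintro _ ⟨x, hx, rfl⟩ _ ⟨y, hy, rfl⟩ hxy
        simp only [Function.onFun, ball_rad hc]
        exact hTd hx hy fun h => hxy (by rw [h])
    calc ENNReal.ofReal D * m (F i ∩ E) ≤ ENNReal.ofReal D * ∑' x : T, m (cyl x n) := by
          gcongr
          exact (measure_mono hTcov).trans (measure_biUnion_le m hTc _)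
      _ = ∑' x : T, ENNReal.ofReal D * m (cyl x n) := ENNReal.tsum_mul_left.symm
      _ ≤ ∑' x : T, w (x, rad c n) := ENNReal.tsum_le_tsum fun x => hn x (hTF x.2).2
      _ = ∑' p : (fun x => (x, rad c n)) '' T, w p := (tsum_image w hinj).symm
      _ ≤ 1 := hpack _ hP
  by_contra hne
  have hpos : 0 < (m (F i ∩ E)).toReal := ENNReal.toReal_pos hne (measure_ne_top _ _)
  have h1 := key (2 / (m (F i ∩ E)).toReal) (by positivity)
  rw [← ENNReal.ofReal_toReal (measure_ne_top m (F i ∩ E)), ← ENNReal.ofReal_mul (by positivity),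
    ENNReal.toReal_ofReal hpos.le, div_mul_cancel₀ _ hpos.ne'] at h1
  norm_num at h1

end Generations

end OlsenGray

namespace OlsenGray

variable {c : ℕ}

/-! ### Masses and weights of balls of words -/

section LogMass

theorem log_cast_pos (hc : 2 ≤ c) : 0 < Real.log c := Real.log_pos (by exact_mod_cast hc)

/-- The logarithm of the mass of the cylinder of generation `n` around `x`. -/
noncomputable def logMass (v : ℕ → Fin c → ℝ) (x : Word c) (n : ℕ) : ℝ :=
  ∑ j ∈ Finset.range n, Real.log (v j (x j))

variable {v : ℕ → Fin c → ℝ}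

theorem wordMeasure_cyl_eq_exp (hv : ∀ n, IsProbVec (v n)) (x : Word c) (n : ℕ) :
    wordMeasure v (cyl x n) = ENNReal.ofReal (Real.exp (logMass v x n)) := by
  rw [wordMeasure_cyl hv, logMass, Real.exp_sum]
  congr 1
  exact Finset.prod_congr rfl fun j _ => (Real.exp_log ((hv j).1 _).1).symm

theorem wordMeasure_ball (hc : 2 ≤ c) (hv : ∀ n, IsProbVec (v n)) (x : Word c) {r : ℝ}
    (hr : 0 < r) : wordMeasure v (Metric.ball x r) =
      ENNReal.ofReal (Real.exp (logMass v x (level c r))) := by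
  rw [ball_eq_cyl hc x hr, wordMeasure_cyl_eq_exp hv]

theorem weight_of_measure_ball {X : Type*} [PseudoMetricSpace X] [MeasurableSpace X]
    {μ : Measure X} {x : X} {r y : ℝ} (hr : 0 < r)
    (h : μ (Metric.ball x r) = ENNReal.ofReal (Real.exp y)) (q s : ℝ) :
    weight μ q s (x, r) = ENNReal.ofReal (Real.exp (s * Real.log r + q * y)) := by
  have hpos : 0 < μ (Metric.ball x r) := by rw [h]; simpa using Real.exp_pos y
  rw [weight, if_neg fun h' => hpos.ne' h'.2, h, ENNReal.ofReal_rpow_of_pos hr,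
    ENNReal.ofReal_rpow_of_pos (Real.exp_pos y), ← ENNReal.ofReal_mul (by positivity),
    Real.exp_add, Real.rpow_def_of_pos hr, ← Real.exp_mul, mul_comm s, mul_comm q]

theorem weight_wordMeasure (hc : 2 ≤ c) (hv : ∀ n, IsProbVec (v n)) (x : Word c) {r : ℝ}
    (hr : 0 < r) (q s : ℝ) : weight (wordMeasure v) q s (x, r) =
      ENNReal.ofReal (Real.exp (s * Real.log r + q * logMass v x (level c r))) :=
  weight_of_measure_ball hr (wordMeasure_ball hc hv x hr) q s

theorem weight_wordMeasure_rad (hc : 2 ≤ c) (hv : ∀ n, IsProbVec (v n)) (x : Word c) (n : ℕ)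
    (q s : ℝ) : weight (wordMeasure v) q s (x, rad c n) =
      ENNReal.ofReal (Real.exp (s * ((1 - n) * Real.log c) + q * logMass v x n)) := by
  rw [← log_rad hc]
  refine weight_of_measure_ball (rad_pos hc n) ?_ q s
  rw [ball_rad hc, wordMeasure_cyl_eq_exp hv]

theorem log_bounds_of_level (hc : 2 ≤ c) {r : ℝ} (hr : 0 < r) (hr1 : r ≤ 1) :
    0 ≤ Real.log r + level c r * Real.log c ∧
      Real.log r + level c r * Real.log c ≤ Real.log c := by
  have hc0 : (0 : ℝ) < c := by exact_mod_cast (by lia : 0 < c)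
  constructor
  · have h := Real.log_le_log (by positivity) (inv_pow_level_lt hc hr).le
    rw [Real.log_inv, Real.log_pow] at h
    linarith
  · have h1 := one_le_level hc hr hr1
    have h := Real.log_le_log hr (le_inv_pow_level_sub_one h1)
    rw [Real.log_inv, Real.log_pow, Nat.cast_sub h1] at h
    push_cast at h
    linarith

theorem tendsto_level (hc : 2 ≤ c) : Tendsto (level c) (𝓝[>] 0) atTop := by
  have hc0 : (0 : ℝ) < c := by exact_mod_cast (by lia : 0 < c)
  have hc1 : (1 : ℝ) < c := by exact_mod_cast hc
  refine tendsto_atTop.2 fun n => ?_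
  filter_upwards [Ioo_mem_nhdsGT (show (0 : ℝ) < ((c : ℝ) ^ n)⁻¹ by positivity)] with r hr
  have h := (inv_pow_level_lt hc hr.1).trans hr.2
  rw [inv_lt_inv₀ (by positivity) (by positivity)] at h
  exact ((pow_lt_pow_iff_right₀ hc1).1 h).le

theorem support_wordMeasure (hc : 2 ≤ c) (hv : ∀ n, IsProbVec (v n)) :
    (wordMeasure v).support = univ :=
  eq_univ_of_forall fun x => (Metric.nhds_basis_ball.mem_measureSupport).2 fun _ hr => by
    rw [ball_eq_cyl hc x hr]; exact wordMeasure_cyl_pos hv _ _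

end LogMass

/-! ### Olsen's functions of a mixture of two laws -/

section Mix

open scoped Classical in
/-- The sequence of laws equal to `l` at the places in `P` and to `h` at the other places. -/
noncomputable def mix (P : ℕ → Prop) (l h : Fin c → ℝ) (n : ℕ) : Fin c → ℝ := if P n then l else h

variable {P : ℕ → Prop} {l h : Fin c → ℝ}

theorem isProbVec_mix (hl : IsProbVec l) (hh : IsProbVec h) (n : ℕ) :
    IsProbVec (mix P l h n) := by
  unfold mix; split_ifs <;> assumption

theorem mix_swap (P : ℕ → Prop) (l h : Fin c → ℝ) : mix (fun n => ¬ P n) h l = mix P l h := by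
  funext n
  by_cases hn : P n <;> simp [mix, hn]

theorem multinomial_eq_wordMeasure (a b : Fin c → ℝ) (T : ℕ → ℕ) :
    multinomial a b T = wordMeasure (mix (firstBlocks T) a b) := rfl

theorem isProbVec_of_pos (hc : 2 ≤ c) {p : Fin c → ℝ} (hp : ∀ i, 0 < p i) (h1 : ∑ i, p i = 1) :
    IsProbVec p := by
  refine ⟨fun i => ⟨hp i, ?_⟩, h1⟩
  have : Nontrivial (Fin c) := Fin.nontrivial_iff_two_le.2 hc
  obtain ⟨j, hj⟩ := exists_ne i
  rw [← h1]
  exact Finset.single_lt_sum hj (Finset.mem_univ i) (Finset.mem_univ j) (hp j) fun k _ _ => (hp k).le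

/-- The vector with entries proportional to `p i ^ q`. -/
noncomputable def tilt (p : Fin c → ℝ) (q : ℝ) (i : Fin c) : ℝ := p i ^ q / ∑ j, p j ^ q

theorem sum_rpow_pos (hc : 2 ≤ c) {p : Fin c → ℝ} (hp : IsProbVec p) (q : ℝ) :
    0 < ∑ j, p j ^ q :=
  Finset.sum_pos (fun i _ => Real.rpow_pos_of_pos (hp.1 i).1 q) ⟨⟨0, by lia⟩, Finset.mem_univ _⟩

theorem isProbVec_tilt (hc : 2 ≤ c) {p : Fin c → ℝ} (hp : IsProbVec p) (q : ℝ) :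
    IsProbVec (tilt p q) := by
  refine isProbVec_of_pos hc
    (fun i => div_pos (Real.rpow_pos_of_pos (hp.1 i).1 q) (sum_rpow_pos hc hp q)) ?_
  simp only [tilt]
  rw [← Finset.sum_div, div_self (sum_rpow_pos hc hp q).ne']

theorem theta_mul_log (hc : 2 ≤ c) (p : Fin c → ℝ) (q : ℝ) :
    theta p q * Real.log c = Real.log (∑ i, p i ^ q) := by
  rw [theta, Real.logb, div_mul_cancel₀ _ (log_cast_pos hc).ne']

theorem log_tilt (hc : 2 ≤ c) {p : Fin c → ℝ} (hp : IsProbVec p) (q : ℝ) (i : Fin c) :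
    Real.log (tilt p q i) = q * Real.log (p i) - theta p q * Real.log c := by
  rw [tilt, Real.log_div (Real.rpow_pos_of_pos (hp.1 i).1 q).ne' (sum_rpow_pos hc hp q).ne',
    Real.log_rpow (hp.1 i).1, theta_mul_log hc]

/-- The basic identity: up to the factor `c ^ (-mixSum)`, the tilted product measure of a cylinder
is the `q`-th power of its mass. -/
theorem logMass_mix_tilt (hc : 2 ≤ c) (hl : IsProbVec l) (hh : IsProbVec h) (q : ℝ) (x : Word c)
    (n : ℕ) : logMass (mix P (tilt l q) (tilt h q)) x n =
      q * logMass (mix P l h) x n - mixSum P (theta l q) (theta h q) n * Real.log c := by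
  rw [logMass, logMass, mixSum, Finset.mul_sum, Finset.sum_mul, ← Finset.sum_sub_distrib]
  refine Finset.sum_congr rfl fun j _ => ?_
  unfold mix
  split_ifs
  · exact log_tilt hc hl q _
  · exact log_tilt hc hh q _

/-- Half of the linear gap `(s - u) * n` absorbs the error `ε * n`, the other half absorbs the
constants. -/
theorem frequently_affine_le {f : ℕ → ℝ} {u s A B : ℝ} (hs : u < s)
    (hf : ∀ ε : ℝ, 0 < ε → ∃ᶠ n : ℕ in atTop, f n ≤ n * u + ε * n) :
    ∃ᶠ n : ℕ in atTop, f n + A ≤ s * n + B := by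
  have h1 : Tendsto (fun n : ℕ => (s - u) / 2 * (n : ℝ)) atTop atTop :=
    tendsto_natCast_atTop_atTop.const_mul_atTop (by linarith)
  refine ((hf ((s - u) / 2) (by linarith)).and_eventually
    (h1.eventually_ge_atTop (A - B))).mono fun n hn => ?_
  nlinarith [hn.1, hn.2]

/-- At generations where `mixSum` is close to `n * theta l q`, the weight is the tilted mass times
about `c ^ (n * (theta l q - s))`, hence an arbitrarily small multiple of it. -/
theorem coveringMeas_mix_null (hc : 2 ≤ c) (hl : IsProbVec l) (hh : IsProbVec h)
    (hP : DominatesOften P) {q s : ℝ} (hs : theta l q < s) :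
    coveringMeas (weight (wordMeasure (mix P l h)) q s) univ = 0 := by
  have hL := log_cast_pos hc
  have hv := isProbVec_mix (P := P) (isProbVec_tilt hc hl q) (isProbVec_tilt hc hh q)
  have := isProbabilityMeasure_wordMeasure hv
  refine coveringMeas_null_of_frequently hc (wordMeasure (mix P (tilt l q) (tilt h q)))
    fun ε hε => ?_
  have hf : ∃ᶠ n : ℕ in atTop,
      mixSum P (theta l q) (theta h q) n + 0 ≤ s * n + (-s + Real.log ε / Real.log c) :=
    frequently_affine_le hs fun η hη =>
      (hP.frequently_mixSum (theta l q) (theta h q) hη).mono fun n hn => by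
        linarith [(abs_le.1 hn).2]
  refine hf.mono fun n hn x _ => ?_
  rw [weight_wordMeasure_rad hc (isProbVec_mix hl hh), wordMeasure_cyl_eq_exp hv,
    ← ENNReal.ofReal_mul hε.le]
  refine ENNReal.ofReal_le_ofReal ?_
  nth_rw 1 [← Real.exp_log hε]
  rw [← Real.exp_add, logMass_mix_tilt hc hl hh]
  refine Real.exp_le_exp.2 ?_
  have h1 := mul_le_mul_of_nonneg_right hn hL.le
  have h2 : Real.log ε / Real.log c * Real.log c = Real.log ε := div_mul_cancel₀ _ hL.ne'
  nlinarith

/-- The lower bound uses `mixSum ≥ n * theta l q` at every generation, so that the tilted measure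
obeys the mass distribution principle on all small balls. -/
theorem olsenb_mix (hc : 2 ≤ c) (hl : IsProbVec l) (hh : IsProbVec h) (hP : DominatesOften P)
    {q : ℝ} (hle : theta l q ≤ theta h q) :
    olsenb (wordMeasure (mix P l h)) q = (theta l q : EReal) := by
  have hL := log_cast_pos hc
  rw [olsenb, lowerOlsen, support_wordMeasure hc (isProbVec_mix hl hh)]
  refine le_antisymm (EReal.le_of_forall_lt_iff_le.1 fun t ht => ?_) (le_iInf₂ fun s hs => ?_)
  · exact iInf₂_le t (coveringMeas_mix_null hc hl hh hP (by exact_mod_cast ht))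
  · by_contra! hlt
    have hlt : s < theta l q := by exact_mod_cast hlt
    have hv := isProbVec_mix (P := P) (isProbVec_tilt hc hl q) (isProbVec_tilt hc hh q)
    have := isProbabilityMeasure_wordMeasure hv
    have h0 := measure_null_of_coveringMeas_null (wordMeasure (mix P (tilt l q) (tilt h q)))
      one_pos (K := ENNReal.ofReal (Real.exp (|theta l q| * Real.log c))) ENNReal.ofReal_ne_top
      (fun x _ r hr hr1 => ?_) hs
    · rw [measure_univ] at h0
      exact one_ne_zero h0
    · rw [weight_wordMeasure hc (isProbVec_mix hl hh) x hr, wordMeasure_ball hc hv x hr,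
        ← ENNReal.ofReal_mul (Real.exp_pos _).le, ← Real.exp_add, logMass_mix_tilt hc hl hh]
      refine ENNReal.ofReal_le_ofReal (Real.exp_le_exp.2 ?_)
      obtain ⟨h1, h2⟩ := log_bounds_of_level hc hr hr1.le
      have h3 := mul_le_mul_of_nonneg_right (mixSum_bounds P hle (level c r)).1 hL.le
      have h4 := Real.log_nonpos hr.le hr1.le
      have h5 : -theta l q * (Real.log r + level c r * Real.log c) ≤ |theta l q| * Real.log c :=
        (mul_le_mul_of_nonneg_right (neg_le_abs _) h1).trans
          (mul_le_mul_of_nonneg_left h2 (abs_nonneg _))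
      have h6 := mul_nonpos_of_nonneg_of_nonpos (sub_nonneg.2 hlt.le) h4
      nlinarith

/-- A packing mixes generations, so a bound at every generation is needed: `mixSum ≤ n * theta h q`.
-/
theorem packingMeas_mix_null (hc : 2 ≤ c) (hl : IsProbVec l) (hh : IsProbVec h) {q s : ℝ}
    (hle : theta l q ≤ theta h q) (hs : theta h q < s) :
    packingMeas (weight (wordMeasure (mix P l h)) q s) univ = 0 := by
  have hL := log_cast_pos hc
  have hv := isProbVec_mix (P := P) (isProbVec_tilt hc hl q) (isProbVec_tilt hc hh q)
  have := isProbabilityMeasure_wordMeasure hv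
  refine nonpos_iff_eq_zero.1 (packingMeas_le_packingPre.trans (le_of_eq ?_))
  refine packingPre_null_of_le_measure (wordMeasure (mix P (tilt l q) (tilt h q))) fun ε hε => ?_
  obtain ⟨η, -, hη0, hηε⟩ := ENNReal.lt_iff_exists_real_btwn.1 (pos_iff_ne_zero.2 hε)
  have hη : 0 < η := by simpa using hη0
  -- This radius solves `(s - theta h q) * log r ≤ log η - |theta h q| * log c`; the last term pays
  -- for replacing `r` by `c ^ (-level)`.
  refine ⟨min 1 (Real.exp ((Real.log η - |theta h q| * Real.log c) / (s - theta h q))),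
    by positivity, fun x _ r hr hrδ => ?_⟩
  refine le_trans ?_ (mul_le_mul_left hηε.le _)
  rw [weight_wordMeasure hc (isProbVec_mix hl hh) x hr, wordMeasure_ball hc hv x hr,
    ← ENNReal.ofReal_mul hη.le]
  nth_rw 1 [← Real.exp_log hη]
  rw [← Real.exp_add, logMass_mix_tilt hc hl hh]
  refine ENNReal.ofReal_le_ofReal (Real.exp_le_exp.2 ?_)
  have hr1 : r ≤ 1 := hrδ.le.trans (min_le_left _ _)
  obtain ⟨h1, h2⟩ := log_bounds_of_level hc hr hr1
  have h3 := mul_le_mul_of_nonneg_right (mixSum_bounds P hle (level c r)).2 hL.le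
  have h5 : theta h q * (Real.log r + level c r * Real.log c) ≤ |theta h q| * Real.log c :=
    (mul_le_mul_of_nonneg_right (le_abs_self _) h1).trans
      (mul_le_mul_of_nonneg_left h2 (abs_nonneg _))
  have h6 : Real.log r ≤ (Real.log η - |theta h q| * Real.log c) / (s - theta h q) := by
    rw [← Real.log_exp ((Real.log η - |theta h q| * Real.log c) / (s - theta h q))]
    exact Real.log_le_log hr (hrδ.le.trans (min_le_right _ _))
  rw [le_div_iff₀ (by linarith)] at h6
  nlinarith

/-- The lower bound uses the generations where `mixSum` is close to `n * theta h q`. There the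
weight exceeds any multiple of the tilted mass when `s < theta h q`. -/
theorem olsenB_mix (hc : 2 ≤ c) (hl : IsProbVec l) (hh : IsProbVec h)
    (hP : DominatesOften fun n => ¬ P n) {q : ℝ} (hle : theta l q ≤ theta h q) :
    olsenB (wordMeasure (mix P l h)) q = (theta h q : EReal) := by
  have hL := log_cast_pos hc
  rw [olsenB, upperOlsen, support_wordMeasure hc (isProbVec_mix hl hh)]
  refine le_antisymm (EReal.le_of_forall_lt_iff_le.1 fun t ht => ?_) (le_iInf₂ fun s hs => ?_)
  · exact iInf₂_le t (packingMeas_mix_null hc hl hh hle (by exact_mod_cast ht))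
  · by_contra! hlt
    have hlt : s < theta h q := by exact_mod_cast hlt
    have hv := isProbVec_mix (P := P) (isProbVec_tilt hc hl q) (isProbVec_tilt hc hh q)
    have := isProbabilityMeasure_wordMeasure hv
    have h0 := measure_null_of_packingMeas_null hc (wordMeasure (mix P (tilt l q) (tilt h q)))
      (fun D hD => ?_) hs
    · rw [measure_univ] at h0
      exact one_ne_zero h0
    · have hf : ∃ᶠ n : ℕ in atTop, -mixSum P (theta l q) (theta h q) n +
          Real.log D / Real.log c ≤ -s * n + s :=
        frequently_affine_le (u := -theta h q) (by linarith) fun η hη =>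
          (hP.frequently_mixSum' (theta l q) (theta h q) hη).mono fun n hn => by
            linarith [(abs_le.1 hn).1]
      refine hf.mono fun n hn x _ => ?_
      rw [weight_wordMeasure_rad hc (isProbVec_mix hl hh), wordMeasure_cyl_eq_exp hv,
        ← ENNReal.ofReal_mul hD.le]
      refine ENNReal.ofReal_le_ofReal ?_
      nth_rw 1 [← Real.exp_log hD]
      rw [← Real.exp_add, logMass_mix_tilt hc hl hh]
      refine Real.exp_le_exp.2 ?_
      have h1 := mul_le_mul_of_nonneg_right hn hL.le
      have h2 : Real.log D / Real.log c * Real.log c = Real.log D := div_mul_cancel₀ _ hL.ne'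
      nlinarith

theorem dimH_levelSet_mix_le (hc : 2 ≤ c) (hl : IsProbVec l) (hh : IsProbVec h)
    (hP : DominatesOften P) (α q : ℝ) :
    dimH (levelSet (wordMeasure (mix P l h)) α) ≤ ENNReal.ofReal (α * q + theta l q) := by
  have := isProbabilityMeasure_wordMeasure (isProbVec_mix (P := P) hl hh)
  refine le_of_forall_gt_imp_ge_of_dense fun t ht => ?_
  obtain ⟨s, hs, hst⟩ := ENNReal.lt_iff_exists_nnreal_btwn.1 ht
  refine (dimH_le_of_coveringMeas_null ?_).trans hst.le
  have hs' : α * q + theta l q < s := by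
    rw [← ENNReal.ofReal_coe_nnreal] at hs
    exact (ENNReal.ofReal_lt_ofReal_iff'.1 hs).1
  obtain ⟨t, ht1, ht2⟩ := exists_between (by linarith : theta l q < s - α * q)
  exact coveringMeas_levelSet_null (q := q) (t := t) (by linarith)
    (coveringMeas_null_mono (subset_univ _) (coveringMeas_mix_null hc hl hh hP ht1))

theorem packingDim_levelSet_mix_le (hc : 2 ≤ c) (hl : IsProbVec l) (hh : IsProbVec h) {q : ℝ}
    (hle : theta l q ≤ theta h q) (α : ℝ) :
    packingDim (levelSet (wordMeasure (mix P l h)) α) ≤ ENNReal.ofReal (α * q + theta h q) := by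
  have := isProbabilityMeasure_wordMeasure (isProbVec_mix (P := P) hl hh)
  refine le_of_forall_gt_imp_ge_of_dense fun t ht => ?_
  obtain ⟨s, hs, hst⟩ := ENNReal.lt_iff_exists_nnreal_btwn.1 ht
  refine le_trans (iInf₂_le s ?_) hst.le
  have hs' : α * q + theta h q < s := by
    rw [← ENNReal.ofReal_coe_nnreal] at hs
    exact (ENNReal.ofReal_lt_ofReal_iff'.1 hs).1
  obtain ⟨t, ht1, ht2⟩ := exists_between (by linarith : theta h q < s - α * q)
  exact packingMeas_levelSet_null (q := q) (t := t) (by linarith)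
    (nonpos_iff_eq_zero.1 ((packingMeas_mono (subset_univ _)).trans
      (packingMeas_mix_null hc hl hh hle ht1).le))

end Mix

/-! ### Measures carried by the level sets -/

section LowerBounds

variable {P : ℕ → Prop} {l h l' h' : Fin c → ℝ} {α e₁ e₂ : ℝ}

/-- A point at which the masses of the cylinders for `wordMeasure v` and `wordMeasure v'` have the
prescribed logarithmic asymptotics. -/
def IsTypical (v v' : ℕ → Fin c → ℝ) (α : ℝ) (S : ℕ → ℝ) (x : Word c) : Prop :=
  (∀ η : ℝ, 0 < η → ∀ᶠ n : ℕ in atTop, |logMass v x n + n * (α * Real.log c)| ≤ η * n) ∧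
    ∀ η : ℝ, 0 < η → ∀ᶠ n : ℕ in atTop, |logMass v' x n + S n * Real.log c| ≤ η * n

theorem exists_abs_log_mix_le (P : ℕ → Prop) (l h : Fin c → ℝ) :
    ∃ B, ∀ n i, |Real.log (mix P l h n i)| ≤ B := by
  refine ⟨∑ i, |Real.log (l i)| + ∑ i, |Real.log (h i)|, fun n i => ?_⟩
  have h1 := Finset.single_le_sum (f := fun i => |Real.log (l i)|) (fun _ _ => abs_nonneg _)
    (Finset.mem_univ i)
  have h2 := Finset.single_le_sum (f := fun i => |Real.log (h i)|) (fun _ _ => abs_nonneg _)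
    (Finset.mem_univ i)
  have h3 := abs_nonneg (Real.log (l i))
  have h4 := abs_nonneg (Real.log (h i))
  unfold mix
  split_ifs <;> linarith

/-- Both laws `l'` and `h'` give the logarithm of the letter probability the same mean, so the local
dimension does not oscillate between blocks. The entropies may differ, and their running sum is
`mixSum P e₁ e₂`. -/
theorem ae_isTypical (hl' : IsProbVec l') (hh' : IsProbVec h')
    (hαl : ∑ i, l' i * Real.log (l i) = -(α * Real.log c))
    (hαh : ∑ i, h' i * Real.log (h i) = -(α * Real.log c))
    (he₁ : ∑ i, l' i * Real.log (l' i) = -(e₁ * Real.log c))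
    (he₂ : ∑ i, h' i * Real.log (h' i) = -(e₂ * Real.log c)) :
    ∀ᵐ x ∂wordMeasure (mix P l' h'),
      IsTypical (mix P l h) (mix P l' h') α (mixSum P e₁ e₂) x := by
  obtain ⟨B, hB⟩ := exists_abs_log_mix_le P l h
  obtain ⟨B', hB'⟩ := exists_abs_log_mix_le P l' h'
  filter_upwards [ae_tendsto_sum_div (isProbVec_mix hl' hh') hB,
    ae_tendsto_sum_div (isProbVec_mix hl' hh') hB'] with x hx hx'
  refine ⟨fun η hη => (hx η hη).mono fun n hn => ?_, fun η hη => (hx' η hη).mono fun n hn => ?_⟩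
  · have h1 : ∀ j, ∑ i, mix P l' h' j i * Real.log (mix P l h j i) = -(α * Real.log c) := by
      intro j
      unfold mix
      split_ifs <;> assumption
    simp only [h1] at hn
    convert hn using 2
    simp [logMass]
  · have h1 : ∀ n, ∑ j ∈ Finset.range n, ∑ i, mix P l' h' j i * Real.log (mix P l' h' j i) =
        -(mixSum P e₁ e₂ n * Real.log c) := by
      intro n
      rw [mixSum, Finset.sum_mul, ← Finset.sum_neg_distrib]
      refine Finset.sum_congr rfl fun j _ => ?_
      unfold mix
      split_ifs <;> assumption
    rw [h1] at hn
    convert hn using 2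
    simp [logMass]

theorem IsTypical.mem_levelSet (hc : 2 ≤ c) {v v' : ℕ → Fin c → ℝ} (hv : ∀ n, IsProbVec (v n))
    {S : ℕ → ℝ} {x : Word c} (hx : IsTypical v v' α S x) : x ∈ levelSet (wordMeasure v) α := by
  have hL := log_cast_pos hc
  rw [mem_levelSet_iff, support_wordMeasure hc hv]
  refine ⟨mem_univ _, Metric.tendsto_nhds.2 fun ε hε => ?_⟩
  have h1 : Tendsto (fun n : ℕ => ε * Real.log c / 4 * (n : ℝ)) atTop atTop :=
    tendsto_natCast_atTop_atTop.const_mul_atTop (by positivity)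
  have h2 : ∀ᶠ n : ℕ in atTop, |logMass v x n + n * (α * Real.log c)| ≤ ε * Real.log c / 4 * n :=
    hx.1 _ (by positivity)
  have h3 := h1.eventually_ge_atTop (|α| * Real.log c + ε * Real.log c)
  filter_upwards [(tendsto_level hc).eventually (h2.and h3),
    Ioo_mem_nhdsGT (one_pos (α := ℝ))] with r ⟨hr2, hr3⟩ hr
  have hlog : Real.log r < 0 := Real.log_neg hr.1 hr.2
  obtain ⟨h4, h5⟩ := log_bounds_of_level hc hr.1 hr.2.le
  have hball : (wordMeasure v).real (Metric.ball x r) = Real.exp (logMass v x (level c r)) := by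
    rw [measureReal_def, wordMeasure_ball hc hv x hr.1, ENNReal.toReal_ofReal (Real.exp_pos _).le]
  rw [hball, Real.log_exp, Real.dist_eq, div_sub' hlog.ne, abs_div, abs_of_neg hlog,
    div_lt_iff₀ (by linarith)]
  have h6 : |α * (Real.log r + level c r * Real.log c)| ≤ |α| * Real.log c := by
    rw [abs_mul, abs_of_nonneg h4]
    gcongr
  have h7 : logMass v x (level c r) - Real.log r * α = (logMass v x (level c r) +
      level c r * (α * Real.log c)) - α * (Real.log r + level c r * Real.log c) := by ring
  have h8 : 0 < ε * Real.log c := by positivity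
  rw [h7]
  refine (abs_sub _ _).trans_lt ?_
  nlinarith

/-- The typical points are split according to the generation from which the estimate holds, which
makes it uniform on each piece. -/
theorem measure_isTypical_null {m : Measure (Word c)} {v v' : ℕ → Fin c → ℝ} {S : ℕ → ℝ}
    {f : ℕ → ℝ} {u : ℝ} (hu : 0 < u)
    (hf : ∀ n, f n = -S n * Real.log c + u * n)
    (h : ∀ k, m {x | IsTypical v v' α S x ∧ ∀ n ≥ k, logMass v' x n ≤ f n} = 0) :
    m {x | IsTypical v v' α S x} = 0 := by
  refine measure_mono_null (fun x hx => ?_) (measure_iUnion_null h)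
  obtain ⟨k, hk⟩ := eventually_atTop.1 (hx.2 u hu)
  refine mem_iUnion.2 ⟨k, hx, fun n hn => ?_⟩
  rw [hf]
  linarith [(abs_le.1 (hk n hn)).2]

/-- As `e₁ ≤ e₂`, the accumulated entropy is at least `n * e₁` at every generation, as mass
distribution requires. -/
theorem le_dimH_levelSet_mix (hc : 2 ≤ c) (hl : IsProbVec l) (hh : IsProbVec h)
    (hl' : IsProbVec l') (hh' : IsProbVec h')
    (hαl : ∑ i, l' i * Real.log (l i) = -(α * Real.log c))
    (hαh : ∑ i, h' i * Real.log (h i) = -(α * Real.log c))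
    (he₁ : ∑ i, l' i * Real.log (l' i) = -(e₁ * Real.log c))
    (he₂ : ∑ i, h' i * Real.log (h' i) = -(e₂ * Real.log c)) (he : e₁ ≤ e₂) :
    ENNReal.ofReal e₁ ≤ dimH (levelSet (wordMeasure (mix P l h)) α) := by
  have hL := log_cast_pos hc
  have hv := isProbVec_mix (P := P) hl' hh'
  have := isProbabilityMeasure_wordMeasure hv
  have htyp := ae_isTypical (P := P) hl' hh' hαl hαh he₁ he₂
  by_contra! hlt
  obtain ⟨s, hs, hs1⟩ := ENNReal.lt_iff_exists_nnreal_btwn.1 hlt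
  have hs' : (s : ℝ) < e₁ := by
    rw [← ENNReal.ofReal_coe_nnreal] at hs1
    exact (ENNReal.ofReal_lt_ofReal_iff'.1 hs1).1
  have hnull := coveringMeas_null_of_dimH_lt hs
  have h0 : wordMeasure (mix P l' h')
      {x | IsTypical (mix P l h) (mix P l' h') α (mixSum P e₁ e₂) x} = 0 := by
    refine measure_isTypical_null (u := (e₁ - s) * Real.log c)
      (mul_pos (by linarith) hL) (fun n => rfl) fun k => ?_
    have hc0 : (0 : ℝ) < c := by exact_mod_cast (by lia : 0 < c)
    have hc1 : (1 : ℝ) ≤ c := by exact_mod_cast (by lia : 1 ≤ c)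
    -- Below this radius the generation is at least `k`, where the uniform estimate is available.
    refine measure_null_of_coveringMeas_null _ (δ₀ := ((c : ℝ) ^ k)⁻¹) (by positivity)
      ENNReal.one_ne_top (fun x hx r hr hrδ => ?_) (coveringMeas_null_mono ?_ hnull)
    · rw [wordMeasure_ball hc hv x hr, one_mul, ENNReal.ofReal_rpow_of_pos hr,
        Real.rpow_def_of_pos hr]
      refine ENNReal.ofReal_le_ofReal (Real.exp_le_exp.2 ?_)
      have hr1 : r ≤ 1 := hrδ.le.trans (inv_le_one_of_one_le₀ (one_le_pow₀ hc1))
      have hk : k ≤ level c r := by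
        by_contra! hlt
        exact (inv_pow_level_lt hc hr).not_ge (hrδ.le.trans
          (inv_anti₀ (by positivity) (pow_le_pow_right₀ hc1 hlt.le)))
      refine (hx.2 _ hk).trans ?_
      have h1 := mul_le_mul_of_nonneg_right (mixSum_bounds P he (level c r)).1 hL.le
      have h2 := mul_le_mul_of_nonneg_right (log_bounds_of_level hc hr hr1).1 s.coe_nonneg
      nlinarith
    · exact fun x hx => hx.1.mem_levelSet hc (isProbVec_mix hl hh)
  obtain ⟨x, hx, hx'⟩ := (htyp.and (measure_eq_zero_iff_ae_notMem.1 h0)).exists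
  exact hx' hx

/-- Here it is enough that the accumulated entropy comes close to `n * e₂` at infinitely many
generations. -/
theorem le_packingDim_levelSet_mix (hc : 2 ≤ c) (hl : IsProbVec l) (hh : IsProbVec h)
    (hl' : IsProbVec l') (hh' : IsProbVec h') (hP : DominatesOften fun n => ¬ P n)
    (hαl : ∑ i, l' i * Real.log (l i) = -(α * Real.log c))
    (hαh : ∑ i, h' i * Real.log (h i) = -(α * Real.log c))
    (he₁ : ∑ i, l' i * Real.log (l' i) = -(e₁ * Real.log c))
    (he₂ : ∑ i, h' i * Real.log (h' i) = -(e₂ * Real.log c)) :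
    ENNReal.ofReal e₂ ≤ packingDim (levelSet (wordMeasure (mix P l h)) α) := by
  have hL := log_cast_pos hc
  have hv := isProbVec_mix (P := P) hl' hh'
  have := isProbabilityMeasure_wordMeasure hv
  have htyp := ae_isTypical (P := P) hl' hh' hαl hαh he₁ he₂
  refine le_iInf₂ fun s hnull => ?_
  by_contra! hlt
  have hs' : (s : ℝ) < e₂ := by
    rw [← ENNReal.ofReal_coe_nnreal] at hlt
    exact (ENNReal.ofReal_lt_ofReal_iff'.1 hlt).1
  have h0 : wordMeasure (mix P l' h')
      {x | IsTypical (mix P l h) (mix P l' h') α (mixSum P e₁ e₂) x} = 0 := by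
    -- Half of the gap `e₂ - s` is spent on the strong law, the other half on the generations close
    -- to the extreme.
    refine measure_isTypical_null (u := (e₂ - s) / 2 * Real.log c)
      (mul_pos (by linarith) hL) (fun n => rfl) fun k => ?_
    refine measure_null_of_packingMeas_null hc _ (fun D hD => ?_)
      (nonpos_iff_eq_zero.1 ((packingMeas_mono ?_).trans hnull.le))
    · have hf : ∃ᶠ n : ℕ in atTop, -mixSum P e₁ e₂ n + Real.log D / Real.log c ≤
          (-(s + e₂) / 2) * n + s :=
        frequently_affine_le (u := -e₂) (by linarith) fun η hη =>
          (hP.frequently_mixSum' e₁ e₂ hη).mono fun n hn => by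
            linarith [(abs_le.1 hn).1]
      refine (hf.and_eventually (eventually_ge_atTop k)).mono fun n hn x hx => ?_
      simp only
      rw [wordMeasure_cyl_eq_exp hv, ← ENNReal.ofReal_mul hD.le,
        ENNReal.ofReal_rpow_of_pos (rad_pos hc n), Real.rpow_def_of_pos (rad_pos hc n), log_rad hc]
      refine ENNReal.ofReal_le_ofReal ?_
      nth_rw 1 [← Real.exp_log hD]
      rw [← Real.exp_add]
      refine Real.exp_le_exp.2 ?_
      have h1 := mul_le_mul_of_nonneg_right hn.1 hL.le
      have h2 : Real.log D / Real.log c * Real.log c = Real.log D := div_mul_cancel₀ _ hL.ne'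
      have h3 := hx.2 n hn.2
      nlinarith
    · exact fun x hx => hx.1.mem_levelSet hc (isProbVec_mix hl hh)
  obtain ⟨x, hx, hx'⟩ := (htyp.and (measure_eq_zero_iff_ae_notMem.1 h0)).exists
  exact hx' hx

end LowerBounds

end OlsenGray

namespace OlsenGray

/-! ### Vectors with equal moments -/

section Moments

variable {A B : Fin 4 → ℝ}

/-- The sums of `x`, `exp x` and `x * exp x` over the entries of two vectors are equal. -/
def EqualMoments (A B : Fin 4 → ℝ) : Prop :=
  ∑ i, A i = ∑ i, B i ∧ ∑ i, Real.exp (A i) = ∑ i, Real.exp (B i) ∧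
    ∑ i, A i * Real.exp (A i) = ∑ i, B i * Real.exp (B i)

theorem EqualMoments.symm (h : EqualMoments A B) : EqualMoments B A :=
  ⟨h.1.symm, h.2.1.symm, h.2.2.symm⟩

/-- A combination of `x`, `exp x` and `x * exp x` increasing outside and decreasing inside of a
given interval. -/
theorem exists_moment_function {s t : ℝ} (hst : s < t) : ∃ u v : ℝ,
    MonotoneOn (fun x => x - u * Real.exp x - v * (x * Real.exp x)) (Iic s) ∧
    StrictAntiOn (fun x => x - u * Real.exp x - v * (x * Real.exp x)) (Icc s t) ∧
    MonotoneOn (fun x => x - u * Real.exp x - v * (x * Real.exp x)) (Ici t) := by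
  -- The derivative is `exp x` times the difference of `exp (-x)` and its chord over `[s, t]`, whose
  -- slope is `β`. Its sign comes from strict convexity.
  set β := (Real.exp (-t) - Real.exp (-s)) / (t - s) with hβ
  have hβ' : β * (t - s) = Real.exp (-t) - Real.exp (-s) := div_mul_cancel₀ _ (by linarith)
  set u := Real.exp (-s) - β * s - β with hu
  have hderiv : ∀ x, HasDerivAt (fun x => x - u * Real.exp x - β * (x * Real.exp x))
      (Real.exp x * (Real.exp (-x) - (Real.exp (-s) + β * (x - s)))) x := fun x => by
    have h1 := ((hasDerivAt_id x).sub ((Real.hasDerivAt_exp x).const_mul u)).sub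
      (((hasDerivAt_id x).mul (Real.hasDerivAt_exp x)).const_mul β)
    refine h1.congr_deriv ?_
    have : Real.exp x * Real.exp (-x) = 1 := by rw [← Real.exp_add]; simp
    rw [mul_sub, this, hu]
    simp only [id]
    ring
  have hcont : Continuous fun x => x - u * Real.exp x - β * (x * Real.exp x) := by fun_prop
  refine ⟨u, β, ?_, ?_, ?_⟩
  · refine monotoneOn_of_deriv_nonneg (convex_Iic s) hcont.continuousOn
      (fun x _ => (hderiv x).differentiableAt.differentiableWithinAt) fun x hx => ?_
    rw [interior_Iic] at hx
    have hx : x < s := hx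
    rw [(hderiv x).deriv]
    refine mul_nonneg (Real.exp_pos x).le ?_
    have h := strictConvexOn_exp.slope_strict_mono_adjacent (mem_univ (-t)) (mem_univ (-x))
      (by linarith : -t < -s) (by linarith : -s < -x)
    rw [div_lt_div_iff₀ (by linarith) (by linarith)] at h
    have h2 : 0 < (Real.exp (-x) - (Real.exp (-s) + β * (x - s))) * (t - s) := by nlinarith
    exact (pos_of_mul_pos_left h2 (by linarith)).le
  · refine strictAntiOn_of_deriv_neg (convex_Icc s t) hcont.continuousOn fun x hx => ?_
    rw [interior_Icc] at hx
    rw [(hderiv x).deriv]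
    refine mul_neg_of_pos_of_neg (Real.exp_pos x) ?_
    have h := strictConvexOn_exp.slope_strict_mono_adjacent (mem_univ (-t)) (mem_univ (-s))
      (by linarith [hx.2] : -t < -x) (by linarith [hx.1] : -x < -s)
    rw [div_lt_div_iff₀ (by linarith [hx.2]) (by linarith [hx.1])] at h
    have h2 : (Real.exp (-x) - (Real.exp (-s) + β * (x - s))) * (t - s) < 0 := by
      have : (Real.exp (-x) - (Real.exp (-s) + β * (x - s))) * (t - s) =
          (Real.exp (-x) - Real.exp (-s)) * (t - s) -
            (Real.exp (-t) - Real.exp (-s)) * (x - s) := by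
        linear_combination (-(x - s)) * hβ'
      rw [this]
      linarith
    exact neg_of_mul_neg_left h2 (by linarith)
  · refine monotoneOn_of_deriv_nonneg (convex_Ici t) hcont.continuousOn
      (fun x _ => (hderiv x).differentiableAt.differentiableWithinAt) fun x hx => ?_
    rw [interior_Ici] at hx
    have hx : t < x := hx
    rw [(hderiv x).deriv]
    refine mul_nonneg (Real.exp_pos x).le ?_
    have h := strictConvexOn_exp.slope_strict_mono_adjacent (mem_univ (-x)) (mem_univ (-s))
      (by linarith : -x < -t) (by linarith : -t < -s)
    rw [div_lt_div_iff₀ (by linarith) (by linarith)] at h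
    have h2 : 0 < (Real.exp (-x) - (Real.exp (-s) + β * (x - s))) * (t - s) := by nlinarith
    exact (pos_of_mul_pos_left h2 (by linarith)).le

/-- Two increasing vectors with equal moments whose difference changes sign at most twice are
equal. -/
theorem EqualMoments.eq_of_signs (h : EqualMoments A B) (hA : Monotone A) (hB : Monotone B)
    (i j : ℕ) (h1 : ∀ k : Fin 4, (k : ℕ) < i → B k ≤ A k)
    (h2 : ∀ k : Fin 4, i ≤ k → (k : ℕ) < j → A k ≤ B k)
    (h3 : ∀ k : Fin 4, j ≤ k → B k ≤ A k) : A = B := by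
  have hsum_le : ∀ G : ℝ → ℝ, ∑ k, G (A k) = ∑ k, G (B k) → (∀ k, G (B k) ≤ G (A k)) →
      ∀ k, G (B k) = G (A k) := fun G hG hle k =>
    (Finset.sum_eq_sum_iff_of_le fun k _ => hle k).1 hG.symm k (Finset.mem_univ k)
  by_cases hex : ∃ k : Fin 4, i ≤ k ∧ (k : ℕ) < j ∧ A k < B k
  · exfalso
    obtain ⟨k, hik, hkj, hk⟩ := hex
    have hi : i < 4 := by lia
    obtain ⟨m, hm, hmk, hmj⟩ : ∃ m : Fin 4, (k : ℕ) ≤ m ∧ (m : ℕ) < j ∧ ∀ k : Fin 4, (k : ℕ) < j →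
        k ≤ m := by
      refine ⟨⟨min (j - 1) 3, by lia⟩, by simp only; lia, by simp only; lia, fun k hk => ?_⟩
      rw [Fin.le_def]
      simp only
      lia
    -- The interval is spanned by the least `A` and the greatest `B` of the middle run. With
    -- monotonicity outside and decrease inside, `G (B k) ≤ G (A k)` termwise. Equal sums then force
    -- equality, against strict decrease at `k`.
    have hst : A ⟨i, hi⟩ < B m := (hA (Fin.le_def.2 hik)).trans_lt (hk.trans_le (hB (Fin.le_def.2 hm)))
    obtain ⟨u, v, hmono, hanti, hmono'⟩ := exists_moment_function hst
    set G := fun x => x - u * Real.exp x - v * (x * Real.exp x) with hG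
    have hGsum : ∑ k, G (A k) = ∑ k, G (B k) := by
      simp only [hG, Finset.sum_sub_distrib, ← Finset.mul_sum]
      rw [h.1, h.2.1, h.2.2]
    have hmem : ∀ k : Fin 4, i ≤ k → (k : ℕ) < j → A k ∈ Icc (A ⟨i, hi⟩) (B m) ∧
        B k ∈ Icc (A ⟨i, hi⟩) (B m) := fun k hik hkj =>
      have h4 := hA (show (⟨i, hi⟩ : Fin 4) ≤ k from hik)
      have h5 := hB (hmj k hkj)
      have h6 := h2 k hik hkj
      ⟨⟨h4, h6.trans h5⟩, ⟨h4.trans h6, h5⟩⟩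
    have hle : ∀ k, G (B k) ≤ G (A k) := fun k => by
      rcases lt_or_ge (k : ℕ) i with hki | hki
      · have h4 := hA (show k ≤ (⟨i, hi⟩ : Fin 4) from hki.le)
        exact hmono ((h1 k hki).trans h4) h4 (h1 k hki)
      rcases lt_or_ge (k : ℕ) j with hkj | hkj
      · exact hanti.antitoneOn (hmem k hki hkj).1 (hmem k hki hkj).2 (h2 k hki hkj)
      · have h4 := hB (show m ≤ k from Fin.le_def.2 (hmk.le.trans hkj))
        exact hmono' h4 (h4.trans (h3 k hkj)) (h3 k hkj)
    have h7 := hsum_le G hGsum hle k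
    have h8 := hanti (hmem k hik hkj).1 (hmem k hik hkj).2 hk
    exact h8.ne h7
  · push Not at hex
    have hle : ∀ k, B k ≤ A k := fun k => by
      rcases lt_or_ge (k : ℕ) i with hki | hki
      · exact h1 k hki
      rcases lt_or_ge (k : ℕ) j with hkj | hkj
      · exact hex k hki hkj
      · exact h3 k hkj
    exact funext fun k => (hsum_le id h.1 hle k).symm

/-- The entries of two increasing vectors are interlaced in the order `A B B A A B B A`. -/
def Interlaced (A B : Fin 4 → ℝ) : Prop := A 0 < B 0 ∧ B 1 < A 1 ∧ A 2 < B 2 ∧ B 3 < A 3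

/-- Since two sign changes are not enough, the four differences must change sign three times, which
leaves only strict alternation. The sign patterns excluded by `key` and `key'` settle the finite
case check. -/
theorem EqualMoments.interlaced (h : EqualMoments A B) (hA : Monotone A) (hB : Monotone B)
    (hne : A ≠ B) : Interlaced A B ∨ Interlaced B A := by
  have key : ∀ i j : ℕ, ¬ ((∀ k : Fin 4, (k : ℕ) < i → B k ≤ A k) ∧
      (∀ k : Fin 4, i ≤ k → (k : ℕ) < j → A k ≤ B k) ∧ ∀ k : Fin 4, j ≤ k → B k ≤ A k) :=
    fun i j hk => hne (h.eq_of_signs hA hB i j hk.1 hk.2.1 hk.2.2)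
  have key' : ∀ i j : ℕ, ¬ ((∀ k : Fin 4, (k : ℕ) < i → A k ≤ B k) ∧
      (∀ k : Fin 4, i ≤ k → (k : ℕ) < j → B k ≤ A k) ∧ ∀ k : Fin 4, j ≤ k → A k ≤ B k) :=
    fun i j hk => hne (h.symm.eq_of_signs hB hA i j hk.1 hk.2.1 hk.2.2).symm
  have k00 := key 0 0; have k01 := key 0 1; have k02 := key 0 2; have k03 := key 0 3
  have k04 := key 0 4; have k12 := key 1 2; have k13 := key 1 3; have k14 := key 1 4
  have k23 := key 2 3; have k24 := key 2 4; have k34 := key 3 4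
  have l01 := key' 0 1; have l02 := key' 0 2; have l03 := key' 0 3
  have l12 := key' 1 2; have l13 := key' 1 3; have l14 := key' 1 4
  have l23 := key' 2 3; have l24 := key' 2 4; have l34 := key' 3 4
  clear key key'
  have h3 : Fin.succ (2 : Fin 3) = 3 := rfl
  simp only [Fin.forall_fin_succ, IsEmpty.forall_iff, Fin.val_zero, Fin.val_succ,
    Fin.succ_zero_eq_one, Fin.succ_one_eq_two, h3] at *
  norm_num at *
  unfold Interlaced
  clear h hA hB hne h3
  rcases lt_or_ge (A 0) (B 0) with h0 | h0 <;> rcases lt_or_ge (A 1) (B 1) with h1 | h1 <;>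
    rcases lt_or_ge (A 2) (B 2) with h2 | h2 <;> rcases lt_or_ge (A 3) (B 3) with h3 | h3 <;>
    grind

/-- A combination of `x`, `exp x`, `x * exp x` and `Γ` which takes equal values at the ends of four
consecutive intervals vanishes, if `ψ = exp (-x) * Γ'` is such that `exp x * ψ''` is injective. -/
theorem eq_zero_of_four_intervals {Γ ψ ψ₁ ψ₂ : ℝ → ℝ}
    (hΓ : ∀ x, HasDerivAt Γ (Real.exp x * ψ x) x) (hψ : ∀ x, HasDerivAt ψ (ψ₁ x) x)
    (hψ₁ : ∀ x, HasDerivAt ψ₁ (ψ₂ x) x) (hinj : Function.Injective fun x => Real.exp x * ψ₂ x)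
    {s t : Fin 4 → ℝ} (hst : ∀ k, s k < t k) (h01 : t 0 ≤ s 1) (h12 : t 1 ≤ s 2) (h23 : t 2 ≤ s 3)
    {w : Fin 4 → ℝ}
    (hw : ∀ k, w 0 * s k + w 1 * Real.exp (s k) + w 2 * (s k * Real.exp (s k)) + w 3 * Γ (s k) =
      w 0 * t k + w 1 * Real.exp (t k) + w 2 * (t k * Real.exp (t k)) + w 3 * Γ (t k)) :
    w = 0 := by
  set u : ℝ → ℝ := fun x => w 0 * Real.exp (-x) + w 1 + w 2 * (1 + x) + w 3 * ψ x with hu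
  set u₁ : ℝ → ℝ := fun x => -w 0 * Real.exp (-x) + w 2 + w 3 * ψ₁ x with hu₁
  set u₂ : ℝ → ℝ := fun x => w 0 * Real.exp (-x) + w 3 * ψ₂ x with hu₂
  have hexp : ∀ x : ℝ, HasDerivAt (fun x => Real.exp (-x)) (-Real.exp (-x)) x := fun x => by
    simpa using (hasDerivAt_neg x).exp
  have hF : ∀ x, HasDerivAt (fun x => w 0 * x + w 1 * Real.exp x + w 2 * (x * Real.exp x) + w 3 * Γ x)
      (Real.exp x * u x) x := fun x => by
    have h1 := ((((hasDerivAt_id x).const_mul (w 0)).add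
      ((Real.hasDerivAt_exp x).const_mul (w 1))).add
      (((hasDerivAt_id x).mul (Real.hasDerivAt_exp x)).const_mul (w 2))).add ((hΓ x).const_mul (w 3))
    refine h1.congr_deriv ?_
    have : Real.exp x * Real.exp (-x) = 1 := by rw [← Real.exp_add]; simp
    simp only [hu, id]
    linear_combination (-w 0) * this
  have hu' : ∀ x, HasDerivAt u (u₁ x) x := fun x => by
    have h1 := ((((hexp x).const_mul (w 0)).add_const (w 1)).add
      (((hasDerivAt_id x).const_add 1).const_mul (w 2))).add ((hψ x).const_mul (w 3))
    refine h1.congr_deriv ?_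
    simp only [hu₁]
    ring
  have hu₁' : ∀ x, HasDerivAt u₁ (u₂ x) x := fun x => by
    have h1 := (((hexp x).const_mul (-w 0)).add_const (w 2)).add ((hψ₁ x).const_mul (w 3))
    refine h1.congr_deriv ?_
    simp only [hu₂]
    ring
  have rolle : ∀ {f f' : ℝ → ℝ} {a b : ℝ}, (∀ x, HasDerivAt f (f' x) x) → a < b → f a = f b →
      ∃ x ∈ Ioo a b, f' x = 0 := fun hf hab hfab =>
    exists_hasDerivAt_eq_zero hab (fun x _ => (hf x).continuousAt.continuousWithinAt) hfab
      fun x _ => hf x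
  -- Four zeros of `u` give three zeros of `u'` and two distinct zeros of `u''`. There `w 0 + w 3 *
  -- (exp z * ψ₂ z) = 0`, so injectivity kills `w 3`, and the other coefficients vanish in turn.
  have hx : ∀ k, ∃ x ∈ Ioo (s k) (t k), u x = 0 := fun k => by
    obtain ⟨x, hx, hx0⟩ := rolle hF (hst k) (hw k)
    exact ⟨x, hx, (mul_eq_zero.1 hx0).resolve_left (Real.exp_pos x).ne'⟩
  choose x hx hx0 using hx
  have hx01 : x 0 < x 1 := (hx 0).2.trans_le (h01.trans (hx 1).1.le)
  have hx12 : x 1 < x 2 := (hx 1).2.trans_le (h12.trans (hx 2).1.le)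
  have hx23 : x 2 < x 3 := (hx 2).2.trans_le (h23.trans (hx 3).1.le)
  obtain ⟨y₀, hy₀, hy₀0⟩ := rolle hu' hx01 (by rw [hx0, hx0])
  obtain ⟨y₁, hy₁, hy₁0⟩ := rolle hu' hx12 (by rw [hx0, hx0])
  obtain ⟨y₂, hy₂, hy₂0⟩ := rolle hu' hx23 (by rw [hx0, hx0])
  obtain ⟨z₀, hz₀, hz₀0⟩ := rolle hu₁' (hy₀.2.trans hy₁.1) (by rw [hy₀0, hy₁0])
  obtain ⟨z₁, hz₁, hz₁0⟩ := rolle hu₁' (hy₁.2.trans hy₂.1) (by rw [hy₁0, hy₂0])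
  have hz : ∀ z, u₂ z = 0 → w 0 + w 3 * (Real.exp z * ψ₂ z) = 0 := fun z hz => by
    have : Real.exp z * Real.exp (-z) = 1 := by rw [← Real.exp_add]; simp
    simp only [hu₂] at hz
    linear_combination Real.exp z * hz - w 0 * this
  have e0 := hz _ hz₀0
  have e1 := hz _ hz₁0
  have hne : Real.exp z₀ * ψ₂ z₀ - Real.exp z₁ * ψ₂ z₁ ≠ 0 := sub_ne_zero.2 fun h =>
    (hz₀.2.trans hz₁.1).ne (hinj h)
  have w3 : w 3 = 0 := by
    have : w 3 * (Real.exp z₀ * ψ₂ z₀ - Real.exp z₁ * ψ₂ z₁) = 0 := by linear_combination e0 - e1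
    exact (mul_eq_zero.1 this).resolve_right hne
  have w0 : w 0 = 0 := by simpa [w3] using e0
  have w2 : w 2 = 0 := by simpa [hu₁, w3, w0] using hy₀0
  have w1 : w 1 = 0 := by
    have := hx0 0
    simpa [hu, w3, w0, w2] using this
  funext k
  fin_cases k <;> assumption

/-- If the sums agreed, the four rows of the matrix of differences would add up to zero. A nonzero
kernel vector is then a combination of the four functions with equal values at both ends of each of
the four interlaced intervals, which Rolle's theorem excludes. -/
theorem Interlaced.sum_ne (h : Interlaced A B) (hA : Monotone A) (hB : Monotone B)
    (hm : EqualMoments A B) {Γ ψ ψ₁ ψ₂ : ℝ → ℝ}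
    (hΓ : ∀ x, HasDerivAt Γ (Real.exp x * ψ x) x) (hψ : ∀ x, HasDerivAt ψ (ψ₁ x) x)
    (hψ₁ : ∀ x, HasDerivAt ψ₁ (ψ₂ x) x) (hinj : Function.Injective fun x => Real.exp x * ψ₂ x) :
    ∑ i, Γ (A i) ≠ ∑ i, Γ (B i) := by
  intro hsum
  let f : Fin 4 → ℝ → ℝ := ![fun x => x, Real.exp, fun x => x * Real.exp x, Γ]
  let M : Matrix (Fin 4) (Fin 4) ℝ := Matrix.of fun k j => f j (A k) - f j (B k)
  have hv : Matrix.vecMul (fun _ => 1) M = 0 := by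
    funext j
    have : ∑ k, f j (A k) = ∑ k, f j (B k) := by
      fin_cases j
      · exact hm.1
      · exact hm.2.1
      · exact hm.2.2
      · exact hsum
    simp [Matrix.vecMul, dotProduct, M, Finset.sum_sub_distrib, this]
  have hdet : M.det = 0 := Matrix.exists_vecMul_eq_zero_iff.1
    ⟨fun _ => 1, fun h => one_ne_zero (congrFun h 0), hv⟩
  obtain ⟨w, hw0, hw⟩ := Matrix.exists_mulVec_eq_zero_iff.2 hdet
  have hw' : ∀ k, w 0 * A k + w 1 * Real.exp (A k) + w 2 * (A k * Real.exp (A k)) + w 3 * Γ (A k) =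
      w 0 * B k + w 1 * Real.exp (B k) + w 2 * (B k * Real.exp (B k)) + w 3 * Γ (B k) := fun k => by
    have h1 := congrFun hw k
    simp only [Matrix.mulVec, dotProduct, Fin.sum_univ_four, M, Matrix.of_apply, f,
      Matrix.cons_val, Pi.zero_apply] at h1
    linear_combination h1
  obtain ⟨h0, h1, h2, h3⟩ := h
  refine hw0 (eq_zero_of_four_intervals hΓ hψ hψ₁ hinj (s := ![A 0, B 1, A 2, B 3])
    (t := ![B 0, A 1, B 2, A 3]) (fun k => ?_) (hB (by decide)) (hA (by decide)) (hB (by decide))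
    fun k => ?_)
  · fin_cases k <;> assumption
  · fin_cases k
    · exact hw' 0
    · exact (hw' 1).symm
    · exact hw' 2
    · exact (hw' 3).symm

end Moments

end OlsenGray

namespace OlsenGray

/-! ### Derivatives and analyticity of `theta` -/

section Theta

variable {c : ℕ} {p : Fin c → ℝ}

/-- The `k`-th derivative at `q` of `∑ i, p i ^ q`. -/
noncomputable def powSum (p : Fin c → ℝ) (k : ℕ) (q : ℝ) : ℝ :=
  ∑ i, p i ^ q * Real.log (p i) ^ k

theorem hasDerivAt_powSum (hp : ∀ i, 0 < p i) (k : ℕ) (q : ℝ) :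
    HasDerivAt (powSum p k) (powSum p (k + 1) q) q := by
  unfold powSum
  refine HasDerivAt.fun_sum fun i _ => ?_
  have h := (Real.hasStrictDerivAt_const_rpow (hp i) q).hasDerivAt.mul_const (Real.log (p i) ^ k)
  exact h.congr_deriv (by ring)

theorem powSum_zero_pos (hc : 2 ≤ c) (hp : ∀ i, 0 < p i) (q : ℝ) : 0 < powSum p 0 q := by
  have : Nonempty (Fin c) := ⟨⟨0, by lia⟩⟩
  exact Finset.sum_pos (fun i _ => by have := Real.rpow_pos_of_pos (hp i) q; simpa) Finset.univ_nonempty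

theorem theta_eq_powSum (p : Fin c → ℝ) : theta p = fun q => Real.logb c (powSum p 0 q) := by
  funext q
  simp [theta, powSum]

theorem hasDerivAt_theta (hc : 2 ≤ c) (hp : ∀ i, 0 < p i) (q : ℝ) :
    HasDerivAt (theta p) (powSum p 1 q / (powSum p 0 q * Real.log c)) q := by
  rw [theta_eq_powSum]
  have h := ((hasDerivAt_powSum hp 0 q).log (powSum_zero_pos hc hp q).ne').div_const (Real.log c)
  exact h.congr_deriv (by rw [div_div])

theorem continuous_theta (hc : 2 ≤ c) (hp : ∀ i, 0 < p i) : Continuous (theta p) :=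
  continuous_iff_continuousAt.2 fun q => (hasDerivAt_theta hc hp q).continuousAt

theorem analyticOnNhd_theta (hc : 2 ≤ c) (hp : ∀ i, 0 < p i) :
    AnalyticOnNhd ℝ (theta p) univ := fun q _ => by
  have h : AnalyticAt ℝ (fun q => ∑ i, Real.exp (Real.log (p i) * q)) q :=
    Finset.analyticAt_fun_sum _ fun i _ => (analyticAt_const.mul analyticAt_id).rexp
  have h2 : theta p = fun q => Real.log (∑ i, Real.exp (Real.log (p i) * q)) / Real.log c := by
    funext q
    simp only [theta, Real.logb, Real.rpow_def_of_pos (hp _)]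
  rw [h2]
  refine AnalyticAt.fun_div (h.log ?_) analyticAt_const
    (log_cast_pos hc).ne'
  have := powSum_zero_pos hc hp q
  simpa [powSum, Real.rpow_def_of_pos (hp _)] using this

theorem theta_zero (hc : 2 ≤ c) (p : Fin c → ℝ) : theta p 0 = 1 := by
  have : (1 : ℝ) < c := by exact_mod_cast hc
  simp only [theta, Real.rpow_zero, Finset.sum_const, Finset.card_univ, Fintype.card_fin,
    nsmul_eq_mul, mul_one]
  exact Real.logb_self_eq_one this

theorem theta_one (hp : IsProbVec p) : theta p 1 = 0 := by
  simp [theta, hp.2]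

end Theta

/-! ### Comparison of `theta` for a tangent pair -/

section Tangent

/-- If `f` vanishes to order exactly two at `x₀` and is positive before `x₀`, then it is positive
on any interval beginning at `x₀` on which it does not vanish. -/
theorem pos_of_double_zero {f f₁ : ℝ → ℝ} {m x₀ : ℝ} (hf : ∀ x, HasDerivAt f (f₁ x) x)
    (hf₁ : HasDerivAt f₁ m x₀) (h0 : f x₀ = 0) (h1 : f₁ x₀ = 0) (h2 : m ≠ 0)
    (hleft : ∀ᶠ x in 𝓝[<] x₀, 0 < f x) {s : Set ℝ} (hs : IsPreconnected s) (hsn : s ∈ 𝓝[>] x₀)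
    (hne : ∀ x ∈ s, f x ≠ 0) : ∀ x ∈ s, 0 < f x := by
  have hcont : Continuous f := continuous_iff_continuousAt.2 fun x => (hf x).continuousAt
  have hd : deriv f = f₁ := funext fun x => (hf x).deriv
  -- A negative second derivative would give a local maximum with value zero, against positivity on
  -- the left.
  have hm : 0 < m := by
    refine lt_of_le_of_ne (not_lt.1 fun hm => ?_) h2.symm
    have hmax : IsLocalMax f x₀ := isLocalMax_of_deriv_deriv_neg (by rwa [hd, hf₁.deriv])
      (by rw [hd, h1]) hcont.continuousAt
    obtain ⟨x, hx1, hx2⟩ := (hleft.and (hmax.filter_mono nhdsWithin_le_nhds)).exists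
    exact absurd (hx1.trans_le hx2) (by rw [h0]; exact lt_irrefl 0)
  have hmin : IsLocalMin f x₀ := isLocalMin_of_deriv_deriv_pos (by rwa [hd, hf₁.deriv])
      (by rw [hd, h1]) hcont.continuousAt
  obtain ⟨y, hy1, hy2⟩ := (Filter.Eventually.and hsn (hmin.filter_mono nhdsWithin_le_nhds)).exists
  rw [h0] at hy2
  have hy : 0 < f y := lt_of_le_of_ne hy2 (hne y hy1).symm
  intro x hx
  by_contra hx0
  obtain ⟨z, hz, hz0⟩ := hs.intermediate_value hx hy1 hcont.continuousOn ⟨not_lt.1 hx0, hy.le⟩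
  exact hne z hz hz0

variable {a b : Fin 4 → ℝ}

theorem IsTangentPair.symm (h : IsTangentPair a b) : IsTangentPair b a :=
  ⟨h.2.1, h.1, fun ⟨σ, hσ⟩ => h.2.2.1 ⟨σ.symm, by rw [← hσ]; funext i; simp⟩,
    h.2.2.2.1.symm, h.2.2.2.2.1.symm, h.2.2.2.2.2.1.symm, h.2.2.2.2.2.2.symm⟩

theorem IsTangentPair.pos_left (h : IsTangentPair a b) (i : Fin 4) : 0 < a i := (h.1.1 i).1

theorem IsTangentPair.pos_right (h : IsTangentPair a b) (i : Fin 4) : 0 < b i := (h.2.1.1 i).1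

theorem IsProbVec.powSum_zero_one {a : Fin 4 → ℝ} (h : IsProbVec a) : powSum a 0 1 = 1 := by
  simp [powSum, h.2]

theorem IsTangentPair.powSum_zero (h : IsTangentPair a b) {e : ℝ} (he : e = 0 ∨ e = 1) :
    powSum a 0 e = powSum b 0 e := by
  rcases he with rfl | rfl
  · simp [powSum]
  · rw [h.1.powSum_zero_one, h.2.1.powSum_zero_one]

theorem IsTangentPair.powSum_one (h : IsTangentPair a b) {e : ℝ} (he : e = 0 ∨ e = 1) :
    powSum a 1 e = powSum b 1 e := by
  have hd : deriv (theta a) e = deriv (theta b) e := by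
    rcases he with rfl | rfl
    · exact h.2.2.2.2.2.1
    · exact h.2.2.2.2.2.2
  rw [(hasDerivAt_theta (by norm_num) h.pos_left e).deriv,
    (hasDerivAt_theta (by norm_num) h.pos_right e).deriv, h.powSum_zero he] at hd
  have h1 := (powSum_zero_pos (by norm_num) h.pos_right e).ne'
  have h2 : Real.log (4 : ℕ) ≠ 0 := (log_cast_pos (by norm_num)).ne'
  exact (div_left_inj' (mul_ne_zero h1 h2)).1 hd

/-- The logarithms of the entries of a vector in increasing order. -/
noncomputable def sortedLog (a : Fin 4 → ℝ) : Fin 4 → ℝ :=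
  (fun i => Real.log (a i)) ∘ Tuple.sort fun i => Real.log (a i)

theorem monotone_sortedLog (a : Fin 4 → ℝ) : Monotone (sortedLog a) := Tuple.monotone_sort _

theorem sum_sortedLog (a : Fin 4 → ℝ) (F : ℝ → ℝ) :
    ∑ i, F (sortedLog a i) = ∑ i, F (Real.log (a i)) :=
  Equiv.sum_comp (Tuple.sort fun i => Real.log (a i)) fun i => F (Real.log (a i))

theorem exp_sortedLog_zero (ha : ∀ i, 0 < a i) : Real.exp (sortedLog a 0) = ⨅ i, a i := by
  set σ := Tuple.sort fun i => Real.log (a i) with hσ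
  have h0 : Real.exp (sortedLog a 0) = a (σ 0) := Real.exp_log (ha _)
  rw [h0]
  refine le_antisymm (le_ciInf fun i => ?_) (ciInf_le (Set.finite_range _).bddBelow _)
  have h := monotone_sortedLog a (Fin.zero_le (σ.symm i))
  simp only [sortedLog, Function.comp, ← hσ, Equiv.apply_symm_apply] at h
  exact (Real.log_le_log_iff (ha _) (ha _)).1 h

/-- The derivative at `0` gives the sum of logarithms, the value at `1` the total mass, the
derivative at `1` the entropy. The value at `0` carries no information. -/
theorem IsTangentPair.equalMoments (h : IsTangentPair a b) :
    EqualMoments (sortedLog a) (sortedLog b) := by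
  have h1 := h.powSum_one (Or.inl rfl)
  have h2 := h.powSum_zero (Or.inr rfl)
  have h3 := h.powSum_one (Or.inr rfl)
  simp only [powSum, Real.rpow_zero, pow_one, one_mul, Real.rpow_one, pow_zero, mul_one] at h1 h2 h3
  refine ⟨?_, ?_, ?_⟩
  · exact (sum_sortedLog a fun x => x).trans (h1.trans (sum_sortedLog b fun x => x).symm)
  · rw [sum_sortedLog a Real.exp, sum_sortedLog b Real.exp]
    simpa only [Real.exp_log (h.pos_left _), Real.exp_log (h.pos_right _)] using h2
  · rw [sum_sortedLog a fun x => x * Real.exp x, sum_sortedLog b fun x => x * Real.exp x]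
    simpa only [Real.exp_log (h.pos_left _), Real.exp_log (h.pos_right _), mul_comm] using h3

theorem IsTangentPair.interlaced (h : IsTangentPair a b) :
    Interlaced (sortedLog a) (sortedLog b) ∨ Interlaced (sortedLog b) (sortedLog a) := by
  refine h.equalMoments.interlaced (monotone_sortedLog a) (monotone_sortedLog b) fun hab => ?_
  set σ := Tuple.sort fun i => Real.log (a i) with hσ
  set τ := Tuple.sort fun i => Real.log (b i) with hτ
  refine h.2.2.1 ⟨τ.symm.trans σ, funext fun i => ?_⟩
  have h1 := congrFun hab (τ.symm i)
  simp only [sortedLog, Function.comp, ← hσ, ← hτ, Equiv.apply_symm_apply] at h1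
  exact Real.log_injOn_pos (h.pos_left _) (h.pos_right _) h1

theorem IsTangentPair.iInf_ne (h : IsTangentPair a b) : ⨅ i, a i ≠ ⨅ i, b i := by
  rw [← exp_sortedLog_zero h.pos_left, ← exp_sortedLog_zero h.pos_right, Ne, Real.exp_eq_exp]
  rcases h.interlaced with h | h
  exacts [h.1.ne, h.1.ne']

theorem IsTangentPair.sum_ne (h : IsTangentPair a b) {Γ ψ ψ₁ ψ₂ : ℝ → ℝ}
    (hΓ : ∀ x, HasDerivAt Γ (Real.exp x * ψ x) x) (hψ : ∀ x, HasDerivAt ψ (ψ₁ x) x)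
    (hψ₁ : ∀ x, HasDerivAt ψ₁ (ψ₂ x) x) (hinj : Function.Injective fun x => Real.exp x * ψ₂ x) :
    ∑ i, Γ (Real.log (a i)) ≠ ∑ i, Γ (Real.log (b i)) := by
  rw [← sum_sortedLog a Γ, ← sum_sortedLog b Γ]
  rcases h.interlaced with hi | hi
  · exact hi.sum_ne (monotone_sortedLog a) (monotone_sortedLog b) h.equalMoments hΓ hψ hψ₁ hinj
  · exact (hi.sum_ne (monotone_sortedLog b) (monotone_sortedLog a) h.symm.equalMoments
      hΓ hψ hψ₁ hinj).symm

/-- For `Γ = exp (q x)`, `exp x * ψ₂ x = q * (q - 1) ^ 2 * exp (q x)`, which is injective exactly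
when `q ≠ 0, 1`. -/
theorem IsTangentPair.powSum_ne (h : IsTangentPair a b) {q : ℝ} (h0 : q ≠ 0) (h1 : q ≠ 1) :
    powSum a 0 q ≠ powSum b 0 q := by
  have hexp : ∀ r x : ℝ, HasDerivAt (fun x => Real.exp (r * x)) (Real.exp (r * x) * r) x :=
    fun r x => by simpa using ((hasDerivAt_id x).const_mul r).exp
  have hmul : ∀ x : ℝ, Real.exp x * Real.exp ((q - 1) * x) = Real.exp (q * x) := fun x => by
    rw [← Real.exp_add]; congr 1; ring
  have key := h.sum_ne (Γ := fun x => Real.exp (q * x)) (ψ := fun x => q * Real.exp ((q - 1) * x))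
    (ψ₁ := fun x => q * (q - 1) * Real.exp ((q - 1) * x))
    (ψ₂ := fun x => q * (q - 1) ^ 2 * Real.exp ((q - 1) * x))
    (fun x => (hexp q x).congr_deriv (by rw [← hmul]; ring))
    (fun x => ((hexp (q - 1) x).const_mul q).congr_deriv (by ring))
    (fun x => ((hexp (q - 1) x).const_mul (q * (q - 1))).congr_deriv (by ring)) (fun x y hxy => by
      have hxy' : q * (q - 1) ^ 2 * Real.exp (q * x) = q * (q - 1) ^ 2 * Real.exp (q * y) := by
        rw [← hmul, ← hmul]
        simp only at hxy
        linear_combination hxy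
      have h3 := mul_left_cancel₀ (mul_ne_zero h0 (pow_ne_zero 2 (sub_ne_zero.2 h1))) hxy'
      exact mul_left_cancel₀ h0 (Real.exp_injective h3))
  simp only [powSum, pow_zero, mul_one, Real.rpow_def_of_pos (h.pos_left _),
    Real.rpow_def_of_pos (h.pos_right _)]
  simpa only [mul_comm] using key

/-- The test functions are `x ^ 2` at `0` and `exp x * x ^ 2` at `1`; the functions required to be
injective are `2 * (x - 2)` and `2 * exp x`. -/
theorem IsTangentPair.powSum_two_ne (h : IsTangentPair a b) {e : ℝ} (he : e = 0 ∨ e = 1) :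
    powSum a 2 e ≠ powSum b 2 e := by
  have hsq : ∀ x : ℝ, HasDerivAt (fun x => x ^ 2) (2 * x) x := fun x => by
    simpa using hasDerivAt_pow 2 x
  rcases he with rfl | rfl
  · have hexp : ∀ x : ℝ, HasDerivAt (fun x => Real.exp (-x)) (-Real.exp (-x)) x := fun x => by
      simpa using (hasDerivAt_neg x).exp
    have hmul : ∀ x : ℝ, Real.exp x * Real.exp (-x) = 1 := fun x => by
      rw [← Real.exp_add]; simp
    have key := h.sum_ne (Γ := fun x => x ^ 2) (ψ := fun x => 2 * x * Real.exp (-x))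
      (ψ₁ := fun x => 2 * (1 - x) * Real.exp (-x)) (ψ₂ := fun x => 2 * (x - 2) * Real.exp (-x))
      (fun x => (hsq x).congr_deriv (by linear_combination (-2 * x) * hmul x))
      (fun x => ((((hasDerivAt_id x).const_mul 2).mul (hexp x))).congr_deriv (by
        simp only [id]; ring))
      (fun x => (((((hasDerivAt_id x).const_sub 1).const_mul 2).mul (hexp x))).congr_deriv (by
        simp only [id]; ring))
      (fun x y hxy => by
        simp only at hxy
        have h1 := hmul x
        have h2 := hmul y
        have : 2 * (x - 2) = 2 * (y - 2) := by
          linear_combination hxy - 2 * (x - 2) * h1 + 2 * (y - 2) * h2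
        linarith)
    simpa [powSum] using key
  · have key := h.sum_ne (Γ := fun x => Real.exp x * x ^ 2) (ψ := fun x => x ^ 2 + 2 * x)
      (ψ₁ := fun x => 2 * x + 2) (ψ₂ := fun _ => 2)
      (fun x => ((Real.hasDerivAt_exp x).mul (hsq x)).congr_deriv (by ring))
      (fun x => ((hsq x).add ((hasDerivAt_id x).const_mul 2)).congr_deriv (by ring))
      (fun x => (((hasDerivAt_id x).const_mul 2).add_const 2).congr_deriv (by ring))
      (fun x y hxy => Real.exp_injective (mul_right_cancel₀ two_ne_zero hxy))
    simpa [powSum, Real.exp_log (h.pos_left _), Real.exp_log (h.pos_right _)] using key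

theorem isIntersectionOfOrder_theta (h : IsTangentPair a b) {e : ℝ} (he : e = 0 ∨ e = 1) :
    IsIntersectionOfOrder (theta a) (theta b) 2 e (1 - e) := by
  have hval : theta a e = 1 - e ∧ theta b e = 1 - e := by
    rcases he with rfl | rfl
    · rw [theta_zero (by norm_num), theta_zero (by norm_num)]; norm_num
    · rw [theta_one h.1, theta_one h.2.1]; norm_num
  have hd : ∀ {p : Fin 4 → ℝ}, (∀ i, 0 < p i) → deriv (theta p) =
      fun q => powSum p 1 q / (powSum p 0 q * Real.log (4 : ℕ)) := fun hp =>
    funext fun q => (hasDerivAt_theta (by norm_num) hp q).deriv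
  have hL : Real.log (4 : ℕ) ≠ 0 := (log_cast_pos (by norm_num)).ne'
  have hd2 : ∀ {p : Fin 4 → ℝ}, (∀ i, 0 < p i) → HasDerivAt (deriv (theta p))
      ((powSum p 2 e * powSum p 0 e - powSum p 1 e ^ 2) / (powSum p 0 e ^ 2 * Real.log (4 : ℕ))) e :=
    fun {p} hp => by
      have h0 := (powSum_zero_pos (by norm_num) hp e).ne'
      rw [hd hp]
      refine ((hasDerivAt_powSum hp 1 e).div ((hasDerivAt_powSum hp 0 e).mul_const _)
        (mul_ne_zero h0 hL)).congr_deriv ?_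
      field_simp
  have hsub : deriv (theta a - theta b) = deriv (theta a) - deriv (theta b) := funext fun q =>
    ((hasDerivAt_theta (by norm_num) h.pos_left q).differentiableAt.hasDerivAt.sub
      (hasDerivAt_theta (by norm_num) h.pos_right q).differentiableAt.hasDerivAt).deriv
  refine ⟨hval.1, fun i hi => ?_, ?_⟩
  · interval_cases i
    · simp [hval]
    · rw [iteratedDeriv_one, hsub, hd h.pos_left, hd h.pos_right]
      simp [h.powSum_zero he, h.powSum_one he]
  · rw [iteratedDeriv_succ, iteratedDeriv_one, hsub, ((hd2 h.pos_left).sub (hd2 h.pos_right)).deriv,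
      h.powSum_zero he, h.powSum_one he, ← sub_div, div_ne_zero_iff]
    have h0 := (powSum_zero_pos (by norm_num) h.pos_right e).ne'
    refine ⟨?_, by positivity⟩
    rw [sub_sub_sub_cancel_right, ← sub_mul]
    exact mul_ne_zero (sub_ne_zero.2 (h.powSum_two_ne he)) h0

/-- For very negative exponents the least entry dominates: the ratio of the minima to the power `n`
exceeds the number `4` of entries. -/
theorem exists_powSum_lt (hb : ∀ i, 0 < b i) (hlt : ⨅ i, b i < ⨅ i, a i) :
    ∃ q < 0, powSum a 0 q < powSum b 0 q := by
  obtain ⟨j, hj⟩ := exists_eq_ciInf_of_finite (f := b)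
  rw [← hj] at hlt
  have ha' : 0 < ⨅ i, a i := (hb j).trans hlt
  obtain ⟨n, hn⟩ := pow_unbounded_of_one_lt 4 ((one_lt_div (hb j)).2 hlt)
  have hn0 : n ≠ 0 := by rintro rfl; norm_num at hn
  refine ⟨-n, by simpa using Nat.pos_of_ne_zero hn0, ?_⟩
  simp only [powSum, pow_zero, mul_one]
  calc ∑ i, a i ^ (-(n : ℝ)) ≤ ∑ _i : Fin 4, (⨅ i, a i) ^ (-(n : ℝ)) :=
        Finset.sum_le_sum fun i _ => Real.rpow_le_rpow_of_nonpos ha'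
          (ciInf_le (Set.finite_range _).bddBelow i) (by simp)
    _ = 4 * (⨅ i, a i) ^ (-(n : ℝ)) := by simp
    _ < b j ^ (-(n : ℝ)) := by
        rw [Real.rpow_neg ha'.le, Real.rpow_neg (hb j).le, Real.rpow_natCast, Real.rpow_natCast,
          ← div_eq_mul_inv, div_lt_iff₀ (pow_pos ha' n), inv_mul_eq_div, ← div_pow]
        exact hn
    _ ≤ ∑ i, b i ^ (-(n : ℝ)) :=
        Finset.single_le_sum (f := fun i => b i ^ (-(n : ℝ)))
          (fun i _ => (Real.rpow_pos_of_pos (hb i) _).le) (Finset.mem_univ j)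

/-- The difference vanishes only at `0` and `1`. It is positive somewhere on the negative axis,
hence on all of it, and the exact double zeros carry the sign to `(0, 1)` and on to `(1, ∞)`. -/
theorem IsTangentPair.powSum_lt (h : IsTangentPair a b) (hlt : ⨅ i, b i < ⨅ i, a i) {q : ℝ}
    (h0 : q ≠ 0) (h1 : q ≠ 1) : powSum a 0 q < powSum b 0 q := by
  set f : ℕ → ℝ → ℝ := fun k q => powSum b k q - powSum a k q with hf
  have hd : ∀ k q, HasDerivAt (f k) (f (k + 1) q) q := fun k q =>
    (hasDerivAt_powSum h.pos_right k q).sub (hasDerivAt_powSum h.pos_left k q)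
  have hcont : Continuous (f 0) := continuous_iff_continuousAt.2 fun x => (hd 0 x).continuousAt
  have hne : ∀ q, q ≠ 0 → q ≠ 1 → f 0 q ≠ 0 := fun q h0 h1 =>
    sub_ne_zero.2 (h.powSum_ne h0 h1).symm
  have hneg : ∀ x ∈ Iio (0 : ℝ), 0 < f 0 x := fun x hx => by
    obtain ⟨y, hy, hy0⟩ := exists_powSum_lt h.pos_right hlt
    by_contra hx0
    obtain ⟨z, hz, hz0⟩ := isPreconnected_Iio.intermediate_value hx hy hcont.continuousOn
      ⟨not_lt.1 hx0, (sub_pos.2 hy0).le⟩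
    exact hne z (ne_of_lt hz) (ne_of_lt (lt_trans hz one_pos)) hz0
  have hmid := pos_of_double_zero (x₀ := 0) (hd 0) (hd 1 0) (sub_eq_zero.2 (h.powSum_zero (Or.inl rfl)).symm)
    (sub_eq_zero.2 (h.powSum_one (Or.inl rfl)).symm)
    (sub_ne_zero.2 (h.powSum_two_ne (Or.inl rfl)).symm)
    (eventually_mem_nhdsWithin.mono hneg) isPreconnected_Ioo (Ioo_mem_nhdsGT one_pos)
    fun x hx => hne x hx.1.ne' hx.2.ne
  have hpos := pos_of_double_zero (x₀ := 1) (hd 0) (hd 1 1) (sub_eq_zero.2 (h.powSum_zero (Or.inr rfl)).symm)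
    (sub_eq_zero.2 (h.powSum_one (Or.inr rfl)).symm)
    (sub_ne_zero.2 (h.powSum_two_ne (Or.inr rfl)).symm)
    (Filter.Eventually.mono (Ioo_mem_nhdsLT one_pos) hmid) isPreconnected_Ioi self_mem_nhdsWithin
    fun x (hx : 1 < x) => hne x (one_pos.trans hx).ne' hx.ne'
  refine sub_pos.1 ?_
  rcases h0.lt_or_gt with hq | hq
  · exact hneg q hq
  rcases h1.lt_or_gt with hq1 | hq1
  · exact hmid q ⟨hq, hq1⟩
  · exact hpos q hq1

theorem IsTangentPair.theta_lt (h : IsTangentPair a b) (hlt : ⨅ i, b i < ⨅ i, a i) {q : ℝ}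
    (h0 : q ≠ 0) (h1 : q ≠ 1) : theta a q < theta b q := by
  rw [theta_eq_powSum, theta_eq_powSum]
  exact Real.logb_lt_logb (by norm_num) (powSum_zero_pos (by norm_num) h.pos_left q)
    (h.powSum_lt hlt h0 h1)

theorem IsTangentPair.theta_le (h : IsTangentPair a b) (hlt : ⨅ i, b i < ⨅ i, a i) (q : ℝ) :
    theta a q ≤ theta b q := by
  by_cases h0 : q = 0
  · rw [h0]; exact h.2.2.2.1.le
  by_cases h1 : q = 1
  · rw [h1]; exact h.2.2.2.2.1.le
  exact (h.theta_lt hlt h0 h1).le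

end Tangent

end OlsenGray

namespace OlsenGray

/-! ### Legendre transforms and the dimensions of the level sets -/

section Legendre

variable {c : ℕ} {p l h : Fin c → ℝ} {P : ℕ → Prop} {α κ : ℝ}

theorem mul_logb_le_theta (hc : 2 ≤ c) (hp : ∀ i, 0 < p i) (q : ℝ) (i : Fin c) :
    q * Real.logb c (p i) ≤ theta p q := by
  rw [← Real.logb_rpow_eq_mul_logb_of_pos (hp i)]
  exact Real.logb_le_logb_of_le (by exact_mod_cast hc) (Real.rpow_pos_of_pos (hp i) q)
    (Finset.single_le_sum (f := fun i => p i ^ q)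
      (fun i _ => (Real.rpow_pos_of_pos (hp i) q).le) (Finset.mem_univ i))

/-- One term of the sum bounds `theta p q` below: the largest entry for `q ≥ 0`, the smallest for `q
≤ 0`. For `α` strictly inside the interval both resulting slopes are strict, so a minimizer will
exist. -/
theorem exists_mul_abs_le (hc : 2 ≤ c) (hp : ∀ i, 0 < p i)
    (hα : α ∈ Ioo (-Real.logb c (⨆ i, p i)) (-Real.logb c (⨅ i, p i))) :
    ∃ κ > 0, ∀ q : ℝ, κ * |q| ≤ α * q + theta p q := by
  have : Nonempty (Fin c) := ⟨⟨0, by lia⟩⟩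
  obtain ⟨i, hi⟩ := exists_eq_ciSup_of_finite (f := p)
  obtain ⟨j, hj⟩ := exists_eq_ciInf_of_finite (f := p)
  rw [← hi, ← hj] at hα
  obtain ⟨h1, h2⟩ := hα
  refine ⟨min (α + Real.logb c (p i)) (-(α + Real.logb c (p j))),
    lt_min (by linarith) (by linarith), fun q => ?_⟩
  rcases le_total 0 q with hq | hq
  · rw [abs_of_nonneg hq]
    have h3 := mul_logb_le_theta hc hp q i
    have h4 := mul_le_mul_of_nonneg_right
      (min_le_left (α + Real.logb c (p i)) (-(α + Real.logb c (p j)))) hq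
    linarith
  · rw [abs_of_nonpos hq]
    have h3 := mul_logb_le_theta hc hp q j
    have h4 := mul_le_mul_of_nonneg_right
      (min_le_right (α + Real.logb c (p i)) (-(α + Real.logb c (p j)))) (neg_nonneg.2 hq)
    linarith

/-- At a point `q` where `α * q + theta p q` is minimal, the local dimension of `p` under the law
`tilt p q` is `α` and the entropy of `tilt p q` is the minimal value. -/
theorem exists_minimizer (hc : 2 ≤ c) (hp : IsProbVec p) (hκ : 0 < κ)
    (hle : ∀ q : ℝ, κ * |q| ≤ α * q + theta p q) :
    ∃ q : ℝ, (∀ y, α * q + theta p q ≤ α * y + theta p y) ∧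
      ∑ i, tilt p q i * Real.log (p i) = -(α * Real.log c) ∧
      ∑ i, tilt p q i * Real.log (tilt p q i) = -((α * q + theta p q) * Real.log c) := by
  have hpos : ∀ i, 0 < p i := fun i => (hp.1 i).1
  have hcont : Continuous fun q => α * q + theta p q :=
    (continuous_const.mul continuous_id).add (continuous_theta hc hpos)
  obtain ⟨q, hq⟩ := hcont.exists_forall_le
    (tendsto_atTop_mono hle (tendsto_norm_cocompact_atTop.const_mul_atTop hκ))
  have hd := ((hasDerivAt_id q).const_mul α).add (hasDerivAt_theta hc hpos q)
  have h0 : α * 1 + powSum p 1 q / (powSum p 0 q * Real.log c) = 0 :=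
    IsLocalMin.hasDerivAt_eq_zero (f := fun q => α * q + theta p q) (Eventually.of_forall hq) hd
  have hL := (log_cast_pos hc).ne'
  have h1 : ∑ i, tilt p q i * Real.log (p i) = -(α * Real.log c) := by
    have hS := (powSum_zero_pos hc hpos q).ne'
    have : ∑ i, tilt p q i * Real.log (p i) = powSum p 1 q / powSum p 0 q := by
      simp only [tilt, powSum, pow_zero, mul_one, pow_one, Finset.sum_div, div_mul_eq_mul_div]
    rw [this]
    field_simp at h0 ⊢
    linarith
  refine ⟨q, hq, h1, ?_⟩
  have h2 : ∀ i, tilt p q i * Real.log (tilt p q i) =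
      q * (tilt p q i * Real.log (p i)) - theta p q * Real.log c * tilt p q i := fun i => by
    rw [log_tilt hc hp]; ring
  rw [Finset.sum_congr rfl fun i _ => h2 i, Finset.sum_sub_distrib, ← Finset.mul_sum,
    ← Finset.mul_sum, h1, (isProbVec_tilt hc hp q).2]
  ring

theorem legendre_coe_eq {f : ℝ → ℝ} {q : ℝ} (hq : ∀ y, α * q + f q ≤ α * y + f y) :
    legendre (fun q => (f q : EReal)) α = ((α * q + f q : ℝ) : EReal) := by
  refine le_antisymm (iInf_le_of_le q (by rw [EReal.coe_add])) (le_iInf fun y => ?_)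
  rw [← EReal.coe_add]
  exact EReal.coe_le_coe_iff.2 (hq y)

theorem dimH_packingDim_levelSet_mix (hc : 2 ≤ c) (hl : IsProbVec l) (hh : IsProbVec h)
    (hP : DominatesOften P) (hP' : DominatesOften fun n => ¬ P n)
    (hle : ∀ q, theta l q ≤ theta h q)
    (hα : α ∈ Ioo (-Real.logb c (⨆ i, l i)) (-Real.logb c (⨅ i, l i))) :
    (dimH (levelSet (wordMeasure (mix P l h)) α) : EReal) =
        legendre (fun q => (theta l q : EReal)) α ∧
      (packingDim (levelSet (wordMeasure (mix P l h)) α) : EReal) =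
        legendre (fun q => (theta h q : EReal)) α := by
  obtain ⟨κ, hκ, hκl⟩ := exists_mul_abs_le hc (fun i => (hl.1 i).1) hα
  -- Growth for `h` is inherited from `theta l ≤ theta h`, so the range of `α` is dictated by `l`
  -- alone.
  have hκh : ∀ q : ℝ, κ * |q| ≤ α * q + theta h q := fun q =>
    (hκl q).trans (by linarith [hle q])
  obtain ⟨s, hs, hs1, hs2⟩ := exists_minimizer hc hl hκ hκl
  obtain ⟨t, ht, ht1, ht2⟩ := exists_minimizer hc hh hκ hκh
  have hs0 : 0 ≤ α * s + theta l s := (by positivity : 0 ≤ κ * |s|).trans (hκl s)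
  have ht0 : 0 ≤ α * t + theta h t := (by positivity : 0 ≤ κ * |t|).trans (hκh t)
  have hst : α * s + theta l s ≤ α * t + theta h t := (hs t).trans (by linarith [hle t])
  have hl' := isProbVec_tilt hc hl s
  have hh' := isProbVec_tilt hc hh t
  rw [legendre_coe_eq hs, legendre_coe_eq ht,
    le_antisymm (dimH_levelSet_mix_le hc hl hh hP α s)
      (le_dimH_levelSet_mix hc hl hh hl' hh' hs1 ht1 hs2 ht2 hst),
    le_antisymm (packingDim_levelSet_mix_le hc hl hh (hle t) α)
      (le_packingDim_levelSet_mix hc hl hh hl' hh' hP' hs1 ht1 hs2 ht2),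
    EReal.coe_ennreal_ofReal, EReal.coe_ennreal_ofReal, max_eq_left hs0, max_eq_left ht0]
  exact ⟨rfl, rfl⟩

end Legendre

/-! ### Existence of tangent pairs and block sequences -/

section Existence

theorem exists_isBlockSeq : ∃ T : ℕ → ℕ, IsBlockSeq T := by
  refine ⟨Nat.factorial, rfl, fun k hk => (Nat.factorial_lt hk).2 (Nat.lt_succ_self k), ?_⟩
  have : (fun k : ℕ => (((k + 1).factorial : ℕ) : ℝ) / (k.factorial : ℝ)) = fun k : ℕ => (k : ℝ) + 1 := by
    funext k
    rw [Nat.factorial_succ]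
    push_cast
    exact mul_div_cancel_right₀ _ (by positivity)
  rw [this]
  exact tendsto_atTop_add_const_right _ _ tendsto_natCast_atTop_atTop

/-- Dividing by the common sum `S` shifts both sums of logarithms by the same amount and acts alike
on both entropy sums, so positive vectors can be used before normalization. -/
theorem isTangentPair_of_sums {x y : Fin 4 → ℝ} (hx : ∀ i, 0 < x i) (hy : ∀ i, 0 < y i)
    (hsum : ∑ i, x i = ∑ i, y i) (hlog : ∑ i, Real.log (x i) = ∑ i, Real.log (y i))
    (hent : ∑ i, x i * Real.log (x i) = ∑ i, y i * Real.log (y i))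
    (hne : ∃ i, ∀ j, x j ≠ y i) :
    IsTangentPair (fun i => x i / ∑ j, x j) fun i => y i / ∑ j, x j := by
  set S := ∑ j, x j with hS
  have hS0 : 0 < S := Finset.sum_pos (fun i _ => hx i) Finset.univ_nonempty
  have ha : IsProbVec fun i => x i / S := isProbVec_of_pos (by norm_num)
    (fun i => div_pos (hx i) hS0) (by rw [← Finset.sum_div, div_self hS0.ne'])
  have hb : IsProbVec fun i => y i / S := isProbVec_of_pos (by norm_num)
    (fun i => div_pos (hy i) hS0) (by rw [← Finset.sum_div, ← hsum, div_self hS0.ne'])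
  have hzero : ∀ p : Fin 4 → ℝ, powSum p 0 0 = 4 := fun p => by simp [powSum]
  have hpow0 : ∀ z : Fin 4 → ℝ, (∀ i, 0 < z i) →
      powSum (fun i => z i / S) 1 0 = ∑ i, Real.log (z i) - 4 * Real.log S := fun z hz => by
    simp [powSum, Real.log_div (hz _).ne' hS0.ne']
  have hpow1 : ∀ z : Fin 4 → ℝ, (∀ i, 0 < z i) → powSum (fun i => z i / S) 1 1 =
      (∑ i, z i * Real.log (z i) - (∑ i, z i) * Real.log S) / S := fun z hz => by
    simp only [powSum, Real.rpow_one, pow_one, Real.log_div (hz _).ne' hS0.ne', Finset.sum_mul,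
      ← Finset.sum_sub_distrib, Finset.sum_div]
    exact Finset.sum_congr rfl fun i _ => by ring
  refine ⟨ha, hb, fun ⟨σ, hσ⟩ => ?_, ?_, ?_, ?_, ?_⟩
  · obtain ⟨i, hi⟩ := hne
    exact hi (σ i) ((div_left_inj' hS0.ne').1 (congrFun hσ i))
  · rw [theta_zero (by norm_num), theta_zero (by norm_num)]
  · rw [theta_one ha, theta_one hb]
  · rw [(hasDerivAt_theta (by norm_num) (fun i => (ha.1 i).1) 0).deriv,
      (hasDerivAt_theta (by norm_num) (fun i => (hb.1 i).1) 0).deriv, hzero, hzero,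
      hpow0 x hx, hpow0 y hy, hlog]
  · rw [(hasDerivAt_theta (by norm_num) (fun i => (ha.1 i).1) 1).deriv,
      (hasDerivAt_theta (by norm_num) (fun i => (hb.1 i).1) 1).deriv, ha.powSum_zero_one,
      hb.powSum_zero_one, hpow1 x hx, hpow1 y hy, hent, ← hsum]

/-- The vectors `(1, 1, y, y)` and `(y / (2k), 2, 2, y k / 2)` have the same product `y ^ 2`, and `y
= 4 / (4 - (k + 1 / k))` makes their sums equal. The remaining entropy equation in `k` is solved by
the intermediate value theorem on `[2, 3]`. As `y > 2`, the entry `2` does not occur in the first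
vector. -/
theorem exists_isTangentPair : ∃ a b : Fin 4 → ℝ, IsTangentPair a b := by
  set Y : ℝ → ℝ := fun k => 4 / (4 - (k + k⁻¹)) with hY
  have hden : ∀ k ∈ Icc (2 : ℝ) 3, 0 < 4 - (k + k⁻¹) := fun k hk => by
    have : k⁻¹ ≤ 2⁻¹ := inv_anti₀ two_pos hk.1
    have := hk.2
    linarith
  have hYpos : ∀ k ∈ Icc (2 : ℝ) 3, 2 < Y k := fun k hk => by
    rw [hY, lt_div_iff₀ (hden k hk)]
    have : 0 < k⁻¹ := by have := hk.1; positivity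
    linarith [hk.1]
  have hcont : ContinuousOn (fun k : ℝ => -2 * Real.log (Y k) + (6 - 2 * Y k) * Real.log 2 +
      (Y k * k / 2 - Y k / (2 * k)) * Real.log k) (Icc 2 3) := by
    have h1 : ContinuousOn Y (Icc 2 3) := continuousOn_const.div (continuousOn_const.sub
      (continuousOn_id.add (continuousOn_id.inv₀ fun k hk =>
        (show (0 : ℝ) < k by linarith [hk.1]).ne')))
      fun k hk => (hden k hk).ne'
    have h2 : ContinuousOn (fun k => Real.log (Y k)) (Icc 2 3) := h1.log fun k hk =>
      (two_pos.trans (hYpos k hk)).ne'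
    have h3 : ContinuousOn Real.log (Icc (2 : ℝ) 3) := continuousOn_id.log fun k hk =>
      (show (0 : ℝ) < k by linarith [hk.1]).ne'
    have h4 : ContinuousOn (fun k => Y k / (2 * k)) (Icc 2 3) :=
      h1.div (continuousOn_const.mul continuousOn_id) fun k hk =>
        (show (0 : ℝ) < 2 * k by linarith [hk.1]).ne'
    fun_prop
  -- The signs at the ends `k = 2` and `k = 3` amount to `3 ^ 6 < 2 ^ 10` and `2 ^ 8 < 3 ^ 6`.
  have hlog6 : 6 * Real.log 3 < 10 * Real.log 2 := by
    have := Real.log_lt_log (by norm_num) (by norm_num : (3 : ℝ) ^ 6 < 2 ^ 10)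
    rwa [Real.log_pow, Real.log_pow] at this
  have hlog8 : 8 * Real.log 2 < 6 * Real.log 3 := by
    have := Real.log_lt_log (by norm_num) (by norm_num : (2 : ℝ) ^ 8 < 3 ^ 6)
    rwa [Real.log_pow, Real.log_pow] at this
  obtain ⟨k, hk, hk0⟩ := intermediate_value_Icc (by norm_num : (2 : ℝ) ≤ 3) hcont
    (show (0 : ℝ) ∈ Icc _ _ by
      constructor
      · have h1 : Y 2 = 8 / 3 := by norm_num [hY]
        have h2 : Real.log (8 / 3) = 3 * Real.log 2 - Real.log 3 := by
          rw [Real.log_div (by norm_num) (by norm_num), show (8 : ℝ) = 2 ^ 3 by norm_num,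
            Real.log_pow]
          norm_num
        simp only [h1, h2]
        linarith
      · have h1 : Y 3 = 6 := by norm_num [hY]
        have h2 : Real.log 6 = Real.log 2 + Real.log 3 := by
          rw [← Real.log_mul (by norm_num) (by norm_num)]; norm_num
        simp only [h1, h2]
        linarith)
  have hkpos : 0 < k := by linarith [hk.1]
  have hy2 := hYpos k hk
  have hyk : Y k * (4 - (k + k⁻¹)) = 4 := div_mul_cancel₀ _ (hden k hk).ne'
  set y := Y k with hy
  simp only at hk0
  have hy0 : 0 < y := by linarith
  have hu : Real.log (y / (2 * k)) = Real.log y - Real.log 2 - Real.log k := by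
    rw [Real.log_div hy0.ne' (by positivity), Real.log_mul two_ne_zero hkpos.ne']; ring
  have hw : Real.log (y * k / 2) = Real.log y + Real.log k - Real.log 2 := by
    rw [Real.log_div (by positivity) two_ne_zero, Real.log_mul hy0.ne' hkpos.ne']
  have huw : y / (2 * k) + y * k / 2 = 2 * y - 2 := by
    have : y / (2 * k) = y * k⁻¹ / 2 := by field_simp
    rw [this]
    linarith
  refine ⟨_, _, isTangentPair_of_sums (x := ![1, 1, y, y]) (y := ![y / (2 * k), 2, 2, y * k / 2])
    (fun i => ?_) (fun i => ?_) ?_ ?_ ?_ ⟨1, fun j => ?_⟩⟩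
  · fin_cases i <;> simp [hy0]
  · fin_cases i <;> simp <;> positivity
  · simp [Fin.sum_univ_four]
    linarith
  · simp [Fin.sum_univ_four, hu, hw]
    ring
  · simp only [Fin.sum_univ_four, Matrix.cons_val, hu, hw, Real.log_one]
    linear_combination -hk0 - (Real.log y - Real.log 2) * huw
  · fin_cases j <;> simp
    exacts [hy2.ne', hy2.ne']

end Existence

end OlsenGray

/-! ### Choice of the lower and the upper vector, and conclusion -/

namespace OlsenGray

/-- The minimal entries decide which vector is `lo`. Both kinds of blocks have upper density one, so
the roles of `a` and `b` can be exchanged by passing to the complementary places. -/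
theorem IsTangentPair.exists_mix {a b : Fin 4 → ℝ} (h : IsTangentPair a b) {T : ℕ → ℕ}
    (hT : IsBlockSeq T) : ∃ lo hi : Fin 4 → ℝ, ((lo = a ∧ hi = b) ∨ (lo = b ∧ hi = a)) ∧
      IsTangentPair lo hi ∧ (⨅ i, hi i) < (⨅ i, lo i) ∧ ∃ P : ℕ → Prop,
        DominatesOften P ∧ (DominatesOften fun n => ¬ P n) ∧
          multinomial a b T = wordMeasure (mix P lo hi) := by
  rcases h.iInf_ne.lt_or_gt with hlt | hlt
  · refine ⟨b, a, Or.inr ⟨rfl, rfl⟩, h.symm, hlt, fun n => ¬ firstBlocks T n,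
      hT.dominatesOften_not_firstBlocks, ?_, ?_⟩
    · simpa only [not_not] using hT.dominatesOften_firstBlocks
    · rw [mix_swap, multinomial_eq_wordMeasure]
  · exact ⟨a, b, Or.inl ⟨rfl, rfl⟩, h, hlt, firstBlocks T, hT.dominatesOften_firstBlocks,
      hT.dominatesOften_not_firstBlocks, multinomial_eq_wordMeasure a b T⟩

end OlsenGray

theorem mainTheorem6 :
    (∀ c : ℕ, 2 ≤ c → ∀ a b : Fin c → ℝ, OlsenGray.IsProbVec a → OlsenGray.IsProbVec b →
      ∀ T : ℕ → ℕ, OlsenGray.IsBlockSeq T → ∀ g ∈ OlsenGray.grayCodes c,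
        ∀ μ : Measure (OlsenGray.Word c), μ = OlsenGray.multinomial a b T →
        ∀ ν : Measure unitInterval, ν = OlsenGray.grayImage g μ →
          (∀ E : Set unitInterval, MeasurableSet E → ν E = μ (g '' (OlsenGray.gammaMap ⁻¹' E))) ∧
          IsProbabilityMeasure ν ∧
          OlsenGray.IsDoubling ν ∧
          (∀ q : ℝ, OlsenGray.olsenb ν q = OlsenGray.olsenb μ q) ∧
          (∀ q : ℝ, OlsenGray.olsenB ν q = OlsenGray.olsenB μ q) ∧
          (∀ α : ℝ, dimH (OlsenGray.levelSet ν α) = dimH (OlsenGray.levelSet μ α) ∧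
            OlsenGray.packingDim (OlsenGray.levelSet ν α) =
              OlsenGray.packingDim (OlsenGray.levelSet μ α))) ∧
    (∀ a b : Fin 4 → ℝ, OlsenGray.IsTangentPair a b →
      ∀ T : ℕ → ℕ, OlsenGray.IsBlockSeq T → ∀ g ∈ OlsenGray.grayCodes 4,
        ∀ ν : Measure unitInterval, ν = OlsenGray.grayImage g (OlsenGray.multinomial a b T) →
          ∃ lo hi : Fin 4 → ℝ, ((lo = a ∧ hi = b) ∨ (lo = b ∧ hi = a)) ∧
            (⨅ i, hi i) < (⨅ i, lo i) ∧
            (∀ q : ℝ, OlsenGray.olsenb ν q = (OlsenGray.theta lo q : EReal)) ∧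
            (∀ q : ℝ, OlsenGray.olsenB ν q = (OlsenGray.theta hi q : EReal)) ∧
            AnalyticOnNhd ℝ (OlsenGray.theta lo) Set.univ ∧
            AnalyticOnNhd ℝ (OlsenGray.theta hi) Set.univ ∧
            OlsenGray.IsIntersectionOfOrder (OlsenGray.theta lo) (OlsenGray.theta hi) 2 0 1 ∧
            OlsenGray.IsIntersectionOfOrder (OlsenGray.theta lo) (OlsenGray.theta hi) 2 1 0 ∧
            (∀ q : ℝ, q ≠ 0 → q ≠ 1 → OlsenGray.theta lo q < OlsenGray.theta hi q) ∧
            (∀ α ∈ Set.Ioo (-Real.logb 4 (⨆ i, lo i)) (-Real.logb 4 (⨅ i, lo i)),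
              (dimH (OlsenGray.levelSet ν α) : EReal) =
                  OlsenGray.legendre (OlsenGray.olsenb ν) α ∧
              (OlsenGray.packingDim (OlsenGray.levelSet ν α) : EReal) =
                  OlsenGray.legendre (OlsenGray.olsenB ν) α)) ∧
    (∃ a b : Fin 4 → ℝ, OlsenGray.IsTangentPair a b) ∧
    (∃ T : ℕ → ℕ, OlsenGray.IsBlockSeq T) := by
  refine ⟨?_, ?_, OlsenGray.exists_isTangentPair, OlsenGray.exists_isBlockSeq⟩
  · rintro c hc a b ha hb T - g hg μ rfl ν rfl
    have h := OlsenGray.isDoublingCoding_multinomial hc hg ha hb T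
    have := OlsenGray.isProbabilityMeasure_multinomial ha hb T
    refine ⟨fun E hE => h.toIsCoding.grayImage_apply _ hE,
      Measure.isProbabilityMeasure_map h.toIsCoding.measurable.aemeasurable, h.isDoubling,
      h.olsenb_map, h.olsenB_map, fun α => ?_⟩
    rw [h.levelSet_eq α, h.toIsCoding.dimH_preimage, h.toIsCoding.packingDim_preimage]
    exact ⟨rfl, rfl⟩
  · rintro a b hab T hT g hg ν rfl
    have h := OlsenGray.isDoublingCoding_multinomial (by norm_num) hg hab.1 hab.2.1 T
    have := OlsenGray.isProbabilityMeasure_multinomial hab.1 hab.2.1 T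
    obtain ⟨lo, hi, hcases, ht, hlt, P, hP, hP', hμ⟩ := hab.exists_mix hT
    have hb : ∀ q : ℝ, OlsenGray.olsenb (OlsenGray.grayImage g (OlsenGray.multinomial a b T)) q =
        (OlsenGray.theta lo q : EReal) := fun q => (h.olsenb_map q).trans (by
      rw [hμ, OlsenGray.olsenb_mix (by norm_num) ht.1 ht.2.1 hP (ht.theta_le hlt q)])
    have hB : ∀ q : ℝ, OlsenGray.olsenB (OlsenGray.grayImage g (OlsenGray.multinomial a b T)) q =
        (OlsenGray.theta hi q : EReal) := fun q => (h.olsenB_map q).trans (by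
      rw [hμ, OlsenGray.olsenB_mix (by norm_num) ht.1 ht.2.1 hP' (ht.theta_le hlt q)])
    refine ⟨lo, hi, hcases, hlt, hb, hB, OlsenGray.analyticOnNhd_theta (by norm_num) ht.pos_left,
      OlsenGray.analyticOnNhd_theta (by norm_num) ht.pos_right, ?_, ?_,
      fun q h0 h1 => ht.theta_lt hlt h0 h1, fun α hα => ?_⟩
    · simpa using OlsenGray.isIntersectionOfOrder_theta ht (Or.inl rfl)
    · simpa using OlsenGray.isIntersectionOfOrder_theta ht (Or.inr rfl)
    · have key := OlsenGray.dimH_packingDim_levelSet_mix (by norm_num) ht.1 ht.2.1 hP hP'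
        (ht.theta_le hlt) (α := α) (by exact_mod_cast hα)
      rw [← hμ, h.levelSet_eq α, h.toIsCoding.dimH_preimage, h.toIsCoding.packingDim_preimage,
        ← funext hb, ← funext hB] at key
      exact key
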